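/- Let $G=(A\cup B,E)$ be a finite bipartite graph with colour classes $A,B$ and edge weights $w:E\to\mathbb Z_{\ge 0}$, and let $k,p$ be positive integers. A matching is a set $M\subseteq E$ of edges no two of which share an end vertex. For $M_1,\dots,M_k\subseteq E$ put $$d_w(M_1,\dots,M_k)=\sum_{1\le i<j\le k}\ \sum_{e\in M_i\triangle M_j} w(e).$$ The problem Diverse Bipartite Matchings asks, given $(G,w,k,p)$, for $k$ (not necessarily distinct) matchings $M_1,\dots,M_k$ of $G$, each of cardinality exactly $p$, such that $d_w(M_1,\dots,M_k)$ is maximum among all such families. Theorem. Diverse Bipartite Matchings can be solved in polynomial time: there are a program for a random access machine (whose unit-cost operations are addition, subtraction and comparison of integers, and indirect memory access) and a polynomial $q$ such that on every input $(G,w,k,p)$ the program halts after at most $$q\Bigl(|A|+|B|+|E|+k+\langle p\rangle+\sum_{e\in E}\langle w(e)\rangle\Bigr)$$ steps, where $\langle x\rangle$ is the binary length of $x$, and outputs an optimal family $M_1,\dots,M_k$, or reports that $G$ has no matching of cardinality $p$. -/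

import Mathlib

/-! ## A random access machine with a step count

Programs of an integer random access machine with finitely many scalar registers and finitely many
arrays, with sequencing, branching and loops.  The arithmetic operations are addition and
subtraction only: in `t` steps the bit length of the numbers grows by at most `O(t)`, so that
counting every elementary operation as one step gives the usual notion of polynomial time
(polynomially equivalent to multitape Turing machines and to logarithmic cost). -/

namespace RAM

/-- A memory state: register `x` holds `reg x`, cell `i` of array `a` holds `mem a i`. -/
structure State where
  reg : ℕ → ℤ
  mem : ℕ → ℤ → ℤ

/-- Write `v` into register `x`. -/
def State.setReg (s : State) (x : ℕ) (v : ℤ) : State :=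
  { s with reg := Function.update s.reg x v }

/-- Write `v` into cell `i` of array `a`. -/
def State.setMem (s : State) (a : ℕ) (i v : ℤ) : State :=
  { s with mem := Function.update s.mem a (Function.update (s.mem a) i v) }

/-- Integer expressions: constants, registers, array cells (indirect addressing), `+` and `-`. -/
inductive Expr where
  | const (c : ℤ)
  | reg (x : ℕ)
  | read (a : ℕ) (i : Expr)
  | add (e f : Expr)
  | sub (e f : Expr)

/-- The value of an expression. -/
def Expr.eval (s : State) : Expr → ℤ
  | const c => c
  | reg x => s.reg x
  | read a i => s.mem a (i.eval s)
  | add e f => e.eval s + f.eval s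
  | sub e f => e.eval s - f.eval s

/-- The number of elementary operations in the evaluation of an expression. -/
def Expr.cost : Expr → ℕ
  | const _ => 1
  | reg _ => 1
  | read _ i => i.cost + 1
  | add e f => e.cost + f.cost + 1
  | sub e f => e.cost + f.cost + 1

/-- Boolean tests. -/
inductive Test where
  | lt (e f : Expr)
  | eq (e f : Expr)
  | not (b : Test)
  | and (b c : Test)

/-- The truth value of a test. -/
def Test.Holds (s : State) : Test → Prop
  | lt e f => e.eval s < f.eval s
  | eq e f => e.eval s = f.eval s
  | not b => ¬ b.Holds s
  | and b c => b.Holds s ∧ c.Holds s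

/-- The number of elementary operations in the evaluation of a test. -/
def Test.cost : Test → ℕ
  | lt e f => e.cost + f.cost + 1
  | eq e f => e.cost + f.cost + 1
  | not b => b.cost + 1
  | and b c => b.cost + c.cost + 1

/-- Programs. -/
inductive Prog where
  | skip
  | assign (x : ℕ) (e : Expr)
  | store (a : ℕ) (i e : Expr)
  | seq (P Q : Prog)
  | branch (b : Test) (P Q : Prog)
  | loop (b : Test) (P : Prog)

/-- `Exec P s t s'`: started in state `s`, the program `P` halts in state `s'` after exactly `t`
elementary steps. -/
inductive Exec : Prog → State → ℕ → State → Prop where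
  | skip (s : State) : Exec .skip s 1 s
  | assign (s : State) (x : ℕ) (e : Expr) :
      Exec (.assign x e) s (e.cost + 1) (s.setReg x (e.eval s))
  | store (s : State) (a : ℕ) (i e : Expr) :
      Exec (.store a i e) s (i.cost + e.cost + 1) (s.setMem a (i.eval s) (e.eval s))
  | seq {P Q : Prog} {s s' s'' : State} {t t' : ℕ} :
      Exec P s t s' → Exec Q s' t' s'' → Exec (.seq P Q) s (t + t') s''
  | branch_true {b : Test} {P Q : Prog} {s s' : State} {t : ℕ} :
      b.Holds s → Exec P s t s' → Exec (.branch b P Q) s (b.cost + t + 1) s'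
  | branch_false {b : Test} {P Q : Prog} {s s' : State} {t : ℕ} :
      ¬ b.Holds s → Exec Q s t s' → Exec (.branch b P Q) s (b.cost + t + 1) s'
  | loop_false {b : Test} {P : Prog} {s : State} :
      ¬ b.Holds s → Exec (.loop b P) s (b.cost + 1) s
  | loop_true {b : Test} {P : Prog} {s s' s'' : State} {t t' : ℕ} :
      b.Holds s → Exec P s t s' → Exec (.loop b P) s' t' s'' →
      Exec (.loop b P) s (b.cost + t + t' + 1) s''

end RAM

/-! ## Diverse bipartite matchings -/

/-- The diversity `d_w(S_1, …, S_k) = ∑_{i < j} w(S_i ∆ S_j)`. -/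
def diversity {U : Type*} [DecidableEq U] (w : U → ℤ) {k : ℕ} (S : Fin k → Finset U) : ℤ :=
  ∑ i : Fin k, ∑ j ∈ Finset.Ioi i, ∑ e ∈ symmDiff (S i) (S j), w e

/-- An edge-weighted (simple) bipartite graph with colour classes `A = {0, …, numA - 1}` and
`B = {0, …, numB - 1}`, given by the list of its edges: edge `e` joins `endA e` and `endB e`. -/
structure WeightedBipartiteGraph where
  numA : ℕ
  numB : ℕ
  numE : ℕ
  endA : Fin numE → Fin numA
  endB : Fin numE → Fin numB
  simple : Function.Injective fun e => (endA e, endB e)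
  weight : Fin numE → ℤ

/-- A set of edges no two of which share an end vertex. -/
def WeightedBipartiteGraph.IsMatching (G : WeightedBipartiteGraph)
    (M : Finset (Fin G.numE)) : Prop :=
  ∀ e ∈ M, ∀ f ∈ M, e ≠ f → G.endA e ≠ G.endA f ∧ G.endB e ≠ G.endB f

/-- An instance of Diverse Bipartite Matchings. -/
structure DiverseMatchingInstance extends WeightedBipartiteGraph where
  k : ℕ
  p : ℕ
  k_pos : 0 < k
  p_pos : 0 < p

namespace DiverseMatchingInstance

variable (I : DiverseMatchingInstance)

/-- A family of `k` matchings, each of cardinality exactly `p`. -/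
def IsFeasible (M : Fin I.k → Finset (Fin I.numE)) : Prop :=
  ∀ i, I.IsMatching (M i) ∧ (M i).card = I.p

/-- A feasible family of maximum diversity. -/
def IsOptimal (M : Fin I.k → Finset (Fin I.numE)) : Prop :=
  I.IsFeasible M ∧ ∀ M', I.IsFeasible M' → diversity I.weight M' ≤ diversity I.weight M

/-- The size of an instance: the numbers of vertices and edges, the number `k` of matchings that
have to be written down, and the bit lengths of `p` and of the weights. -/
def size : ℕ :=
  I.numA + I.numB + I.numE + I.k + Nat.size I.p + ∑ e, Nat.size (I.weight e).natAbs

/-- The input: registers `0, …, 4` hold `|A|, |B|, |E|, k, p`; cell `e` of the arrays `0, 1, 2`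
holds the two end vertices and the weight of the edge `e`; everything else is `0`. -/
def input : RAM.State where
  reg x := match x with
    | 0 => I.numA
    | 1 => I.numB
    | 2 => I.numE
    | 3 => I.k
    | 4 => I.p
    | _ => 0
  mem a j :=
    if h : 0 ≤ j ∧ j.toNat < I.numE then
      match a with
      | 0 => (I.endA ⟨j.toNat, h.2⟩ : ℕ)
      | 1 => (I.endB ⟨j.toNat, h.2⟩ : ℕ)
      | 2 => I.weight ⟨j.toNat, h.2⟩
      | _ => 0
    else 0

/-- The `k` edge sets written in array `3`: cell `i * |E| + e` is `1` iff edge `e` is in the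
`i`-th set. -/
def output (s : RAM.State) (i : Fin I.k) : Finset (Fin I.numE) :=
  Finset.univ.filter fun e => s.mem 3 ((i : ℤ) * I.numE + (e : ℤ)) = 1

/-- Correct final states: register `0` holds `1` and array `3` describes an optimal family, or
register `0` holds `0` and there is no feasible family. -/
def Correct (s : RAM.State) : Prop :=
  (s.reg 0 = 1 ∧ I.IsOptimal (I.output s)) ∨ (s.reg 0 = 0 ∧ ∀ M, ¬ I.IsFeasible M)

end DiverseMatchingInstance

/-!
Diverse Bipartite Matchings is a transportation problem with a separable convex cost, small enough
to be solved one unit at a time.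

*Reduction.* If the edge `e` lies in `c e` of the `k` sets, then it is counted `c e * (k - c e)`
times in the diversity (`diversity_eq`), so the diversity is a separable concave function of the
vector `c`. Complete the bipartite graph with `numB - p` dummy rows and `numA - p` dummy columns, so
that there are `N = numA + numB - p` rows and columns. A matching of cardinality `p` extends to a
permutation matrix that uses edges and pairs of a vertex and a dummy; conversely a permutation
matrix that uses no other pairs restricts to a matching of cardinality `p` (`IsPerm.isMatching`).
Thus families of matchings become nonnegative integral `N × N` matrices with all margins `k`, where
the remaining pairs are forbidden and cost `1 + k ^ 2 * ∑ w` per unit, more than any diversity.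

*Optimality.* The transportation problem is solved together with a dual solution
(`TransportOpt`). Its marginal costs bound the convex costs from below, and the dual solution is
orthogonal to differences of matrices with equal margins, which bounds the diversity of every
feasible family (`objective_le`); for this it suffices to extend the counting vector of the family
fractionally to the dummies (`exists_extension`). A solution that uses a forbidden pair hence shows
that there is no feasible family (`not_isFeasible_of_forbidden`), and any decomposition of a
solution that uses none into permutation matrices is an optimal family
(`isOptimal_of_decomposition`). The permutation matrices are found by the same algorithm with
margins `1` and costs `-1` on the support: by duality the result lies in the support, because the
remaining matrix divided by its margins is a fractional solution inside it
(`le_of_transportOpt_support`).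

*Algorithm.* One unit is sent from a row to a column with demand as in the primal-dual method: from
the row a tree of residual arcs that are tight for the potential is grown, the potential outside
the tree being raised by the least slack of a leaving arc (`TightTree.grow`), until it reaches a
column with demand; then a unit is pushed along the tree path (`ResidualFlow.push`,
`augment_spec`). Margins `k` take `N * k` augmentations, however large the weights
are.

*Running time.* All programs consist of counted loops (`FProg`) whose bounds are linear in the size
of the instance. Such a program computes a function of the state given by structural recursion, and
its number of steps is bounded by a polynomial in the bound for its loops (`exec_compile`).
-/

/-! ### Structured programs with counted loops -/

namespace RAM

@[simp] theorem State.setReg_reg (s : State) (x y : ℕ) (v : ℤ) :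
    (s.setReg x v).reg y = if y = x then v else s.reg y := by
  simp [State.setReg, Function.update_apply]

@[simp] theorem State.setReg_mem (s : State) (x : ℕ) (v : ℤ) : (s.setReg x v).mem = s.mem := rfl

@[simp] theorem State.setMem_reg (s : State) (a : ℕ) (i v : ℤ) :
    (s.setMem a i v).reg = s.reg := rfl

@[simp] theorem State.setMem_mem (s : State) (a b : ℕ) (i v : ℤ) :
    (s.setMem a i v).mem b = if b = a then Function.update (s.mem a) i v else s.mem b := by
  by_cases h : b = a
  · subst h; simp [State.setMem]
  · simp [State.setMem, h]

theorem State.setMem_self (s : State) (a : ℕ) (i : ℤ) : s.setMem a i (s.mem a i) = s := by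
  simp [State.setMem]

/-- Programs whose only loops are counted loops: `forTo x n P` runs `P` with register `x` equal to
`0, 1, …, reg n - 1`. -/
inductive FProg where
  | skip
  | assign (x : ℕ) (e : Expr)
  | store (a : ℕ) (i e : Expr)
  | seq (P Q : FProg)
  | ite (b : Test) (P Q : FProg)
  | forTo (x n : ℕ) (P : FProg)

namespace FProg

/-- Sequential composition of programs. -/
scoped infixr:60 " ;; " => FProg.seq

/-- The random access machine program of a structured program. -/
def compile : FProg → Prog
  | skip => .skip
  | assign x e => .assign x e
  | store a i e => .store a i e
  | seq P Q => .seq P.compile Q.compile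
  | ite b P Q => .branch b P.compile Q.compile
  | forTo x n P =>
      .seq (.assign x (.const 0))
        (.loop (.lt (.reg x) (.reg n))
          (.seq P.compile (.assign x (.add (.reg x) (.const 1)))))

/-- The registers that a program may write. -/
def writes : FProg → List ℕ
  | skip => []
  | assign x _ => [x]
  | store _ _ _ => []
  | seq P Q => P.writes ++ Q.writes
  | ite _ P Q => P.writes ++ Q.writes
  | forTo x _ P => x :: P.writes

/-- The arrays that a program may write. -/
def arrs : FProg → List ℕ
  | skip => []
  | assign _ _ => []
  | store a _ _ => [a]
  | seq P Q => P.arrs ++ Q.arrs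
  | ite _ P Q => P.arrs ++ Q.arrs
  | forTo _ _ P => P.arrs

open Classical in
/-- The state transformation computed by a program. It is meaningful for programs whose loops do
not write their own counter or bound (see `FProg.WF`). -/
noncomputable def den : FProg → State → State
  | skip, s => s
  | assign x e, s => s.setReg x (e.eval s)
  | store a i e, s => s.setMem a (i.eval s) (e.eval s)
  | seq P Q, s => Q.den (P.den s)
  | ite b P Q, s => if b.Holds s then P.den s else Q.den s
  | forTo x n P, s =>
      Nat.rec (s.setReg x 0) (fun i s' => (P.den s').setReg x (i + 1)) (s.reg n).toNat

@[simp] theorem den_skip (s : State) : skip.den s = s := rfl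

@[simp] theorem den_assign (x : ℕ) (e : Expr) (s : State) :
    (assign x e).den s = s.setReg x (e.eval s) := rfl

@[simp] theorem den_store (a : ℕ) (i e : Expr) (s : State) :
    (store a i e).den s = s.setMem a (i.eval s) (e.eval s) := rfl

@[simp] theorem den_seq (P Q : FProg) (s : State) : (seq P Q).den s = Q.den (P.den s) := rfl

open Classical in
@[simp] theorem den_ite (b : Test) (P Q : FProg) (s : State) :
    (ite b P Q).den s = if b.Holds s then P.den s else Q.den s := rfl

/-- Loop bounds are among the registers `L`, these are never written, and the body of a loop does
not write its counter. -/
def WF (L : List ℕ) : FProg → Prop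
  | skip => True
  | assign x _ => x ∉ L
  | store _ _ _ => True
  | seq P Q => P.WF L ∧ Q.WF L
  | ite _ P Q => P.WF L ∧ Q.WF L
  | forTo x n P => n ∈ L ∧ x ∉ L ∧ x ∉ P.writes ∧ P.WF L

instance decidableWF (L : List ℕ) : (P : FProg) → Decidable (P.WF L)
  | skip => isTrue trivial
  | assign x _ => inferInstanceAs (Decidable (x ∉ L))
  | store _ _ _ => isTrue trivial
  | seq P Q => @instDecidableAnd _ _ (decidableWF L P) (decidableWF L Q)
  | ite _ P Q => @instDecidableAnd _ _ (decidableWF L P) (decidableWF L Q)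
  | forTo x n P =>
      @instDecidableAnd (n ∈ L) _ _ <| @instDecidableAnd (x ∉ L) _ _ <|
        @instDecidableAnd (x ∉ P.writes) _ _ (decidableWF L P)

/-- `Agree R A s s'`: the states differ at most in the registers `R` and the arrays `A`. -/
structure Agree (R A : List ℕ) (s s' : State) : Prop where
  reg : ∀ x, x ∉ R → s'.reg x = s.reg x
  mem : ∀ a, a ∉ A → s'.mem a = s.mem a

theorem Agree.refl (R A : List ℕ) (s : State) : Agree R A s s := ⟨fun _ _ => rfl, fun _ _ => rfl⟩

theorem Agree.trans {R A : List ℕ} {s s' s'' : State} (h : Agree R A s s')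
    (h' : Agree R A s' s'') : Agree R A s s'' :=
  ⟨fun x hx => (h'.reg x hx).trans (h.reg x hx), fun a ha => (h'.mem a ha).trans (h.mem a ha)⟩

theorem Agree.mono {R A R' A' : List ℕ} {s s' : State} (h : Agree R A s s') (hR : R ⊆ R')
    (hA : A ⊆ A') : Agree R' A' s s' :=
  ⟨fun x hx => h.reg x fun h' => hx (hR h'), fun a ha => h.mem a fun h' => ha (hA h')⟩

theorem Agree.setReg {R A : List ℕ} {s s' : State} (h : Agree R A s s') {x : ℕ} (v : ℤ)
    (hx : x ∈ R) : Agree R A s (s'.setReg x v) := by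
  refine ⟨fun y hy => ?_, h.mem⟩
  have : y ≠ x := fun h => hy (h ▸ hx)
  simp [this, h.reg y hy]

theorem Agree.setMem {R A : List ℕ} {s s' : State} (h : Agree R A s s') {a : ℕ} (i v : ℤ)
    (ha : a ∈ A) : Agree R A s (s'.setMem a i v) := by
  refine ⟨h.reg, fun b hb => ?_⟩
  have : b ≠ a := fun h => hb (h ▸ ha)
  simp [this, h.mem b hb]

theorem agree_den (P : FProg) (s : State) : Agree P.writes P.arrs s (P.den s) := by
  induction P generalizing s with
  | skip => exact .refl _ _ _
  | assign x e => exact (Agree.refl _ _ s).setReg _ (by simp [writes])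
  | store a i e => exact (Agree.refl _ _ s).setMem _ _ (by simp [arrs])
  | seq P Q hP hQ =>
    exact ((hP s).mono (by simp [writes]) (by simp [arrs])).trans
      ((hQ _).mono (by simp [writes]) (by simp [arrs]))
  | ite b P Q hP hQ =>
    simp only [den]
    split_ifs
    · exact (hP s).mono (by simp [writes]) (by simp [arrs])
    · exact (hQ s).mono (by simp [writes]) (by simp [arrs])
  | forTo x n P hP =>
    simp only [den]
    induction (s.reg n).toNat with
    | zero => exact (Agree.refl _ _ s).setReg _ (by simp [writes])
    | succ m ih =>
      exact (ih.trans ((hP _).mono (by simp [writes]) (by simp [arrs]))).setReg _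
        (by simp [writes])

/-- The invariant rule for counted loops. In the step the state may be assumed to differ from the
initial one only in what the loop writes. -/
theorem forTo_rule {x n : ℕ} {P : FProg} {s : State} (Inv : ℕ → State → Prop)
    (h0 : Inv 0 (s.setReg x 0))
    (hs : ∀ (i : ℕ) (s' : State), (i : ℤ) < s.reg n → Agree (x :: P.writes) P.arrs s s' →
      s'.reg x = i → Inv i s' → Inv (i + 1) ((P.den s').setReg x (i + 1))) :
    Inv (s.reg n).toNat ((forTo x n P).den s) := by
  simp only [den]
  have key : ∀ m : ℕ, (m : ℤ) ≤ max (s.reg n) 0 →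
      let s' : State := Nat.rec (s.setReg x 0) (fun i s' => (P.den s').setReg x (i + 1)) m
      Inv m s' ∧ s'.reg x = m ∧ Agree (x :: P.writes) P.arrs s s' := by
    intro m
    induction m with
    | zero => exact fun _ => ⟨h0, by simp, (Agree.refl _ _ s).setReg _ (by simp)⟩
    | succ m ih =>
      intro hm
      obtain ⟨h1, h2, h3⟩ := ih (by push_cast at hm; omega)
      refine ⟨hs m _ (by push_cast at hm; omega) h3 h2 h1, by simp, ?_⟩
      exact (h3.trans ((agree_den P _).mono (by simp) (by simp))).setReg _ (by simp)
  exact (key _ (by omega)).1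

/-- The invariant rule for two nested loops over the same range. -/
theorem forTo_forTo_rule {x y n : ℕ} {P : FProg} {s : State} (Inv : ℕ → ℕ → State → Prop)
    (hxy : x ≠ y) (hn : n ∉ x :: y :: P.writes) (hx : x ∉ P.writes)
    (h0 : Inv 0 0 (s.setReg x 0))
    (hrow : ∀ (i : ℕ) (s' : State), Inv i 0 s' → Inv i 0 (s'.setReg y 0))
    (hs : ∀ (i j : ℕ) (s' : State), (i : ℤ) < s.reg n → (j : ℤ) < s.reg n →
      Agree (x :: y :: P.writes) P.arrs s s' → s'.reg x = i → s'.reg y = j → Inv i j s' →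
      Inv i (j + 1) ((P.den s').setReg y (j + 1)))
    (hnext : ∀ (i : ℕ) (s' : State), Inv i (s.reg n).toNat s' →
      Inv (i + 1) 0 (s'.setReg x (i + 1))) :
    Inv (s.reg n).toNat 0 ((forTo x n (forTo y n P)).den s) := by
  refine forTo_rule (fun i s' => Inv i 0 s') h0 ?_
  intro i s' hi hag hxi hI
  have hns : s'.reg n = s.reg n := hag.reg n (by simpa [writes] using hn)
  refine hnext i _ ?_
  rw [← hns]
  refine (forTo_rule (fun j s'' => s''.reg x = i ∧ Inv i j s'')
    ⟨by simp [hxy, hxi], hrow i s' hI⟩ ?_).2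
  rintro j s'' hj hag' hy ⟨hx', hI'⟩
  refine ⟨by simp [hxy, (agree_den P s'').reg x hx, hx'], ?_⟩
  exact hs i j s'' hi (hns ▸ hj) ((hag.mono (by simp [writes]) (by simp [arrs])).trans
    (hag'.mono (by simp) (by simp))) hx' hy hI'

/-- A bound for the running time, as a polynomial in an upper bound for all loop bounds. Besides its
body, an iteration takes 8 steps for the test and the increment of the counter; the first assignment
and the last test take 6 steps. -/
noncomputable def time : FProg → Polynomial ℕ
  | skip => 1
  | assign _ e => Polynomial.C (e.cost + 1)
  | store _ i e => Polynomial.C (i.cost + e.cost + 1)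
  | seq P Q => P.time + Q.time
  | ite b P Q => Polynomial.C (b.cost + 1) + P.time + Q.time
  | forTo _ _ P => Polynomial.C 6 + Polynomial.X * (P.time + Polynomial.C 8)

/-- The loop of a counted loop runs through the states `S i` before its iterations. -/
theorem exec_loop {x n : ℕ} {P : FProg} {T N : ℕ} {S : ℕ → State}
    (hS : ∀ i, S (i + 1) = (P.den (S i)).setReg x (i + 1)) (hx : ∀ i, (S i).reg x = i)
    (hxP : x ∉ P.writes) (hn : ∀ i, ((S i).reg n).toNat = N)
    (ih : ∀ i, ∃ t ≤ T, Exec P.compile (S i) t (P.den (S i))) (m : ℕ) :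
    ∀ i : ℕ, i + m = N → ∃ t ≤ m * (T + 8) + 4,
      Exec (.loop (.lt (.reg x) (.reg n))
        (.seq P.compile (.assign x (.add (.reg x) (.const 1))))) (S i) t (S N) := by
  induction m with
  | zero =>
    rintro i rfl
    refine ⟨4, by simp, Exec.loop_false ?_⟩
    have := hn i
    simp only [Test.Holds, Expr.eval, hx]
    omega
  | succ m ihm =>
    intro i hi
    obtain ⟨t, ht, hex⟩ := ih i
    obtain ⟨t', ht', hex'⟩ := ihm (i + 1) (by omega)
    have hstep : Exec (.seq P.compile (.assign x (.add (.reg x) (.const 1)))) (S i) (t + 4)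
        (S (i + 1)) := by
      have h := Exec.assign (P.den (S i)) x (.add (.reg x) (.const 1))
      simp only [Expr.eval, (agree_den P (S i)).reg x hxP, hx, Expr.cost, ← hS] at h
      exact hex.seq h
    refine ⟨3 + (t + 4) + t' + 1, ?_, Exec.loop_true ?_ hstep hex'⟩
    · rw [Nat.succ_mul]; omega
    · have := hn i
      simp only [Test.Holds, Expr.eval, hx]
      omega

theorem not_mem_writes_of_WF {L : List ℕ} {P : FProg} (h : P.WF L) : ∀ r ∈ L, r ∉ P.writes := by
  intro r hr
  induction P with
  | skip => simp [writes]
  | assign x e => simp only [WF] at h; rintro h'; simp [writes] at h'; exact h (h' ▸ hr)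
  | store => simp [writes]
  | seq P Q hP hQ => simp [writes, hP h.1, hQ h.2]
  | ite b P Q hP hQ => simp [writes, hP h.1, hQ h.2]
  | forTo x n P hP =>
    obtain ⟨h1, h2, h3, h4⟩ := h
    have : r ≠ x := fun h => h2 (h ▸ hr)
    simp [writes, hP h4, this]

/-- A well-formed program computes `FProg.den`, within the time bound `FProg.time`. -/
theorem exec_compile {L : List ℕ} {P : FProg} (h : P.WF L) (B : ℕ) (s : State)
    (hB : ∀ r ∈ L, s.reg r ≤ B) : ∃ t ≤ P.time.eval B, Exec P.compile s t (P.den s) := by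
  induction P generalizing s with
  | skip => exact ⟨1, by simp [time], .skip s⟩
  | assign x e => exact ⟨_, by simp [time], .assign s x e⟩
  | store a i e => exact ⟨_, by simp [time], .store s a i e⟩
  | seq P Q hP hQ =>
    obtain ⟨t, ht, he⟩ := hP h.1 s hB
    obtain ⟨t', ht', he'⟩ := hQ h.2 (P.den s) fun r hr =>
      ((agree_den P s).reg r (not_mem_writes_of_WF h.1 r hr)).le.trans (hB r hr)
    exact ⟨t + t', by simp only [time, Polynomial.eval_add]; omega, he.seq he'⟩
  | ite b P Q hP hQ =>
    obtain ⟨t, ht, he⟩ := hP h.1 s hB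
    obtain ⟨t', ht', he'⟩ := hQ h.2 s hB
    by_cases hb : b.Holds s
    · refine ⟨b.cost + t + 1, ?_, ?_⟩
      · simp only [time, Polynomial.eval_add, Polynomial.eval_C]; omega
      · simp only [den, hb, if_true]; exact .branch_true hb he
    · refine ⟨b.cost + t' + 1, ?_, ?_⟩
      · simp only [time, Polynomial.eval_add, Polynomial.eval_C]; omega
      · simp only [den, hb, if_false]; exact .branch_false hb he'
  | forTo x n P hP =>
    obtain ⟨h1, h2, h3, h4⟩ := h
    have hW := not_mem_writes_of_WF h4
    let S : ℕ → State := fun m =>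
      Nat.rec (s.setReg x 0) (fun i s' => (P.den s').setReg x (i + 1)) m
    have hSL : ∀ i, ∀ r ∈ L, (S i).reg r = s.reg r := by
      intro i r hr
      have hrx : r ≠ x := fun h => h2 (h ▸ hr)
      induction i with
      | zero => simp [S, hrx]
      | succ i ih =>
        change ((P.den (S i)).setReg x (i + 1)).reg r = _
        simp [hrx, (agree_den P (S i)).reg r (hW r hr), ih]
    obtain ⟨t, ht, he⟩ := exec_loop (x := x) (n := n) (P := P) (N := (s.reg n).toNat) (S := S)
      (fun _ => rfl) (fun i => by cases i <;> simp [S]) h3 (fun i => by rw [hSL i n h1])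
      (fun i => hP h4 (S i) fun r hr => (hSL i r hr).le.trans (hB r hr)) _ 0 (Nat.zero_add _)
    refine ⟨_, ?_, .seq (.assign s x (.const 0)) he⟩
    · simp only [time, Polynomial.eval_add, Polynomial.eval_mul, Polynomial.eval_C,
        Polynomial.eval_X, Expr.cost]
      have : (s.reg n).toNat ≤ B := by have := hB n h1; omega
      have := Nat.mul_le_mul_right (Polynomial.eval B P.time + 8) this
      omega

/-- A loop whose iterations write `F i` into cell `i` of an array, for `i = 0, 1, …`. -/
theorem fill1 {x n a : ℕ} {P : FProg} {s : State} (F : ℤ → ℤ)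
    (hb : ∀ (i : ℤ) (s' : State), 0 ≤ i → i < s.reg n → Agree [x] [a] s s' → s'.reg x = i →
      s'.mem a i = s.mem a i → P.den s' = s'.setMem a i (F i)) :
    Agree [x] [a] s ((forTo x n P).den s) ∧
      ∀ i, 0 ≤ i → i < s.reg n → ((forTo x n P).den s).mem a i = F i := by
  have := forTo_rule (x := x) (n := n) (P := P) (s := s)
    (fun i s' => Agree [x] [a] s s' ∧ (∀ j : ℤ, 0 ≤ j → j < i → s'.mem a j = F j) ∧
      ∀ j : ℤ, i ≤ j → s'.mem a j = s.mem a j)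
    ⟨(Agree.refl _ _ s).setReg _ (by simp), by intros; omega, by simp⟩
    (by
      rintro i s' hi - hx ⟨h1, h2, h3⟩
      have := hb i s' (by omega) hi h1 hx (h3 i le_rfl)
      rw [this]
      refine ⟨(h1.setMem _ _ (by simp)).setReg _ (by simp), ?_, ?_⟩
      · intro j hj hji
        push_cast at hji
        by_cases hjj : j = i
        · subst hjj; simp
        · simp only [State.setReg_mem, State.setMem_mem, if_true, Function.update_of_ne hjj]
          exact h2 j hj (by omega)
      · intro j hji
        push_cast at hji
        have hjj : j ≠ i := by omega
        simp only [State.setReg_mem, State.setMem_mem, if_true, Function.update_of_ne hjj]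
        exact h3 j (by omega))
  refine ⟨this.1, fun i h0 hi => this.2.1 i h0 (by omega)⟩

end FProg

/-! ### Matrices in arrays -/

/-- The matrix with row length `n` that is stored in an array row by row. -/
def mat (n : ℤ) (m : ℤ → ℤ) (x y : ℤ) : ℤ := m (x * n + y)

theorem index_inj {n x y u v : ℤ} (hy : 0 ≤ y) (hy' : y < n) (hv : 0 ≤ v) (hv' : v < n) :
    x * n + y = u * n + v ↔ x = u ∧ y = v := by
  refine ⟨fun h => ?_, fun h => by rw [h.1, h.2]⟩
  have hxu : x = u := by
    rcases lt_trichotomy x u with h' | h' | h'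
    · nlinarith
    · exact h'
    · nlinarith
  subst hxu
  exact ⟨rfl, by omega⟩

theorem mat_update {n x y u v : ℤ} (m : ℤ → ℤ) (a : ℤ) (hy : 0 ≤ y) (hy' : y < n) (hv : 0 ≤ v)
    (hv' : v < n) :
    mat n (Function.update m (x * n + y) a) u v = if u = x ∧ v = y then a else mat n m u v := by
  simp only [mat, Function.update_apply, index_inj hv hv' hy hy']

namespace FProg

/-- A double loop whose iterations write the entries `F i j` of a square matrix. -/
theorem fill2 {x y n a : ℕ} {P : FProg} {s : State} (F : ℤ → ℤ → ℤ)
    (hxy : x ≠ y) (hn : n ∉ [x, y])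
    (hb : ∀ (i j : ℤ) (s' : State), 0 ≤ i → i < s.reg n → 0 ≤ j → j < s.reg n →
      Agree [x, y] [a] s s' → s'.reg x = i → s'.reg y = j →
      mat (s.reg n) (s'.mem a) i j = mat (s.reg n) (s.mem a) i j →
      P.den s' = s'.setMem a (i * s.reg n + j) (F i j)) :
    Agree [x, y] [a] s ((forTo x n (forTo y n P)).den s) ∧
      ∀ i j, 0 ≤ i → i < s.reg n → 0 ≤ j → j < s.reg n →
        mat (s.reg n) (((forTo x n (forTo y n P)).den s).mem a) i j = F i j := by
  have := forTo_rule (x := x) (n := n) (P := forTo y n P) (s := s)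
    (fun i s' => Agree [x, y] [a] s s' ∧
      ∀ u v : ℤ, 0 ≤ u → 0 ≤ v → v < s.reg n →
        mat (s.reg n) (s'.mem a) u v = if u < i then F u v else mat (s.reg n) (s.mem a) u v)
    ⟨(Agree.refl _ _ s).setReg _ (by simp), by intro u v hu hv hv'; simp; intro; omega⟩
    (by
      rintro i s' hi - hx ⟨h1, h2⟩
      have hns : s'.reg n = s.reg n := h1.reg n hn
      have := forTo_rule (x := y) (n := n) (P := P) (s := s')
        (fun j s'' => Agree [x, y] [a] s s'' ∧ s''.reg x = i ∧
          ∀ u v : ℤ, 0 ≤ u → 0 ≤ v → v < s.reg n →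
            mat (s.reg n) (s''.mem a) u v =
              if u < i ∨ u = i ∧ v < j then F u v else mat (s.reg n) (s.mem a) u v)
        ⟨h1.setReg _ (by simp), by simp [hxy, hx], by
          intro u v hu hv hv'
          simp only [State.setReg_mem, h2 u v hu hv hv']
          congr 1
          simp only [eq_iff_iff]; omega⟩
        (by
          rintro j s'' hj - hy ⟨g1, g2, g3⟩
          rw [hns] at hj
          have := hb i j s'' (by omega) hi (by omega) hj g1 g2 hy
            (by rw [g3 i j (by omega) (by omega) hj, if_neg (by omega)])
          rw [this]
          refine ⟨(g1.setMem _ _ (by simp)).setReg _ (by simp), by simp [hxy, g2], ?_⟩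
          intro u v hu hv hv'
          simp only [State.setReg_mem, State.setMem_mem, if_true]
          rw [mat_update _ _ (by omega) hj hv hv', g3 u v hu hv hv']
          push_cast
          split_ifs with c1 c2 c3 c2 c3
          · rw [c1.1, c1.2]
          · omega
          · rfl
          · omega
          · omega
          · rfl)
      obtain ⟨t1, t2, t3⟩ := this
      refine ⟨t1.setReg _ (by simp), ?_⟩
      intro u v hu hv hv'
      simp only [State.setReg_mem, t3 u v hu hv hv']
      congr 1
      push_cast
      simp only [eq_iff_iff, hns]; omega)
  refine ⟨this.1, fun i j h0 hi hj0 hj => ?_⟩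
  rw [this.2 i j h0 hj0 hj, if_pos (by omega)]

end FProg

end RAM

/-! ### Residual networks, pushing a unit and growing a tree of tight arcs -/

namespace DiverseMatching

open Finset

/-- The constant data of a residual network on the nodes `0, …, n - 1`: `cap x y` is the sum of the
residual capacities of `(x, y)` and `(y, x)`, and the cost of the next unit on `(x, y)` is
`A x y + d x y * r` when `(y, x)` has residual capacity `r`. The last field says that sending a
unit forth and back costs nothing, so that `d` is the second difference of a convex cost. -/
structure ResidualNetwork (n : ℤ) (cap A d : ℤ → ℤ → ℤ) : Prop where
  cap_self : ∀ x ∈ Ico 0 n, cap x x = 0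
  d_nonneg : ∀ x ∈ Ico 0 n, ∀ y ∈ Ico 0 n, 0 ≤ d x y
  d_symm : ∀ x ∈ Ico 0 n, ∀ y ∈ Ico 0 n, d x y = d y x
  balance : ∀ x ∈ Ico 0 n, ∀ y ∈ Ico 0 n, 0 < cap x y →
    A x y + A y x + d x y * cap x y = d x y

/-- A state of the network: residual capacities `res`, costs `cst` of the next units, a feasible
potential `π`, and total residual capacities `out` of the arcs that leave a node. -/
structure ResidualFlow (n : ℤ) (cap A d : ℤ → ℤ → ℤ) (res cst : ℤ → ℤ → ℤ) (π out : ℤ → ℤ) :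
    Prop where
  res_nonneg : ∀ x ∈ Ico 0 n, ∀ y ∈ Ico 0 n, 0 ≤ res x y
  res_add : ∀ x ∈ Ico 0 n, ∀ y ∈ Ico 0 n, res x y + res y x = cap x y
  cst_eq : ∀ x ∈ Ico 0 n, ∀ y ∈ Ico 0 n, cst x y = A x y + d x y * res y x
  pot : ∀ x ∈ Ico 0 n, ∀ y ∈ Ico 0 n, 0 < res x y → π y ≤ π x + cst x y
  sum_res : ∀ x ∈ Ico 0 n, ∑ y ∈ Ico 0 n, res x y = out x

section ResidualNetwork

variable {n : ℤ} {cap A d res cst : ℤ → ℤ → ℤ} {π out : ℤ → ℤ}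

theorem ResidualFlow.ne (hN : ResidualNetwork n cap A d)
    (hF : ResidualFlow n cap A d res cst π out) {x y : ℤ} (hx : x ∈ Ico 0 n)
    (hr : 0 < res x y) : x ≠ y := by
  rintro rfl
  have := hF.res_add x hx x hx
  rw [hN.cap_self x hx] at this
  omega

/-- Pushing a unit along a tight residual arc keeps the potential feasible, because the cost of the
reverse arc becomes the negative of the old cost. -/
theorem ResidualFlow.push (hN : ResidualNetwork n cap A d)
    (hF : ResidualFlow n cap A d res cst π out) {x y : ℤ} (hx : x ∈ Ico 0 n)
    (hy : y ∈ Ico 0 n) (hr : 0 < res x y) (ht : π y = π x + cst x y)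
    {res' cst' : ℤ → ℤ → ℤ} {out' : ℤ → ℤ}
    (hres : ∀ u ∈ Ico 0 n, ∀ v ∈ Ico 0 n, res' u v =
      if u = y ∧ v = x then res y x + 1 else if u = x ∧ v = y then res x y - 1 else res u v)
    (hcst : ∀ u ∈ Ico 0 n, ∀ v ∈ Ico 0 n, cst' u v =
      if u = y ∧ v = x then cst y x - d x y else if u = x ∧ v = y then cst x y + d x y
        else cst u v)
    (hout : ∀ u ∈ Ico 0 n, out' u = out u + (if u = y then 1 else 0) - if u = x then 1 else 0) :
    ResidualFlow n cap A d res' cst' π out' := by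
  have hxy := hF.ne hN hx hr
  have hsymm := hN.d_symm x hx y hy
  refine ⟨?_, ?_, ?_, ?_, ?_⟩
  · intro u hu v hv
    rw [hres u hu v hv]
    have := hF.res_nonneg u hu v hv
    have := hF.res_nonneg y hy x hx
    split_ifs <;> omega
  · intro u hu v hv
    rw [hres u hu v hv, hres v hv u hu, ← hF.res_add u hu v hv]
    by_cases h1 : u = y ∧ v = x
    · obtain ⟨rfl, rfl⟩ := h1
      simp [hxy]
    · by_cases h2 : u = x ∧ v = y
      · obtain ⟨rfl, rfl⟩ := h2
        simp [hxy]
      · rw [if_neg h1, if_neg h2, if_neg (fun h => h2 ⟨h.2, h.1⟩), if_neg (fun h => h1 ⟨h.2, h.1⟩)]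
  · intro u hu v hv
    have h := hF.cst_eq u hu v hv
    rw [hcst u hu v hv, hres v hv u hu]
    by_cases h1 : u = y ∧ v = x
    · obtain ⟨rfl, rfl⟩ := h1
      simp only [and_self, if_true, hxy, hxy.symm, if_false]
      rw [h, hsymm]; ring
    · by_cases h2 : u = x ∧ v = y
      · obtain ⟨rfl, rfl⟩ := h2
        rw [if_neg h1, if_pos ⟨rfl, rfl⟩, if_pos ⟨rfl, rfl⟩, h]; ring
      · rw [if_neg h1, if_neg h2, if_neg (fun h => h2 ⟨h.2, h.1⟩), if_neg (fun h => h1 ⟨h.2, h.1⟩),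
          h]
  · intro u hu v hv
    rw [hres u hu v hv, hcst u hu v hv]
    by_cases h1 : u = y ∧ v = x
    · obtain ⟨rfl, rfl⟩ := h1
      simp only [and_self, if_true]
      intro _
      have hc := hF.res_add v hx u hu
      have hp := hF.res_nonneg u hu v hx
      have hb := hN.balance v hx u hu (by omega)
      have e1 := hF.cst_eq v hx u hu
      have e2 := hF.cst_eq u hu v hx
      rw [← hc] at hb
      rw [← hsymm] at e2
      have : cst v u + cst u v = d v u := by rw [e1, e2]; linear_combination hb
      omega
    · rw [if_neg h1, if_neg h1]
      by_cases h2 : u = x ∧ v = y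
      · obtain ⟨rfl, rfl⟩ := h2
        simp only [and_self, if_true]
        intro _
        have := hN.d_nonneg u hu v hv
        omega
      · rw [if_neg h2, if_neg h2]
        exact hF.pot u hu v hv
  · intro u hu
    rw [hout u hu, ← hF.sum_res u hu]
    have : ∀ v ∈ Ico 0 n, res' u v =
        res u v + (if v = x then (if u = y then 1 else 0) else 0)
          - (if v = y then (if u = x then 1 else 0) else 0) := by
      intro v hv
      rw [hres u hu v hv]
      by_cases h1 : u = y <;> by_cases h2 : v = x <;> by_cases h3 : u = x <;>
        by_cases h4 : v = y <;> simp [h1, h2, h3, h4, hxy, hxy.symm] at *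
    rw [sum_congr rfl this, sum_sub_distrib, sum_add_distrib, sum_ite_eq', sum_ite_eq',
      if_pos hx, if_pos hy]

/-- A tree of tight residual arcs that is rooted at `root`. The nodes of the tree are those with
`0 < T z`, where `T z ≤ b` is the time at which `z` was added, and `par` is the parent function. -/
structure TightTree (n root b : ℤ) (T par : ℤ → ℤ) (res cst : ℤ → ℤ → ℤ) (π : ℤ → ℤ) : Prop where
  nonneg : ∀ z ∈ Ico 0 n, 0 ≤ T z
  le : ∀ z ∈ Ico 0 n, T z ≤ b
  root_eq : T root = 1
  eq_root : ∀ z ∈ Ico 0 n, T z = 1 → z = root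
  par_mem : ∀ z ∈ Ico 0 n, 1 < T z → par z ∈ Ico 0 n
  par_pos : ∀ z ∈ Ico 0 n, 1 < T z → 1 ≤ T (par z)
  par_lt : ∀ z ∈ Ico 0 n, 1 < T z → T (par z) < T z
  res_pos : ∀ z ∈ Ico 0 n, 1 < T z → 0 < res (par z) z
  tight : ∀ z ∈ Ico 0 n, 1 < T z → π z = π (par z) + cst (par z) z

/-- The arc `(x, y)` leaves the tree. -/
def Leaves (T : ℤ → ℤ) (res : ℤ → ℤ → ℤ) (x y : ℤ) : Prop := 0 < T x ∧ T y = 0 ∧ 0 < res x y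

/-- Raising the potential outside the tree by the least slack of a leaving arc keeps it feasible
and makes that arc tight. -/
theorem TightTree.grow {root b : ℤ} {T par : ℤ → ℤ} (hF : ResidualFlow n cap A d res cst π out)
    (hT : TightTree n root b T par res cst π) (hb : 1 ≤ b)
    {x y δ : ℤ} (hx : x ∈ Ico 0 n) (hy : y ∈ Ico 0 n) (hL : Leaves T res x y)
    (hδ : δ = π x + cst x y - π y)
    (hmin : ∀ u ∈ Ico 0 n, ∀ v ∈ Ico 0 n, Leaves T res u v → δ ≤ π u + cst u v - π v)
    {π' : ℤ → ℤ} (hπ : ∀ z ∈ Ico 0 n, π' z = if T z = 0 then π z + δ else π z) :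
    ResidualFlow n cap A d res cst π' out ∧
      TightTree n root (b + 1) (Function.update T y (b + 1)) (Function.update par y x) res cst
        π' := by
  obtain ⟨hTx, hTy, hr⟩ := hL
  have hδ0 : 0 ≤ δ := by have := hF.pot x hx y hy hr; omega
  refine ⟨⟨hF.res_nonneg, hF.res_add, hF.cst_eq, ?_, hF.sum_res⟩, ?_⟩
  · intro u hu v hv huv
    have h1 := hF.pot u hu v hv huv
    have h2 := hmin u hu v hv
    have h3 := hT.nonneg u hu
    rw [hπ u hu, hπ v hv]
    split_ifs with h4 h5 h5
    · omega
    · have := h2 ⟨by omega, h4, huv⟩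
      omega
    · omega
    · omega
  · have hry : root ≠ y := by rintro rfl; have := hT.root_eq; omega
    have hxy : x ≠ y := by rintro rfl; omega
    refine ⟨?_, ?_, ?_, ?_, ?_, ?_, ?_, ?_, ?_⟩
    · intro z hz
      have := hT.nonneg z hz
      simp only [Function.update_apply]; split_ifs <;> omega
    · intro z hz
      have := hT.le z hz
      simp only [Function.update_apply]; split_ifs <;> omega
    · simp [hry, hT.root_eq]
    · intro z hz
      simp only [Function.update_apply]
      split_ifs with h
      · omega
      · exact hT.eq_root z hz
    all_goals
      intro z hz
      by_cases h : z = y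
      · subst h
        have := hT.le x hx
        simp only [Function.update_self, Function.update_of_ne hxy]
        intro _
        first
          | exact hx
          | omega
          | exact hr
          | (rw [hπ z hz, hπ x hx, if_pos hTy, if_neg (by omega)]; omega)
      · simp only [Function.update_of_ne h]
        intro hz1
        have hpar : par z ≠ y := by
          intro h'
          have := hT.par_pos z hz hz1
          rw [h'] at this; omega
        try simp only [Function.update_of_ne hpar]
        first
          | exact hT.par_mem z hz hz1
          | exact hT.par_pos z hz hz1
          | exact hT.par_lt z hz hz1
          | exact hT.res_pos z hz hz1
          | (have := hT.par_pos z hz hz1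
             rw [hπ z hz, hπ _ (hT.par_mem z hz hz1), if_neg (by omega), if_neg (by omega)]
             exact hT.tight z hz hz1)

end ResidualNetwork

end DiverseMatching

/-! ### The augmentation program -/

open RAM RAM.FProg Finset

namespace DiverseMatching

/-! Names of registers (`r…`) and arrays (`a…`). The registers `rA`, …, `rp` and the arrays `aA`,
`aB`, `aW` hold the input, and `aOut` holds the output. There are `rN` rows and `rV = 2 rN` nodes,
and `rK` is the margin of the transportation problem, whose cost functions are in `aG` and `aD`;
`- rBig` is a lower bound for the costs of first units. The arrays `aRes`, `aCst`, `aDd`, `aPi` hold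
residual capacities, costs of next units, second differences and potentials, `aDef` holds the unmet
demands, and `aT`, `aPar` hold the times and parents of the nodes of the search tree. The array `aC`
holds the solution that is decomposed, and `aF` marks the forbidden pairs. -/

notation "rA" => 0
notation "rB" => 1
notation "rE" => 2
notation "rk" => 3
notation "rp" => 4
notation "rN" => 5
notation "rV" => 6
notation "rBig" => 8
notation "rK" => 9
notation "rX" => 10
notation "rY" => 11
notation "rI" => 12
notation "rS" => 13
notation "rM" => 14
notation "rT" => 15
notation "rJ" => 16
notation "rTgt" => 17
notation "rBx" => 18
notation "rBy" => 19
notation "rBs" => 20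
notation "rCur" => 21
notation "rSl" => 22
notation "rAcc" => 23
notation "rBad" => 24
notation "rPar" => 25
notation "rOut" => 26
notation "aA" => 0
notation "aB" => 1
notation "aW" => 2
notation "aOut" => 3
notation "aOff" => 4
notation "aG" => 5
notation "aD" => 6
notation "aRes" => 7
notation "aCst" => 8
notation "aDd" => 9
notation "aPi" => 10
notation "aDef" => 11
notation "aT" => 12
notation "aPar" => 13
notation "aC" => 14
notation "aF" => 15

/-- The address of the entry `(x, y)` of a matrix; cell `x` of the array `aOff` holds the offset
of row `x`, as there is no multiplication. -/
def idx (x y : ℕ) : Expr := .add (.read aOff (.reg x)) (.reg y)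

/-- The entry of a matrix whose coordinates are held by two registers. -/
def cell (a x y : ℕ) : Expr := .read a (idx x y)

/-- The array cell whose address is held by a register. -/
def at1 (a x : ℕ) : Expr := .read a (.reg x)

/-- Compare the arc `(rX, rY)`, if it leaves the tree, with the best arc `(rBx, rBy)` so far. -/
def scanStep : FProg :=
  .ite (.and (.lt (.const 0) (at1 aT rX))
      (.and (.eq (at1 aT rY) (.const 0)) (.lt (.const 0) (cell aRes rX rY))))
    (.assign rSl (.sub (.add (at1 aPi rX) (cell aCst rX rY)) (at1 aPi rY)) ;;
      .ite (.and (.not (.eq (.reg rBx) (.const (-1)))) (.not (.lt (.reg rSl) (.reg rBs)))) .skip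
        (.assign rBx (.reg rX) ;; .assign rBy (.reg rY) ;; .assign rBs (.reg rSl)))
    .skip

/-- Find an arc `(rBx, rBy)` that leaves the tree and has the least slack `rBs`. -/
def scan : FProg :=
  .assign rBx (.const (-1)) ;; .forTo rX rV (.forTo rY rV scanStep)

/-- The offsets of the rows of square matrices are in place. -/
def Offsets (s : State) : Prop := ∀ x ∈ Ico 0 (s.reg rV), s.mem aOff x = x * s.reg rV

attribute [simp] Expr.eval Test.Holds writes arrs idx cell at1

/-- The registers of `s'` describe a leaving arc of least slack among the arcs of the set `S`,
where tree, residual capacities and slacks are those of `s`. -/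
def Best (n : ℤ) (s : State) (S : ℤ → ℤ → Prop) (s' : State) : Prop :=
  (s'.reg rBx = -1 ∧ ∀ u ∈ Ico 0 n, ∀ v ∈ Ico 0 n, S u v →
    ¬ Leaves (s.mem aT) (mat n (s.mem aRes)) u v) ∨
  (s'.reg rBx ∈ Ico 0 n ∧ s'.reg rBy ∈ Ico 0 n ∧
    Leaves (s.mem aT) (mat n (s.mem aRes)) (s'.reg rBx) (s'.reg rBy) ∧
    s'.reg rBs = s.mem aPi (s'.reg rBx) + mat n (s.mem aCst) (s'.reg rBx) (s'.reg rBy)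
      - s.mem aPi (s'.reg rBy) ∧
    ∀ u ∈ Ico 0 n, ∀ v ∈ Ico 0 n, S u v → Leaves (s.mem aT) (mat n (s.mem aRes)) u v →
      s'.reg rBs ≤ s.mem aPi u + mat n (s.mem aCst) u v - s.mem aPi v)

theorem Best.congr {n : ℤ} {s s' s'' : State} {S S' : ℤ → ℤ → Prop} (h : Best n s S s')
    (hS : ∀ u ∈ Ico 0 n, ∀ v ∈ Ico 0 n, S' u v →
      S u v ∨ ¬ Leaves (s.mem aT) (mat n (s.mem aRes)) u v)
    (h1 : s''.reg rBx = s'.reg rBx) (h2 : s''.reg rBy = s'.reg rBy)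
    (h3 : s''.reg rBs = s'.reg rBs) : Best n s S' s'' := by
  simp only [Best, h1, h2, h3] at h ⊢
  rcases h with ⟨h, h'⟩ | ⟨h4, h5, h6, h7, h8⟩
  · exact .inl ⟨h, fun u hu v hv hs =>
      (hS u hu v hv hs).elim (fun hs => h' u hu v hv hs) id⟩
  · exact .inr ⟨h4, h5, h6, h7, fun u hu v hv hs hl =>
      (hS u hu v hv hs).elim (fun hs => h8 u hu v hv hs hl) (fun h => absurd hl h)⟩

theorem scanStep_spec {n i j : ℤ} {s s' : State} (hi : i ∈ Ico 0 n) (hj : j ∈ Ico 0 n)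
    (ho : s.mem aOff i = i * n) (hmem : s'.mem = s.mem) (hx : s'.reg rX = i) (hy : s'.reg rY = j)
    {S : ℤ → ℤ → Prop} (hB : Best n s S s') :
    Best n s (fun u v => S u v ∨ u = i ∧ v = j) (scanStep.den s') := by
  by_cases hL : Leaves (s.mem aT) (mat n (s.mem aRes)) i j
  · have hL' := hL
    simp only [Leaves, mat] at hL'
    by_cases hc : s'.reg rBx ≠ -1 ∧ s'.reg rBs ≤ s.mem aPi i + mat n (s.mem aCst) i j - s.mem aPi j
    · have hden : scanStep.den s' =
          s'.setReg rSl (s.mem aPi i + mat n (s.mem aCst) i j - s.mem aPi j) := by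
        simp only [mat] at hc
        simp [scanStep, hmem, hx, hy, ho, hL', hc, mat]
      rw [hden]
      rcases hB with ⟨h, -⟩ | ⟨h4, h5, h6, h7, h8⟩
      · exact absurd h hc.1
      · refine .inr ⟨by simpa using h4, by simpa using h5, by simpa using h6, by simpa using h7, ?_⟩
        rintro u hu v hv (hs | ⟨rfl, rfl⟩) hl
        · simpa using h8 u hu v hv hs hl
        · simpa using hc.2
    · have hden : scanStep.den s' =
          (((s'.setReg rSl (s.mem aPi i + mat n (s.mem aCst) i j - s.mem aPi j)).setReg rBx i).setReg
            rBy j).setReg rBs (s.mem aPi i + mat n (s.mem aCst) i j - s.mem aPi j) := by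
        simp only [mat] at hc
        simp [scanStep, hmem, hx, hy, ho, hL', mat]
        intro h1 h2
        exact absurd ⟨h1, h2⟩ hc
      rw [hden]
      refine .inr ⟨by simpa using hi, by simpa using hj, by simpa using hL, by simp, ?_⟩
      rintro u hu v hv (hs | ⟨rfl, rfl⟩) hl
      · rcases hB with ⟨-, h⟩ | ⟨h4, -, -, -, h8⟩
        · exact absurd hl (h u hu v hv hs)
        · have := h8 u hu v hv hs hl
          have hm : s'.reg rBx ≠ -1 := by have := mem_Ico.1 h4; omega
          have hlt : ¬ _ := fun h => hc ⟨hm, h⟩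
          simp
          omega
      · simp
  · have hden : scanStep.den s' = s' := by
      simp only [Leaves, mat] at hL
      simp [scanStep, hmem, hx, hy, ho, hL]
    rw [hden]
    refine hB.congr ?_ rfl rfl rfl
    rintro u hu v hv (hs | ⟨rfl, rfl⟩)
    · exact .inl hs
    · exact .inr hL

/-- The minimum exists because some arc leaves the tree. -/
theorem scan_spec {s : State} {n : ℤ} (hn : s.reg rV = n) (ho : Offsets s)
    (hc : ∃ x ∈ Ico 0 n, ∃ y ∈ Ico 0 n, Leaves (s.mem aT) (mat n (s.mem aRes)) x y) :
    let s' := scan.den s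
    s'.reg rBx ∈ Ico 0 n ∧ s'.reg rBy ∈ Ico 0 n ∧
    Leaves (s.mem aT) (mat n (s.mem aRes)) (s'.reg rBx) (s'.reg rBy) ∧
    s'.reg rBs = s.mem aPi (s'.reg rBx) + mat n (s.mem aCst) (s'.reg rBx) (s'.reg rBy)
      - s.mem aPi (s'.reg rBy) ∧
    ∀ u ∈ Ico 0 n, ∀ v ∈ Ico 0 n, Leaves (s.mem aT) (mat n (s.mem aRes)) u v →
      s'.reg rBs ≤ s.mem aPi u + mat n (s.mem aCst) u v - s.mem aPi v := by
  have key := forTo_forTo_rule (x := rX) (y := rY) (n := rV) (P := scanStep)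
    (s := s.setReg rBx (-1))
    (fun i j s' => Best n s (fun u v => u < i ∨ u = i ∧ v < j) s') (by simp)
    (by simp [scanStep]) (by simp [scanStep])
    (.inl ⟨by simp, by
      intro u hu v hv h
      simp at hu hv h; omega⟩)
    (fun i s' h => h.congr (fun _ _ _ _ h => .inl h) (by simp) (by simp) (by simp))
    (by
      intro i j s' hi hj hag hx hy hB
      simp [hn] at hi hj
      have hmem : s'.mem = s.mem := by
        funext a
        rw [hag.mem a (by simp [scanStep])]; simp
      have hoff : s.mem aOff i = i * n := by rw [← hn]; exact ho _ (by simpa [hn] using hi)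
      refine (scanStep_spec (by simpa using hi) (by simpa using hj) hoff hmem hx hy hB).congr
        ?_ (by simp) (by simp) (by simp)
      intro u _ v _ h
      left; push_cast at h; omega)
    (by
      intro i s' h
      refine h.congr ?_ (by simp) (by simp) (by simp)
      intro u hu v hv h
      left
      simp [hn] at *
      omega)
  rcases key with ⟨-, h⟩ | ⟨h4, h5, h6, h7, h8⟩
  · obtain ⟨x, hx, y, hy, hL⟩ := hc
    refine absurd hL (h x hx y hy ?_)
    simp [hn] at *; omega
  · refine ⟨h4, h5, h6, h7, fun u hu v hv hL => h8 u hu v hv ?_ hL⟩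
    simp [hn] at *; omega

end DiverseMatching

namespace DiverseMatching

/-- Add a node to the tree: raise the potential outside the tree by the least slack of a leaving
arc, and append the end `rBy` of that arc at time `rM + 2`. If that node has demand, the search
has succeeded. -/
def growStep : FProg :=
  scan ;;
  .forTo rX rV (.ite (.eq (at1 aT rX) (.const 0))
    (.store aPi (.reg rX) (.add (at1 aPi rX) (.reg rBs))) .skip) ;;
  .store aT (.reg rBy) (.add (.reg rM) (.const 2)) ;;
  .store aPar (.reg rBy) (.reg rBx) ;;
  .ite (.lt (.const 0) (at1 aDef rBy)) (.assign rTgt (.reg rBy)) .skip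

variable {n : ℤ} {cap A d : ℤ → ℤ → ℤ} {out : ℤ → ℤ}

/-- The flow that is stored in the arrays `aRes`, `aCst` and `aPi`. -/
def FlowAt (n : ℤ) (cap A d : ℤ → ℤ → ℤ) (out : ℤ → ℤ) (s : State) : Prop :=
  ResidualFlow n cap A d (mat n (s.mem aRes)) (mat n (s.mem aCst)) (s.mem aPi) out

/-- The tree that is stored in the arrays `aT` and `aPar`. -/
def TreeAt (n root b : ℤ) (s : State) : Prop :=
  TightTree n root b (s.mem aT) (s.mem aPar) (mat n (s.mem aRes)) (mat n (s.mem aCst)) (s.mem aPi)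

/-- As long as no node of the tree has demand, some arc leaves the tree, since the root has a direct
residual arc to a node with demand. The step adds one node to the tree. -/
theorem growStep_spec {root : ℤ} {m : ℕ} {s : State} (hn : s.reg rV = n) (ho : Offsets s)
    (hM : s.reg rM = m) (hroot : root ∈ Ico 0 n)
    (hdem : ∃ y ∈ Ico 0 n, 0 < s.mem aDef y ∧ 0 < mat n (s.mem aRes) root y)
    (hF : FlowAt n cap A d out s) (hT : TreeAt n root (m + 1) s) (htgt : s.reg rTgt = -1)
    (hcard : #{z ∈ Ico 0 n | 0 < s.mem aT z} = m + 1)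
    (hdef : ∀ z ∈ Ico 0 n, 0 < s.mem aT z → s.mem aDef z ≤ 0) :
    let s' := growStep.den s
    FlowAt n cap A d out s' ∧ TreeAt n root ((m + 1 : ℕ) + 1) s' ∧
      ((s'.reg rTgt = -1 ∧ #{z ∈ Ico 0 n | 0 < s'.mem aT z} = (m + 1) + 1 ∧
        ∀ z ∈ Ico 0 n, 0 < s'.mem aT z → s'.mem aDef z ≤ 0) ∨
      (s'.reg rTgt ∈ Ico 0 n ∧ 0 < s'.mem aT (s'.reg rTgt) ∧ 0 < s'.mem aDef (s'.reg rTgt))) := by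
  obtain ⟨g1, g2, g3, g4, g5⟩ := scan_spec hn ho (by
    obtain ⟨y, hy, h1, h2⟩ := hdem
    refine ⟨root, hroot, y, hy, by rw [hT.root_eq]; omega, ?_, h2⟩
    have := hT.nonneg y hy
    have := fun h => hdef y hy h
    by_contra h
    have := this (by omega)
    omega)
  have hag := agree_den scan s
  set s1 := scan.den s with hs1
  have hmem : s1.mem = s.mem := by
    funext a
    exact hag.mem a (by simp [scan, scanStep])
  have hr1 : s1.reg rV = n := by rw [hag.reg rV (by simp [scan, scanStep]), hn]
  have hM1 : s1.reg rM = m := by rw [hag.reg rM (by simp [scan, scanStep]), hM]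
  have ht1 : s1.reg rTgt = -1 := by rw [hag.reg rTgt (by simp [scan, scanStep]), htgt]
  obtain ⟨f1, f2⟩ := fill1 (x := rX) (n := rV) (a := aPi)
    (P := .ite (.eq (at1 aT rX) (.const 0))
      (.store aPi (.reg rX) (.add (at1 aPi rX) (.reg rBs))) .skip) (s := s1)
    (fun z => if s.mem aT z = 0 then s.mem aPi z + s1.reg rBs else s.mem aPi z) (by
      intro i s' _ _ hag' hx hpi
      have e1 := hag'.mem aT (by simp)
      have e2 := hag'.reg rBs (by simp)
      rw [hmem] at hpi e1
      by_cases h : s.mem aT i = 0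
      · simp [hx, e1, h, hpi, e2]
      · simp [hx, e1, h, ← hpi, State.setMem_self])
  set s2 := (FProg.forTo rX rV (.ite (.eq (at1 aT rX) (.const 0))
    (.store aPi (.reg rX) (.add (at1 aPi rX) (.reg rBs))) .skip)).den s1 with hs2
  rw [hr1] at f2
  have hBx : s2.reg rBx = s1.reg rBx := f1.reg _ (by simp)
  have hBy : s2.reg rBy = s1.reg rBy := f1.reg _ (by simp)
  have hM2 : s2.reg rM = m := by rw [f1.reg _ (by simp), hM1]
  have ht2 : s2.reg rTgt = -1 := by rw [f1.reg _ (by simp), ht1]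
  have hm2 : ∀ a, a ≠ aPi → s2.mem a = s.mem a := by
    intro a ha
    rw [f1.mem a (by simpa using ha), hmem]
  obtain ⟨hF', hT'⟩ := TightTree.grow hF hT (by omega) g1 g2 g3 g4 g5 (π' := s2.mem aPi)
    (fun z hz => f2 z (mem_Ico.1 hz).1 (mem_Ico.1 hz).2)
  have hden : growStep.den s = if 0 < s.mem aDef (s1.reg rBy) then
      ((s2.setMem aT (s1.reg rBy) (m + 2)).setMem aPar (s1.reg rBy) (s1.reg rBx)).setReg rTgt
        (s1.reg rBy) else
      ((s2.setMem aT (s1.reg rBy) (m + 2)).setMem aPar (s1.reg rBy) (s1.reg rBx)) := by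
    simp only [growStep, den_seq, ← hs1, ← hs2]
    simp [hM2, hBx, hBy, hm2]
  have key : (FlowAt n cap A d out (growStep.den s) ∧ TreeAt n root ((m + 1 : ℕ) + 1)
      (growStep.den s)) ∧ (growStep.den s).mem aT = Function.update (s.mem aT) (s1.reg rBy) (m + 2)
      ∧ (growStep.den s).mem aDef = s.mem aDef := by
    rw [show ((m + 1 : ℕ) : ℤ) + 1 = (m + 1) + 1 by push_cast; ring]
    have e : (m : ℤ) + 2 = m + 1 + 1 := by ring
    rw [hden]
    split_ifs <;> simpa [FlowAt, TreeAt, hm2, e] using ⟨hF', hT'⟩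
  obtain ⟨⟨k1, k2⟩, k3, k4⟩ := key
  refine ⟨k1, k2, ?_⟩
  by_cases h : 0 < s.mem aDef (s1.reg rBy)
  · right
    rw [k3, k4, hden, if_pos h]
    simp only [State.setReg_reg, if_true, Function.update_self]
    exact ⟨g2, by omega, h⟩
  · left
    rw [k3, k4, hden, if_neg h]
    refine ⟨by simp [ht2], ?_, ?_⟩
    · have : ({z ∈ Ico 0 n | 0 < Function.update (s.mem aT) (s1.reg rBy) (m + 2 : ℤ) z} : Finset ℤ)
          = insert (s1.reg rBy) {z ∈ Ico 0 n | 0 < s.mem aT z} := by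
        ext z
        simp only [mem_filter, mem_insert, Function.update_apply]
        by_cases hz : z = s1.reg rBy
        · subst hz; simp only [if_true, true_or, iff_true]; exact ⟨g2, by omega⟩
        · simp [hz]
      rw [this, card_insert_of_notMem (by simp [g3.2.1]), hcard]
    · intro z hz
      rw [Function.update_apply]
      split_ifs with hz'
      · subst hz'; intro; omega
      · exact hdef z hz

end DiverseMatching

namespace DiverseMatching

variable {n : ℤ} {cap A d : ℤ → ℤ → ℤ} {out : ℤ → ℤ}

/-- Push one unit along the arc `(rPar, rCur)`. -/
def pushStep : FProg :=
  .store aRes (idx rPar rCur) (.sub (cell aRes rPar rCur) (.const 1)) ;;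
  .store aRes (idx rCur rPar) (.add (cell aRes rCur rPar) (.const 1)) ;;
  .store aCst (idx rPar rCur) (.add (cell aCst rPar rCur) (cell aDd rPar rCur)) ;;
  .store aCst (idx rCur rPar) (.sub (cell aCst rCur rPar) (cell aDd rPar rCur))

/-- Unless `rCur` is the root, push along the arc from its parent and move there. -/
def walkStep : FProg :=
  .ite (.eq (.reg rCur) (.reg rI)) .skip
    (.assign rPar (at1 aPar rCur) ;; pushStep ;; .assign rCur (.reg rPar))

/-- Send one unit from the node `rI` to some node with demand. -/
def augment : FProg :=
  .forTo rX rV (.store aT (.reg rX) (.const 0)) ;;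
  .store aT (.reg rI) (.const 1) ;;
  .assign rTgt (.const (-1)) ;;
  .forTo rM rV (.ite (.eq (.reg rTgt) (.const (-1))) growStep .skip) ;;
  .store aDef (.reg rTgt) (.sub (at1 aDef rTgt) (.const 1)) ;;
  .assign rCur (.reg rTgt) ;;
  .forTo rM rV walkStep

theorem pushStep_spec {x y : ℤ} {s : State} (hn : s.reg rV = n) (ho : Offsets s)
    (hx : x ∈ Ico 0 n) (hy : y ∈ Ico 0 n) (hxy : x ≠ y) (hp : s.reg rPar = x)
    (hc : s.reg rCur = y) :
    (∀ u ∈ Ico 0 n, ∀ v ∈ Ico 0 n, mat n ((pushStep.den s).mem aRes) u v =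
      if u = y ∧ v = x then mat n (s.mem aRes) y x + 1
      else if u = x ∧ v = y then mat n (s.mem aRes) x y - 1 else mat n (s.mem aRes) u v) ∧
    (∀ u ∈ Ico 0 n, ∀ v ∈ Ico 0 n, mat n ((pushStep.den s).mem aCst) u v =
      if u = y ∧ v = x then mat n (s.mem aCst) y x - mat n (s.mem aDd) x y
      else if u = x ∧ v = y then mat n (s.mem aCst) x y + mat n (s.mem aDd) x y
      else mat n (s.mem aCst) u v) := by
  have ox : s.mem aOff x = x * n := by rw [← hn]; exact ho x (by rwa [hn])
  have oy : s.mem aOff y = y * n := by rw [← hn]; exact ho y (by rwa [hn])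
  rw [mem_Ico] at hx hy
  have hne : y * n + x ≠ x * n + y := by
    rw [Ne, index_inj hx.1 hx.2 hy.1 hy.2]; omega
  constructor
  all_goals
    intro u _ v hv
    rw [mem_Ico] at hv
    simp [pushStep, hp, hc, ox, oy, mat_update, hx, hy, hv, Function.update_of_ne hne]
    simp [mat]

/-- While a unit is sent from `root` to `t`, the flow lacks the part of the tree path from the root
to `rCur`, whose arcs are still tight, since a push changes only the arc above `rCur`. -/
theorem walkStep_spec (hN : ResidualNetwork n cap A d) {root t : ℤ} {s : State} {T par : ℤ → ℤ}
    (hn : s.reg rV = n) (ho : Offsets s) (hI : s.reg rI = root) (hc : s.reg rCur ∈ Ico 0 n)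
    (hd : ∀ x ∈ Ico 0 n, ∀ y ∈ Ico 0 n, mat n (s.mem aDd) x y = d x y)
    (hpar : s.mem aPar = par)
    {b : ℤ} {res cst : ℤ → ℤ → ℤ} {π : ℤ → ℤ} (hT : TightTree n root b T par res cst π)
    (hpos : 1 ≤ T (s.reg rCur))
    (hF : FlowAt n cap A d (fun u => out u + (if u = t then 1 else 0)
      - if u = s.reg rCur then 1 else 0) s)
    (hpath : ∀ z ∈ Ico 0 n, 1 < T z → T z ≤ T (s.reg rCur) →
      0 < mat n (s.mem aRes) (par z) z ∧
        s.mem aPi z = s.mem aPi (par z) + mat n (s.mem aCst) (par z) z) :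
    let s' := walkStep.den s
    s'.reg rCur ∈ Ico 0 n ∧ 1 ≤ T (s'.reg rCur) ∧
    (T (s'.reg rCur) < T (s.reg rCur) ∨ T (s'.reg rCur) = 1) ∧
    FlowAt n cap A d (fun u => out u + (if u = t then 1 else 0)
      - if u = s'.reg rCur then 1 else 0) s' ∧
    ∀ z ∈ Ico 0 n, 1 < T z → T z ≤ T (s'.reg rCur) →
      0 < mat n (s'.mem aRes) (par z) z ∧
        s'.mem aPi z = s'.mem aPi (par z) + mat n (s'.mem aCst) (par z) z := by
  by_cases hroot : s.reg rCur = root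
  · have hden : walkStep.den s = s := by simp [walkStep, hI, hroot]
    rw [hden]
    refine ⟨hc, hpos, .inr ?_, hF, hpath⟩
    rw [hroot, hT.root_eq]
  · have h1 : 1 < T (s.reg rCur) := by
      have := mt (hT.eq_root _ hc) hroot
      omega
    set y := s.reg rCur with hy
    have hx := hT.par_mem y hc h1
    have hlt := hT.par_lt y hc h1
    obtain ⟨hr, htight⟩ := hpath y hc h1 le_rfl
    have hxy := ResidualFlow.ne hN hF hx hr
    set s1 := s.setReg rPar (par y) with hs1
    have hag := agree_den pushStep s1
    obtain ⟨p1, p2⟩ := pushStep_spec (s := s1) (x := par y) (y := y) (n := n) (by simp [s1, hn])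
      (by simpa [Offsets, s1] using ho) hx hc hxy (by simp [s1]) (by simp [s1, hy])
    have hden : walkStep.den s = (pushStep.den s1).setReg rCur (par y) := by
      have h2 : s.mem aPar y = par y := by rw [hpar]
      have h3 : (pushStep.den s1).reg rPar = par y := by
        rw [hag.reg _ (by simp [pushStep])]; simp [s1]
      simp [walkStep, hI, hroot, ← hy, h2, ← hs1, h3]
    have hpi : (pushStep.den s1).mem aPi = s.mem aPi := by
      rw [hag.mem _ (by simp [pushStep])]; simp [s1]
    simp only [hden, State.setReg_reg, if_true, State.setReg_mem, hpi]
    refine ⟨hx, hT.par_pos y hc h1, .inl hlt, ?_, ?_⟩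
    · simp only [FlowAt, State.setReg_mem, hpi]
      refine hF.push hN hx hc hr htight p1 ?_ ?_
      · intro u hu v hv
        rw [p2 u hu v hv]
        simp only [s1, State.setReg_mem, hd _ hx _ hc]
      · intro u _
        ring
    · intro z hz hz1 hzx
      have hpz := hT.par_lt z hz hz1
      have e1 : z ≠ y := by rintro rfl; omega
      have e2 : par z ≠ y := by intro h; rw [h] at hpz; omega
      rw [p1 _ (hT.par_mem z hz hz1) z hz, p2 _ (hT.par_mem z hz hz1) z hz]
      simpa [e1, e2, s1] using hpath z hz hz1 (by omega)

/-- The tree grows in every round until it contains a node with demand, so that `n` rounds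
suffice. -/
theorem augment_spec (hN : ResidualNetwork n cap A d) {root : ℤ} {s : State}
    (hn : s.reg rV = n) (ho : Offsets s) (hI : s.reg rI = root) (hroot : root ∈ Ico 0 n)
    (hd : ∀ x ∈ Ico 0 n, ∀ y ∈ Ico 0 n, mat n (s.mem aDd) x y = d x y)
    (hdem : ∃ y ∈ Ico 0 n, 0 < s.mem aDef y ∧ 0 < mat n (s.mem aRes) root y)
    (hdr : s.mem aDef root ≤ 0) (hF : FlowAt n cap A d out s) :
    ∃ t ∈ Ico 0 n, 0 < s.mem aDef t ∧
      (augment.den s).mem aDef = Function.update (s.mem aDef) t (s.mem aDef t - 1) ∧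
      FlowAt n cap A d (fun u => out u + (if u = t then 1 else 0) - if u = root then 1 else 0)
        (augment.den s) := by
  have hn0 : 0 < n := by have := mem_Ico.1 hroot; omega
  obtain ⟨f1, f2⟩ := fill1 (x := rX) (n := rV) (a := aT)
    (P := .store aT (.reg rX) (.const 0)) (s := s) (fun _ => 0)
    (by intro i s' _ _ _ hx _; simp [hx])
  set s1 := (FProg.forTo rX rV (.store aT (.reg rX) (.const 0))).den s with hs1
  rw [hn] at f2
  set s2 := (s1.setMem aT root 1).setReg rTgt (-1) with hs2
  have hm2 : ∀ a, a ≠ aT → s2.mem a = s.mem a := by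
    intro a ha
    simp [s2, ha, f1.mem a (by simpa using ha)]
  have hT2 : ∀ z ∈ Ico 0 n, s2.mem aT z = if z = root then 1 else 0 := by
    intro z hz
    rw [mem_Ico] at hz
    simp [s2, Function.update_apply, f2 z hz.1 hz.2]
  have hr2 : ∀ x, x ≠ rX → x ≠ rTgt → s2.reg x = s.reg x := by
    intro x h h'
    simp [s2, h', f1.reg x (by simpa using h)]
  have hV2 : s2.reg rV = n := by rw [hr2 _ (by simp) (by simp), hn]
  -- The search for a node with demand.
  have grow := forTo_rule (x := rM) (n := rV)
    (P := .ite (.eq (.reg rTgt) (.const (-1))) growStep .skip) (s := s2)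
    (fun m s' => FlowAt n cap A d out s' ∧ TreeAt n root (m + 1) s' ∧
      ((s'.reg rTgt = -1 ∧ #{z ∈ Ico 0 n | 0 < s'.mem aT z} = m + 1 ∧
        ∀ z ∈ Ico 0 n, 0 < s'.mem aT z → s'.mem aDef z ≤ 0) ∨
      (s'.reg rTgt ∈ Ico 0 n ∧ 0 < s'.mem aT (s'.reg rTgt) ∧ 0 < s'.mem aDef (s'.reg rTgt))))
    (by
      refine ⟨by simpa [FlowAt, hm2] using hF, ?_, .inl ⟨by simp [s2], ?_, ?_⟩⟩
      · have h1 : ∀ z ∈ Ico 0 n, ¬ 1 < s2.mem aT z := by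
          intro z hz; rw [hT2 z hz]; split_ifs <;> simp
        refine ⟨?_, ?_, ?_, ?_, fun z hz h => absurd h (h1 z hz), fun z hz h => absurd h (h1 z hz),
          fun z hz h => absurd h (h1 z hz), fun z hz h => absurd h (h1 z hz),
          fun z hz h => absurd h (h1 z hz)⟩
        · intro z hz; simp only [State.setReg_mem]; rw [hT2 z hz]; split_ifs <;> simp
        · intro z hz; simp only [State.setReg_mem]; rw [hT2 z hz]; split_ifs <;> simp
        · simp only [State.setReg_mem]; rw [hT2 _ hroot, if_pos rfl]
        · intro z hz; simp only [State.setReg_mem]; rw [hT2 z hz]; split_ifs <;> simp [*]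
      · have : ({z ∈ Ico 0 n | 0 < s2.mem aT z} : Finset ℤ) = {root} := by
          ext z
          simp only [mem_filter, mem_singleton]
          constructor
          · rintro ⟨hz, h⟩
            rw [hT2 z hz] at h
            by_contra hne
            simp [hne] at h
          · rintro rfl
            exact ⟨hroot, by rw [hT2 _ hroot]; simp⟩
        simp only [State.setReg_mem]
        rw [Nat.zero_add, ← card_singleton root, ← this]
        congr 1
      · intro z hz h
        simp only [State.setReg_mem] at h ⊢
        rw [hT2 z hz] at h
        have : z = root := by by_contra hne; simp [hne] at h
        rw [this, hm2 _ (by simp)]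
        exact hdr)
    (by
      rintro m s' hm hag hM ⟨h1, h2, h3⟩
      have hres : ∀ a ∈ [aRes, aDef, aOff], s'.mem a = s.mem a := by
        intro a ha
        rw [hag.mem a, hm2 a] <;> revert a <;> decide
      have hV : s'.reg rV = n := by rw [hag.reg rV (by decide), hV2]
      by_cases htgt : s'.reg rTgt = -1
      · rcases h3 with ⟨-, h4, h5⟩ | ⟨h4, -⟩
        · have := growStep_spec hV (by
            have := hres aOff (by simp)
            simpa only [Offsets, hV, ← hn, this] using ho) hM hroot
            (by rw [hres aDef (by simp), hres aRes (by simp)]; exact hdem) h1 h2 htgt h4 h5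
          simpa [htgt, FlowAt, TreeAt] using this
        · rw [htgt] at h4; simp at h4
      · rcases h3 with ⟨h4, -⟩ | h4
        · exact absurd h4 htgt
        · simp only [den_ite, Test.Holds, Expr.eval, htgt, if_false, den_skip]
          refine ⟨h1, ?_, .inr h4⟩
          refine { h2 with le := fun z hz => ?_ }
          have := h2.le z hz
          simp only [State.setReg_mem]
          push_cast
          omega)
  have hag3 := agree_den (.forTo rM rV (.ite (.eq (.reg rTgt) (.const (-1))) growStep .skip)) s2
  set s3 := (FProg.forTo rM rV (.ite (.eq (.reg rTgt) (.const (-1))) growStep .skip)).den s2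
    with hs3
  obtain ⟨hF3, hT3, h3⟩ := grow
  rw [hV2] at hT3 h3
  replace hT3 : TreeAt n root (n + 1) s3 := by
    rwa [show ((n.toNat : ℕ) : ℤ) = n by omega] at hT3
  have hmem3 : ∀ a ∈ [aRes, aDef, aOff, aCst, aDd], s3.mem a = s.mem a := by
    intro a ha
    rw [hag3.mem a, hm2 a] <;> revert a <;> decide
  have h3 : s3.reg rTgt ∈ Ico 0 n ∧
      0 < s3.mem aT (s3.reg rTgt) ∧ 0 < s3.mem aDef (s3.reg rTgt) := by
    rcases h3 with ⟨-, h, -⟩ | h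
    · have h' := card_filter_le (Ico 0 n) fun z => 0 < s3.mem aT z
      rw [h, Int.card_Ico] at h'
      omega
    · exact h
  obtain ⟨ht1, ht2, ht3⟩ := h3
  set t := s3.reg rTgt with ht
  rw [hmem3 aDef (by simp)] at ht3
  set s4 := (s3.setMem aDef t (s.mem aDef t - 1)).setReg rCur t with hs4
  have hV4 : s4.reg rV = n := by simp [s4]; rw [hag3.reg rV (by decide), hV2]
  have hI4 : s4.reg rI = root := by
    simp [s4]; rw [hag3.reg rI (by decide), hr2 _ (by simp) (by simp), hI]
  have hm4 : ∀ a, a ≠ aDef → s4.mem a = s3.mem a := by intro a ha; simp [s4, ha]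
  have walk := forTo_rule (x := rM) (n := rV) (P := walkStep) (s := s4)
    (fun m s' => s'.reg rCur ∈ Ico 0 n ∧ 1 ≤ s3.mem aT (s'.reg rCur) ∧
      s3.mem aT (s'.reg rCur) ≤ max 1 (n + 1 - m) ∧
      FlowAt n cap A d (fun u => out u + (if u = t then 1 else 0)
        - if u = s'.reg rCur then 1 else 0) s' ∧
      ∀ z ∈ Ico 0 n, 1 < s3.mem aT z → s3.mem aT z ≤ s3.mem aT (s'.reg rCur) →
        0 < mat n (s'.mem aRes) (s3.mem aPar z) z ∧
          s'.mem aPi z = s'.mem aPi (s3.mem aPar z) + mat n (s'.mem aCst) (s3.mem aPar z) z)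
    (by
      have hc : s4.reg rCur = t := by simp [s4]
      simp only [State.setReg_reg, State.setReg_mem]
      norm_num [hc]
      refine ⟨mem_Ico.1 ht1, ht2, ?_, ?_, ?_⟩
      · right; exact hT3.le t ht1
      · simpa [FlowAt, hm4] using hF3
      · intro z hz0 hzn hz _
        have hz' : z ∈ Ico 0 n := mem_Ico.2 ⟨hz0, hzn⟩
        simp only [hm4 aRes (by simp), hm4 aPi (by simp), hm4 aCst (by simp)]
        exact ⟨hT3.res_pos z hz' hz, hT3.tight z hz' hz⟩)
    (by
      rintro m s' hm hag hM ⟨h1, h2, h3, h4, h5⟩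
      have hV' : s'.reg rV = n := by rw [hag.reg rV (by decide), hV4]
      have hm' : ∀ a ∈ [aOff, aDd], s'.mem a = s.mem a := by
        intro a ha
        rw [hag.mem a, hm4 a, hmem3 a] <;> revert a <;> decide
      have := walkStep_spec hN (t := t) (T := s3.mem aT) (par := s3.mem aPar) hV'
        (by simpa only [Offsets, hV', ← hn, hm' aOff (by simp)] using ho)
        (by rw [hag.reg rI (by decide), hI4]) h1
        (by rw [hm' aDd (by simp)]; exact hd)
        (by rw [hag.mem aPar (by decide), hm4 aPar (by simp)]) hT3 h2 h4 h5
      obtain ⟨k1, k2, k3, k4, k5⟩ := this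
      refine ⟨by simpa using k1, by simpa using k2, ?_, by simpa [FlowAt] using k4,
        by simpa using k5⟩
      simp only [State.setReg_reg]
      norm_num
      omega)
  obtain ⟨w1, w2, w3, w4, -⟩ := walk
  have hden : augment.den s = (FProg.forTo rM rV walkStep).den s4 := by
    have hIs1 : s1.reg rI = root := by rw [f1.reg rI (by simp), hI]
    simp only [augment, den_seq, ← hs1, den_store, den_assign, Expr.eval, hIs1, at1]
    rw [← hs2, ← hs3]
    simp only [← ht, hmem3 aDef (by simp), State.setMem_reg]
    rw [← hs4]
  have hag5 := agree_den (.forTo rM rV walkStep) s4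
  rw [← hden] at w1 w2 w3 w4 hag5
  have hcur : (augment.den s).reg rCur = root := by
    refine hT3.eq_root _ w1 ?_
    rw [hV4] at w3
    have : ((n.toNat : ℕ) : ℤ) = n := by omega
    rw [this] at w3
    omega
  refine ⟨t, ht1, ht3, ?_, by rwa [hcur] at w4⟩
  rw [hag5.mem aDef (by decide)]
  simp [s4, hmem3 aDef (by simp)]

end DiverseMatching

namespace DiverseMatching

/-! ### The transportation problem -/

/-- `(rX, rY)` is a pair of a row and a column. -/
def rowCol : Test := .and (.lt (.reg rX) (.reg rN)) (.not (.lt (.reg rY) (.reg rN)))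

/-- `(rX, rY)` is a pair of a column and a row. -/
def colRow : Test := .and (.not (.lt (.reg rX) (.reg rN))) (.lt (.reg rY) (.reg rN))

/-- Run a program for all pairs of nodes `(rX, rY)`. -/
def forPairs (P : FProg) : FProg := .forTo rX rV (.forTo rY rV P)

/-- Set up the zero flow for the transportation problem with costs in `aG` and `aD`. -/
def initFlow : FProg :=
  forPairs (.ite rowCol (.store aRes (idx rX rY) (.add (.reg rK) (.const 1)))
    (.store aRes (idx rX rY) (.const 0))) ;;
  forPairs (.ite rowCol (.store aCst (idx rX rY) (cell aG rX rY))
    (.ite colRow (.store aCst (idx rX rY) (.sub (cell aD rY rX) (cell aG rY rX)))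
      (.store aCst (idx rX rY) (.const 0)))) ;;
  forPairs (.ite rowCol (.store aDd (idx rX rY) (cell aD rX rY))
    (.ite colRow (.store aDd (idx rX rY) (cell aD rY rX))
      (.store aDd (idx rX rY) (.const 0)))) ;;
  .forTo rX rV (.ite (.lt (.reg rX) (.reg rN)) (.store aPi (.reg rX) (.const 0))
    (.store aPi (.reg rX) (.sub (.const 0) (.reg rBig)))) ;;
  .forTo rX rV (.ite (.lt (.reg rX) (.reg rN)) (.store aDef (.reg rX) (.const 0))
    (.store aDef (.reg rX) (.reg rK)))

/-- Solve the transportation problem: send `rK` units from each row to the columns. -/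
def transport : FProg := initFlow ;; .forTo rI rN (.forTo rS rK augment)

/-- The sum of the residual capacities of an arc and its reverse. -/
def capF (N K x y : ℤ) : ℤ := if (x < N ↔ y < N) then 0 else K + 1

/-- The second differences of the costs, on arcs and reverse arcs. -/
def secondDiff (N : ℤ) (D : ℤ → ℤ → ℤ) (x y : ℤ) : ℤ :=
  if x < N ∧ N ≤ y then D x y else if N ≤ x ∧ y < N then D y x else 0

/-- The constant terms of the costs, on arcs and reverse arcs. -/
def baseCost (N K : ℤ) (G D : ℤ → ℤ → ℤ) (x y : ℤ) : ℤ :=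
  if x < N ∧ N ≤ y then G x y else if N ≤ x ∧ y < N then D y x - G y x - D y x * (K + 1) else 0

/-- Optimality conditions for the transportation problem with rows `0, …, N - 1`, columns
`N, …, 2 N - 1` and all margins `K`, where the cost of the unit `r + 1` on `(x, y)` is
`G x y + D x y * r`; the dual solution is `π`. -/
structure TransportOpt (N K : ℤ) (G D c : ℤ → ℤ → ℤ) (π : ℤ → ℤ) : Prop where
  nonneg : ∀ x ∈ Ico 0 N, ∀ y ∈ Ico N (2 * N), 0 ≤ c x y
  row_sum : ∀ x ∈ Ico 0 N, ∑ y ∈ Ico N (2 * N), c x y = K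
  col_sum : ∀ y ∈ Ico N (2 * N), ∑ x ∈ Ico 0 N, c x y = K
  upper : ∀ x ∈ Ico 0 N, ∀ y ∈ Ico N (2 * N), π y - π x ≤ G x y + D x y * c x y
  lower : ∀ x ∈ Ico 0 N, ∀ y ∈ Ico N (2 * N), 0 < c x y →
    G x y + D x y * (c x y - 1) ≤ π y - π x

section

variable {N K : ℤ} {G D : ℤ → ℤ → ℤ}

theorem sum_Ico_two_mul (hN : 0 ≤ N) (f : ℤ → ℤ) :
    ∑ y ∈ Ico 0 (2 * N), f y = ∑ y ∈ Ico 0 N, f y + ∑ y ∈ Ico N (2 * N), f y := by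
  rw [← Ico_union_Ico_eq_Ico hN (by omega : N ≤ 2 * N),
    sum_union (Ico_disjoint_Ico_consecutive _ _ _)]

theorem sum_capF (hN : 0 ≤ N) {x : ℤ} (hx : x < N) :
    ∑ y ∈ Ico 0 (2 * N), capF N K x y = N * (K + 1) := by
  rw [sum_Ico_two_mul hN, sum_congr rfl (g := fun _ => (0 : ℤ)),
    sum_congr (s₁ := Ico N (2 * N)) rfl (g := fun _ => K + 1)]
  · simp [Int.card_Ico]; left; omega
  · intro y hy; simp at hy; simp [capF, hx, hy]
  · intro y hy; simp at hy; simp [capF, hx, hy]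

theorem residualNetwork_transport
    (hD : ∀ x ∈ Ico 0 N, ∀ y ∈ Ico N (2 * N), 0 ≤ D x y) :
    ResidualNetwork (2 * N) (capF N K) (baseCost N K G D) (secondDiff N D) := by
  refine ⟨?_, ?_, ?_, ?_⟩
  · intro x _; simp [capF]
  · intro x hx y hy
    simp only [mem_Ico] at hx hy
    unfold secondDiff
    split_ifs with h1 h2
    · exact hD x (by simp; omega) y (by simp; omega)
    · exact hD y (by simp; omega) x (by simp; omega)
    · rfl
  · intro x _ y _
    unfold secondDiff
    split_ifs <;> first | rfl | omega
  · intro x hx y hy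
    unfold capF baseCost secondDiff
    rcases lt_or_ge x N with h1 | h1 <;> rcases lt_or_ge y N with h2 | h2
    · simp [h1, h2]
    · simp only [h1, h2, not_lt_of_ge h2, not_le_of_gt h1, and_self, iff_false,
        not_true, if_true, if_false]
      intro _; ring
    · simp only [h1, h2, not_lt_of_ge h1, not_le_of_gt h2, and_self, false_iff,
        not_true, if_true, if_false]
      intro _; ring
    · simp [not_lt_of_ge h1, not_lt_of_ge h2]

/-- The total residual capacity of the arcs that leave `x`, up to the units that a row has sent and
the unmet demand of a column. -/
def margin (N K x : ℤ) : ℤ := if x < N then N * (K + 1) else K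

/-- The number of units that have been sent from the row `x` when `σ` units have been sent from
row `i` and all units from the rows before it. -/
def sent (K i σ x : ℤ) : ℤ := if x < i then K else if x = i then σ else 0

theorem agree_initFlow (s : State) :
    Agree [rX, rY] [aRes, aCst, aDd, aPi, aDef] s (initFlow.den s) :=
  (agree_den initFlow s).mono (by decide) (by decide)

theorem agree_transport (s : State) :
    Agree [rX, rY, rI, rS, rM, rTgt, rBx, rBy, rBs, rCur, rSl, rPar]
      [aRes, aCst, aDd, aPi, aDef, aT, aPar] s (transport.den s) :=
  (agree_den transport s).mono (by decide) (by decide)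

theorem forPairs_spec {a : ℕ} {P : FProg} {s : State} {n : ℤ} (hn : s.reg rV = n) (ho : Offsets s)
    (ha : a ≠ aOff) (F : ℤ → ℤ → ℤ)
    (hb : ∀ (i j : ℤ) (s' : State), i ∈ Ico 0 n → j ∈ Ico 0 n → s'.mem aOff i = i * n →
      s'.mem aOff j = j * n →
      Agree [rX, rY] [a] s s' → s'.reg rX = i → s'.reg rY = j →
      mat n (s'.mem a) i j = mat n (s.mem a) i j →
      P.den s' = s'.setMem a (i * n + j) (F i j)) :
    Agree [rX, rY] [a] s ((forPairs P).den s) ∧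
      ∀ x ∈ Ico 0 n, ∀ y ∈ Ico 0 n, mat n (((forPairs P).den s).mem a) x y = F x y := by
  subst hn
  obtain ⟨h1, h2⟩ := fill2 (x := rX) (y := rY) (n := rV) (a := a) (P := P) (s := s) F (by simp)
    (by simp) (by
      intro i j s' hi hi' hj hj' hag
      have := hag.mem aOff (by simpa using ha.symm)
      exact hb i j s' (mem_Ico.2 ⟨hi, hi'⟩) (mem_Ico.2 ⟨hj, hj'⟩)
        (by rw [this]; exact ho i (mem_Ico.2 ⟨hi, hi'⟩))
        (by rw [this]; exact ho j (mem_Ico.2 ⟨hj, hj'⟩)) hag)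
  refine ⟨h1, fun x hx y hy => ?_⟩
  rw [mem_Ico] at hx hy
  exact h2 x y hx.1 hx.2 hy.1 hy.2

theorem Offsets.of_agree {R Y : List ℕ} {s s' : State} (ho : Offsets s) (hag : Agree R Y s s')
    (hR : rV ∉ R := by decide) (hY : aOff ∉ Y := by decide) : Offsets s' := by
  intro x hx
  rw [hag.reg _ hR] at hx ⊢
  rw [hag.mem _ hY]
  exact ho x hx

/-- Potentials `0` on rows and `- rBig` on columns are feasible for the zero flow. -/
theorem initFlow_spec {s : State} (hN : 0 ≤ N) (hK : 0 ≤ K) (hrN : s.reg rN = N)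
    (hrV : s.reg rV = 2 * N) (hrK : s.reg rK = K) (ho : Offsets s)
    (hG : ∀ x ∈ Ico 0 N, ∀ y ∈ Ico N (2 * N), mat (2 * N) (s.mem aG) x y = G x y)
    (hD : ∀ x ∈ Ico 0 N, ∀ y ∈ Ico N (2 * N), mat (2 * N) (s.mem aD) x y = D x y)
    (hbig : ∀ x ∈ Ico 0 N, ∀ y ∈ Ico N (2 * N), - s.reg rBig ≤ G x y) :
    let s' := initFlow.den s
    FlowAt (2 * N) (capF N K) (baseCost N K G D) (secondDiff N D)
      (fun x => margin N K x - s'.mem aDef x) s' ∧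
    (∀ x ∈ Ico 0 (2 * N), s'.mem aDef x = if x < N then 0 else K) ∧
    ∀ x ∈ Ico 0 (2 * N), ∀ y ∈ Ico 0 (2 * N),
      mat (2 * N) (s'.mem aDd) x y = secondDiff N D x y := by
  obtain ⟨a1, b1⟩ := forPairs_spec (a := aRes) (s := s) (n := 2 * N)
    (P := .ite rowCol (.store aRes (idx rX rY) (.add (.reg rK) (.const 1)))
      (.store aRes (idx rX rY) (.const 0))) hrV ho (by decide)
    (fun x y => if x < N ∧ N ≤ y then K + 1 else 0) (by
      intro i j s' hi hj oi oj hag hx hy _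
      have h1 := hag.reg rN (by simp)
      have h2 := hag.reg rK (by simp)
      by_cases h : i < N ∧ N ≤ j <;> simp [rowCol, hx, hy, oi, h1, h2, hrN, hrK, h])
  set s1 := (forPairs (.ite rowCol (.store aRes (idx rX rY) (.add (.reg rK) (.const 1)))
      (.store aRes (idx rX rY) (.const 0)))).den s with hs1
  have hrV1 : s1.reg rV = 2 * N := by rw [a1.reg _ (by simp), hrV]
  obtain ⟨a2, b2⟩ := forPairs_spec (a := aCst) (s := s1) (n := 2 * N)
    (P := .ite rowCol (.store aCst (idx rX rY) (cell aG rX rY))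
    (.ite colRow (.store aCst (idx rX rY) (.sub (cell aD rY rX) (cell aG rY rX)))
      (.store aCst (idx rX rY) (.const 0)))) hrV1 (ho.of_agree a1) (by decide)
    (fun x y => if x < N ∧ N ≤ y then G x y else if N ≤ x ∧ y < N then D y x - G y x else 0) (by
      intro i j s' hi hj oi oj hag hx hy _
      have h1 := hag.reg rN (by simp)
      rw [a1.reg _ (by simp), hrN] at h1
      have h2 := hag.mem aG (by simp)
      rw [a1.mem _ (by simp)] at h2
      have h3 := hag.mem aD (by simp)
      rw [a1.mem _ (by simp)] at h3
      rw [mem_Ico] at hi hj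
      by_cases h : i < N ∧ N ≤ j
      · have := hG i (by simp; omega) j (by simp; omega)
        simp only [mat] at this
        simp [rowCol, colRow, hx, hy, oi, h1, h2, h, this]
      · by_cases h' : N ≤ i ∧ j < N
        · have e1 := hG j (by simp; omega) i (by simp; omega)
          have e2 := hD j (by simp; omega) i (by simp; omega)
          simp only [mat] at e1 e2
          simp [rowCol, colRow, hx, hy, oi, oj, h1, h2, h3, h, h', e1, e2]
        · simp [rowCol, colRow, hx, hy, oi, h1, h, h'])
  set s2 := (forPairs (.ite rowCol (.store aCst (idx rX rY) (cell aG rX rY))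
    (.ite colRow (.store aCst (idx rX rY) (.sub (cell aD rY rX) (cell aG rY rX)))
      (.store aCst (idx rX rY) (.const 0))))).den s1 with hs2
  have hrV2 : s2.reg rV = 2 * N := by rw [a2.reg _ (by simp), hrV1]
  obtain ⟨a3, b3⟩ := forPairs_spec (a := aDd) (s := s2) (n := 2 * N)
    (P := .ite rowCol (.store aDd (idx rX rY) (cell aD rX rY))
    (.ite colRow (.store aDd (idx rX rY) (cell aD rY rX))
      (.store aDd (idx rX rY) (.const 0)))) hrV2 ((ho.of_agree a1).of_agree a2) (by decide)
    (secondDiff N D) (by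
      intro i j s' hi hj oi oj hag hx hy _
      have h1 := hag.reg rN (by simp)
      rw [a2.reg _ (by simp), a1.reg _ (by simp), hrN] at h1
      have h3 := hag.mem aD (by simp)
      rw [a2.mem _ (by simp), a1.mem _ (by simp)] at h3
      rw [mem_Ico] at hi hj
      by_cases h : i < N ∧ N ≤ j
      · have := hD i (by simp; omega) j (by simp; omega)
        simp only [mat] at this
        simp [rowCol, colRow, secondDiff, hx, hy, oi, h1, h3, h, this]
      · by_cases h' : N ≤ i ∧ j < N
        · have e2 := hD j (by simp; omega) i (by simp; omega)
          simp only [mat] at e2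
          simp [rowCol, colRow, secondDiff, hx, hy, oi, oj, h1, h3, h, h', e2]
        · simp [rowCol, colRow, secondDiff, hx, hy, oi, h1, h, h'])
  set s3 := (forPairs (.ite rowCol (.store aDd (idx rX rY) (cell aD rX rY))
    (.ite colRow (.store aDd (idx rX rY) (cell aD rY rX))
      (.store aDd (idx rX rY) (.const 0))))).den s2 with hs3
  have hr3 : ∀ x, x ∉ [rX, rY] → s3.reg x = s.reg x := fun x hx => by
    rw [a3.reg x hx, a2.reg x hx, a1.reg x hx]
  obtain ⟨a4, b4⟩ := fill1 (x := rX) (n := rV) (a := aPi) (s := s3)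
    (P := .ite (.lt (.reg rX) (.reg rN)) (.store aPi (.reg rX) (.const 0))
      (.store aPi (.reg rX) (.sub (.const 0) (.reg rBig))))
    (fun x => if x < N then 0 else - s.reg rBig) (by
      intro i s' _ _ hag hx _
      have h1 := hag.reg rN (by simp)
      rw [hr3 _ (by simp), hrN] at h1
      have h2 := hag.reg rBig (by simp)
      rw [hr3 _ (by simp)] at h2
      by_cases h : i < N <;> simp [hx, h1, h2, h])
  set s4 := (FProg.forTo rX rV (.ite (.lt (.reg rX) (.reg rN)) (.store aPi (.reg rX) (.const 0))
      (.store aPi (.reg rX) (.sub (.const 0) (.reg rBig))))).den s3 with hs4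
  have hr4 : ∀ x, x ∉ [rX, rY] → s4.reg x = s.reg x := fun x hx => by
    rw [a4.reg x (by simp at hx ⊢; omega), hr3 x hx]
  obtain ⟨a5, b5⟩ := fill1 (x := rX) (n := rV) (a := aDef) (s := s4)
    (P := .ite (.lt (.reg rX) (.reg rN)) (.store aDef (.reg rX) (.const 0))
      (.store aDef (.reg rX) (.reg rK)))
    (fun x => if x < N then 0 else K) (by
      intro i s' _ _ hag hx _
      have h1 := hag.reg rN (by simp)
      rw [hr4 _ (by simp), hrN] at h1
      have h2 := hag.reg rK (by simp)
      rw [hr4 _ (by simp), hrK] at h2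
      by_cases h : i < N <;> simp [hx, h1, h2, h])
  set s5 := (FProg.forTo rX rV (.ite (.lt (.reg rX) (.reg rN)) (.store aDef (.reg rX) (.const 0))
      (.store aDef (.reg rX) (.reg rK)))).den s4 with hs5
  rw [hr3 _ (by simp), hrV] at b4
  rw [hr4 _ (by simp), hrV] at b5
  have hden : initFlow.den s = s5 := rfl
  rw [hden]
  have e1 : s5.mem aRes = s1.mem aRes := by
    rw [a5.mem _ (by simp), a4.mem _ (by simp), a3.mem _ (by simp), a2.mem _ (by simp)]
  have e2 : s5.mem aCst = s2.mem aCst := by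
    rw [a5.mem _ (by simp), a4.mem _ (by simp), a3.mem _ (by simp)]
  have e3 : s5.mem aDd = s3.mem aDd := by rw [a5.mem _ (by simp), a4.mem _ (by simp)]
  have e4 : s5.mem aPi = s4.mem aPi := by rw [a5.mem _ (by simp)]
  have b5' : ∀ x ∈ Ico 0 (2 * N), s5.mem aDef x = if x < N then 0 else K := by
    intro x hx
    rw [mem_Ico] at hx
    exact b5 x hx.1 hx.2
  refine ⟨?_, b5', by rw [e3]; exact b3⟩
  simp only [FlowAt, e1, e2, e4]
  refine ⟨?_, ?_, ?_, ?_, ?_⟩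
  · intro x hx y hy
    rw [b1 x hx y hy]
    split_ifs <;> omega
  · intro x hx y hy
    rw [b1 x hx y hy, b1 y hy x hx]
    unfold capF
    split_ifs <;> omega
  · intro x hx y hy
    rw [b1 y hy x hx, b2 x hx y hy]
    unfold baseCost secondDiff
    by_cases h : x < N ∧ N ≤ y
    · simp [h]
    · by_cases h' : N ≤ x ∧ y < N
      · simp [h, h']
      · simp [h, h']
  · intro x hx y hy
    rw [b1 x hx y hy, b2 x hx y hy]
    rw [mem_Ico] at hx hy
    rw [b4 x hx.1 hx.2, b4 y hy.1 hy.2]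
    by_cases h : x < N ∧ N ≤ y
    · have := hbig x (by simp; omega) y (by simp; omega)
      simp [h]
      intro; omega
    · simp [h]
  · intro x hx
    rw [b5' x hx, sum_congr rfl (fun y hy => b1 x hx y hy)]
    unfold margin
    by_cases h : x < N
    · rw [← sum_capF hN h, if_pos h, if_pos h, sub_zero]
      refine sum_congr rfl fun y hy => ?_
      unfold capF
      split_ifs <;> omega
    · simp [h]

/-- After all units are sent no demand is left. An arc carries at most `K` units and has capacity
`K + 1`, so that feasibility of the potential bounds the dual variables from both sides. -/
theorem transport_spec {s : State} (hN : 0 ≤ N) (hK : 0 ≤ K) (hrN : s.reg rN = N)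
    (hrV : s.reg rV = 2 * N) (hrK : s.reg rK = K) (ho : Offsets s)
    (hG : ∀ x ∈ Ico 0 N, ∀ y ∈ Ico N (2 * N), mat (2 * N) (s.mem aG) x y = G x y)
    (hD : ∀ x ∈ Ico 0 N, ∀ y ∈ Ico N (2 * N), mat (2 * N) (s.mem aD) x y = D x y)
    (hbig : ∀ x ∈ Ico 0 N, ∀ y ∈ Ico N (2 * N), - s.reg rBig ≤ G x y)
    (hD0 : ∀ x ∈ Ico 0 N, ∀ y ∈ Ico N (2 * N), 0 ≤ D x y) :
    ∃ π, TransportOpt N K G D (fun x y => mat (2 * N) ((transport.den s).mem aRes) y x) π := by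
  have hNet := residualNetwork_transport (N := N) (K := K) (G := G) hD0
  obtain ⟨hF, hdef, hdd⟩ := initFlow_spec hN hK hrN hrV hrK ho hG hD hbig
  have hag0 := agree_initFlow s
  set s0 := initFlow.den s with hs0
  have ho0 : Offsets s0 := ho.of_agree hag0
  have hrN0 : s0.reg rN = N := by rw [hag0.reg _ (by simp), hrN]
  have hrV0 : s0.reg rV = 2 * N := by rw [hag0.reg _ (by simp), hrV]
  have hrK0 : s0.reg rK = K := by rw [hag0.reg _ (by simp), hrK]
  let Inv (i σ : ℕ) (s' : State) : Prop :=
    FlowAt (2 * N) (capF N K) (baseCost N K G D) (secondDiff N D)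
      (fun x => margin N K x - sent K i σ x - s'.mem aDef x) s' ∧
    (∀ x ∈ Ico 0 (2 * N), 0 ≤ s'.mem aDef x) ∧ (∀ x ∈ Ico 0 N, s'.mem aDef x = 0) ∧
    ∑ x ∈ Ico 0 (2 * N), s'.mem aDef x = N * K - i * K - σ
  have key := forTo_rule (x := rI) (n := rN) (P := .forTo rS rK augment) (s := s0)
    (fun i s' => Inv i 0 s')
    (by
      refine ⟨?_, ?_, ?_, ?_⟩
      · refine { hF with sum_res := fun x hx => (hF.sum_res x hx).trans ?_ }
        rw [mem_Ico] at hx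
        simp only [State.setReg_mem, sent]
        push_cast
        split_ifs <;> omega
      · intro x hx
        simp only [State.setReg_mem]
        rw [hdef x hx]; split_ifs <;> omega
      · intro x hx
        simp only [State.setReg_mem]
        rw [mem_Ico] at hx
        rw [hdef x (by simp; omega), if_pos hx.2]
      · simp only [State.setReg_mem]
        rw [sum_congr rfl hdef, sum_Ico_two_mul hN, sum_congr rfl (g := fun _ => (0 : ℤ)),
          sum_congr (s₁ := Ico N (2 * N)) rfl (g := fun _ => K)]
        · simp [Int.card_Ico]; left; omega
        · intro y hy; simp at hy; simp [hy]
        · intro y hy; simp at hy; simp [hy])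
    (by
      intro i s1 hi hag1 hI1 hInv1
      rw [hrN0] at hi
      have hrK1 : s1.reg rK = K := by rw [hag1.reg _ (by decide), hrK0]
      have step := forTo_rule (x := rS) (n := rK) (P := augment) (s := s1)
        (fun σ s' => Inv i σ s') hInv1 (by
          rintro σ s2 hσ hag2 - ⟨j1, j2, j3, j4⟩
          rw [hrK1] at hσ
          have hI2 : s2.reg rI = i := by rw [hag2.reg _ (by decide), hI1]
          have hiN : (i : ℤ) ∈ Ico 0 (2 * N) := by simp; omega
          have hdi : s2.mem aDef i = 0 := j3 i (by simpa using hi)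
          -- Some column has demand, since fewer than `N K` units have been sent, and it can be
          -- reached directly from the row, since fewer than `K` units have left the row.
          have hdem : ∃ y ∈ Ico 0 (2 * N), 0 < s2.mem aDef y ∧
              0 < mat (2 * N) (s2.mem aRes) i y := by
            have : 0 < ∑ x ∈ Ico 0 (2 * N), s2.mem aDef x := by rw [j4]; nlinarith
            obtain ⟨y, hy, hy0⟩ := exists_lt_of_sum_lt (f := fun _ => (0 : ℤ)) (by simpa using this)
            refine ⟨y, hy, hy0, ?_⟩
            have hyN : N ≤ y := by
              by_contra h
              rw [j3 y (by simp at hy ⊢; omega)] at hy0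
              exact absurd hy0 (lt_irrefl _)
            have h1 : ∑ z ∈ Ico 0 (2 * N), mat (2 * N) (s2.mem aRes) z i = σ := by
              have : ∀ z ∈ Ico 0 (2 * N), mat (2 * N) (s2.mem aRes) z i =
                  capF N K i z - mat (2 * N) (s2.mem aRes) i z := by
                intro z hz
                have := j1.res_add i hiN z hz
                omega
              rw [sum_congr rfl this, sum_sub_distrib, sum_capF hN hi, j1.sum_res i hiN]
              simp [margin, hi, sent, hdi]
            have h2 := single_le_sum (f := fun z => mat (2 * N) (s2.mem aRes) z i)
              (fun z hz => j1.res_nonneg z hz i hiN) hy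
            have h3 := j1.res_add i hiN y hy
            have h4 : capF N K i y = K + 1 := by
              unfold capF; rw [if_neg]; omega
            omega
          obtain ⟨t, ht, ht0, hupd, hF'⟩ := augment_spec hNet (root := i) (s := s2) (n := 2 * N)
            (by rw [hag2.reg _ (by decide), hag1.reg _ (by decide), hrV0])
            ((ho0.of_agree hag1).of_agree hag2) hI2 hiN (by
              rw [hag2.mem _ (by decide), hag1.mem _ (by decide)]; exact hdd) hdem hdi.le j1
          have htN : N ≤ t := by
            by_contra h
            rw [j3 t (by simp at ht ⊢; omega)] at ht0
            exact absurd ht0 (lt_irrefl _)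
          refine ⟨?_, ?_, ?_, ?_⟩
          · simp only [FlowAt, State.setReg_mem] at hF' ⊢
            convert hF' using 1
            funext x
            rw [hupd]
            simp only [sent, Function.update_apply]
            push_cast
            split_ifs <;> first | omega | (subst_vars; omega)
          · intro x hx
            have := j2 x hx
            simp only [State.setReg_mem, hupd, Function.update_apply]
            split_ifs <;> omega
          · intro x hx
            have hxt : x ≠ t := by rw [mem_Ico] at hx; omega
            simp only [State.setReg_mem, hupd, Function.update_of_ne hxt]
            exact j3 x hx
          · simp only [State.setReg_mem, hupd]
            have h := sum_sdiff (f := s2.mem aDef) (singleton_subset_iff.2 ht)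
            rw [sum_singleton, j4] at h
            rw [sum_update_of_mem ht]
            push_cast
            linarith)
      obtain ⟨k1, k2, k3, k4⟩ := step
      rw [hrK1] at k1 k4
      refine ⟨?_, by simpa using k2, by simpa using k3, ?_⟩
      · simp only [FlowAt, State.setReg_mem] at k1 ⊢
        convert k1 using 1
        funext x
        unfold sent
        push_cast
        split_ifs <;> omega
      · simp only [State.setReg_mem, k4]
        rw [Int.toNat_of_nonneg hK]; push_cast; ring)
  have hden : transport.den s = (FProg.forTo rI rN (.forTo rS rK augment)).den s0 := rfl
  rw [← hden, hrN0] at key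
  obtain ⟨k1, k2, k3, k4⟩ := key
  rw [Int.toNat_of_nonneg hN] at k1 k4
  set s' := transport.den s
  have hzero : ∀ x ∈ Ico 0 (2 * N), s'.mem aDef x = 0 :=
    (sum_eq_zero_iff_of_nonneg k2).1 (by rw [k4]; simp)
  have hcap : ∀ x ∈ Ico 0 N, ∀ y ∈ Ico N (2 * N), mat (2 * N) (s'.mem aRes) x y =
      K + 1 - mat (2 * N) (s'.mem aRes) y x := by
    intro x hx y hy
    rw [mem_Ico] at hx hy
    have := k1.res_add x (by simp; omega) y (by simp; omega)
    unfold capF at this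
    rw [if_neg (by omega)] at this
    omega
  have hsame : ∀ x ∈ Ico 0 (2 * N), ∀ y ∈ Ico 0 (2 * N), (x < N ↔ y < N) →
      mat (2 * N) (s'.mem aRes) x y = 0 := by
    intro x hx y hy h
    have h1 := k1.res_add x hx y hy
    have h2 := k1.res_nonneg x hx y hy
    have h3 := k1.res_nonneg y hy x hx
    unfold capF at h1
    rw [if_pos h] at h1
    omega
  have hsub : Ico 0 N ⊆ Ico 0 (2 * N) := Ico_subset_Ico_right (by omega)
  have hsub' : Ico N (2 * N) ⊆ Ico 0 (2 * N) := Ico_subset_Ico_left hN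
  have hnonneg : ∀ x ∈ Ico 0 N, ∀ y ∈ Ico N (2 * N), 0 ≤ mat (2 * N) (s'.mem aRes) y x :=
    fun x hx y hy => k1.res_nonneg y (hsub' hy) x (hsub hx)
  have hrow : ∀ x ∈ Ico 0 N, ∑ y ∈ Ico N (2 * N), mat (2 * N) (s'.mem aRes) y x = K := by
    intro x hx
    have h1 := k1.sum_res x (hsub hx)
    rw [sum_Ico_two_mul hN, sum_eq_zero (s := Ico 0 N), zero_add,
      sum_congr rfl (hcap x hx), sum_sub_distrib, hzero x (hsub hx)] at h1
    · rw [mem_Ico] at hx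
      simp only [sum_const, Int.card_Ico, margin, sent, hx.2, if_true, nsmul_eq_mul] at h1
      rw [Int.toNat_of_nonneg (by omega)] at h1
      linarith
    · intro y hy
      refine hsame x (hsub hx) y (hsub hy) ?_
      rw [mem_Ico] at hx hy; omega
  refine ⟨s'.mem aPi, hnonneg, hrow, ?_, ?_, ?_⟩
  · intro y hy
    have h1 := k1.sum_res y (hsub' hy)
    rw [sum_Ico_two_mul hN, sum_eq_zero (s := Ico N (2 * N)), add_zero, hzero y (hsub' hy)] at h1
    · rw [mem_Ico] at hy
      simp only [h1, margin, sent]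
      rw [if_neg (by omega), if_neg (by omega)]
      split_ifs <;> simp
    · intro x hx
      refine hsame y (hsub' hy) x (hsub' hx) ?_
      rw [mem_Ico] at hx hy; omega
  · intro x hx y hy
    have h0 := single_le_sum (fun y hy => hnonneg x hx y hy) hy
    rw [hrow x hx] at h0
    have h1 := k1.pot x (hsub hx) y (hsub' hy) (by rw [hcap x hx y hy]; omega)
    rw [k1.cst_eq x (hsub hx) y (hsub' hy)] at h1
    rw [mem_Ico] at hx hy
    simp only [baseCost, secondDiff, hx.2, hy.1, and_self, if_true] at h1
    linarith
  · intro x hx y hy hpos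
    have h1 := k1.pot y (hsub' hy) x (hsub hx) hpos
    rw [k1.cst_eq y (hsub' hy) x (hsub hx), hcap x hx y hy] at h1
    rw [mem_Ico] at hx hy
    simp only [baseCost, secondDiff, hx.2, hy.1, and_self, if_true] at h1
    rw [if_neg (by omega), if_neg (by omega)] at h1
    linarith

end

end DiverseMatching

namespace DiverseMatching

/-! ### Optimality of the transportation problem for diverse matchings -/

/-- A potential difference is orthogonal to a matrix with vanishing row and column sums. -/
theorem sum_potential_mul_eq_zero {α : Type*} [CommRing α] {R Q : Finset ℤ} (π : ℤ → α)
    {θ : ℤ → ℤ → α} (hR : ∀ x ∈ R, ∑ y ∈ Q, θ x y = 0) (hQ : ∀ y ∈ Q, ∑ x ∈ R, θ x y = 0) :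
    ∑ x ∈ R, ∑ y ∈ Q, (π y - π x) * θ x y = 0 := by
  simp only [sub_mul, sum_sub_distrib]
  rw [sum_comm]
  simp only [← mul_sum]
  rw [sum_congr rfl fun y hy => by rw [hQ y hy],
    sum_congr (s₁ := R) rfl fun x hx => by rw [hR x hx]]
  simp

/-- A perfect matching of least cost for the costs `-1` on the support of a nonnegative matrix `C`
with equal margins and `0` elsewhere lies in the support of `C`, since a multiple of `C` is a
fractional solution that avoids all entries of cost `0`. -/
theorem le_of_transportOpt_support {N r : ℤ} (hr : 0 < r) {C m G D : ℤ → ℤ → ℤ}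
    {π : ℤ → ℤ} (hC : ∀ x ∈ Ico 0 N, ∀ y ∈ Ico N (2 * N), 0 ≤ C x y)
    (hCr : ∀ x ∈ Ico 0 N, ∑ y ∈ Ico N (2 * N), C x y = r)
    (hCc : ∀ y ∈ Ico N (2 * N), ∑ x ∈ Ico 0 N, C x y = r)
    (hG : ∀ x ∈ Ico 0 N, ∀ y ∈ Ico N (2 * N), G x y = if 0 < C x y then -1 else 0)
    (hD : ∀ x ∈ Ico 0 N, ∀ y ∈ Ico N (2 * N), D x y = 0)
    (hm : TransportOpt N 1 G D m π) :
    ∀ x ∈ Ico 0 N, ∀ y ∈ Ico N (2 * N), m x y ≤ C x y := by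
  have hle1 : ∀ x ∈ Ico 0 N, ∀ y ∈ Ico N (2 * N), m x y ≤ 1 := by
    intro x hx y hy
    rw [← hm.row_sum x hx]
    exact single_le_sum (fun y hy => hm.nonneg x hx y hy) hy
  have hler : ∀ x ∈ Ico 0 N, ∀ y ∈ Ico N (2 * N), C x y ≤ r := by
    intro x hx y hy
    rw [← hCr x hx]
    exact single_le_sum (fun y hy => hC x hx y hy) hy
  have h0 := sum_potential_mul_eq_zero (R := Ico 0 N) (Q := Ico N (2 * N)) π
    (θ := fun x y => C x y - r * m x y)
    (by intro x hx; simp only [sum_sub_distrib, ← mul_sum, hCr x hx, hm.row_sum x hx]; ring)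
    (by intro y hy; simp only [sum_sub_distrib, ← mul_sum, hCc y hy, hm.col_sum y hy]; ring)
  have h1 : ∑ x ∈ Ico 0 N, ∑ y ∈ Ico N (2 * N), (π y - π x) * (C x y - r * m x y) ≤
      ∑ x ∈ Ico 0 N, ∑ y ∈ Ico N (2 * N), G x y * (C x y - r * m x y) := by
    refine sum_le_sum fun x hx => sum_le_sum fun y hy => ?_
    have a1 := hm.nonneg x hx y hy
    have a2 := hle1 x hx y hy
    have a3 := hC x hx y hy
    have a4 := hler x hx y hy
    have a5 := hm.upper x hx y hy
    have a6 := hm.lower x hx y hy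
    rw [hD x hx y hy] at a5 a6
    rcases (by omega : m x y = 0 ∨ m x y = 1) with h | h
    · rw [h, mul_zero, sub_zero]
      exact mul_le_mul_of_nonneg_right (by linarith) a3
    · rw [h, mul_one]
      have := a6 (by omega)
      exact mul_le_mul_of_nonpos_right (by linarith) (by linarith)
  have h2 : ∑ x ∈ Ico 0 N, ∑ y ∈ Ico N (2 * N), G x y * (C x y - r * m x y) =
      - r * ∑ x ∈ Ico 0 N, ∑ y ∈ Ico N (2 * N), (G x y + 1) * m x y := by
    have e1 : ∀ x ∈ Ico 0 N, ∑ y ∈ Ico N (2 * N), G x y * (C x y - r * m x y) =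
        - r * ∑ y ∈ Ico N (2 * N), (G x y + 1) * m x y := by
      intro x hx
      have e2 : ∀ y ∈ Ico N (2 * N), G x y * (C x y - r * m x y) =
          - C x y + r * m x y - r * ((G x y + 1) * m x y) := by
        intro y hy
        have := hC x hx y hy
        rw [hG x hx y hy]
        split_ifs with h
        · ring
        · rw [show C x y = 0 by omega]; ring
      rw [sum_congr rfl e2, sum_sub_distrib, sum_add_distrib, sum_neg_distrib, ← mul_sum,
        ← mul_sum, hCr x hx, hm.row_sum x hx]
      ring
    rw [sum_congr rfl e1, ← mul_sum]
  have hpos : ∀ x ∈ Ico 0 N, ∀ y ∈ Ico N (2 * N), 0 ≤ (G x y + 1) * m x y := by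
    intro x hx y hy
    refine mul_nonneg ?_ (hm.nonneg x hx y hy)
    rw [hG x hx y hy]; split_ifs <;> simp
  intro x hx y hy
  by_contra hlt
  have b1 := hm.nonneg x hx y hy
  have b2 := hle1 x hx y hy
  have b3 := hC x hx y hy
  have b4 : (G x y + 1) * m x y = 1 := by
    rw [hG x hx y hy, if_neg (by omega), show m x y = 1 by omega]; rfl
  have b5 := single_le_sum (fun y hy => hpos x hx y hy) hy
  have b6 := single_le_sum (f := fun x => ∑ y ∈ Ico N (2 * N), (G x y + 1) * m x y)
    (fun x hx => sum_nonneg (hpos x hx)) hx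
  have b7 : 1 ≤ ∑ x ∈ Ico 0 N, ∑ y ∈ Ico N (2 * N), (G x y + 1) * m x y := by
    exact b4.symm.le.trans (b5.trans b6)
  rw [h0, h2] at h1
  nlinarith

/-- The deficits `k - u x` of a vector with total `k p` can be spread evenly over `a - p` dummies:
each dummy receives `k` in total, and each `x` receives its deficit. If there are no dummies, there
are no deficits. -/
theorem spread_deficit {a p k : ℤ} (hp : p ≤ a) {u : ℤ → ℚ} (hu : ∀ x ∈ Ico 0 a, u x ≤ k)
    (hs : ∑ x ∈ Ico 0 a, u x = k * p) (ha : 0 ≤ a) :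
    (∀ x ∈ Ico 0 a, ((a : ℚ) - p) * ((k - u x) / (a - p)) = k - u x) ∧
      (p < a → ∑ x ∈ Ico 0 a, (k - u x) / ((a : ℚ) - p) = k) := by
  have htot : ∑ x ∈ Ico 0 a, (k - u x) = k * (a - p) := by
    have : ((a.toNat : ℕ) : ℚ) = a := by exact_mod_cast Int.toNat_of_nonneg ha
    rw [sum_sub_distrib, hs, sum_const, Int.card_Ico, nsmul_eq_mul, sub_zero, this]; ring
  rcases hp.lt_or_eq with h | h
  · have h' : (a : ℚ) - p ≠ 0 := by
      have : (p : ℚ) < a := by exact_mod_cast h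
      intro; linarith
    refine ⟨fun x _ => by field_simp, fun _ => ?_⟩
    rw [← sum_div, htot]; field_simp
  · subst h
    refine ⟨fun x hx => ?_, fun h => absurd h (lt_irrefl _)⟩
    rw [sub_self, mul_zero] at htot
    rw [(sum_eq_zero_iff_of_nonneg (fun x hx => sub_nonneg.2 (hu x hx))).1 htot x hx]
    simp

/-- A nonnegative matrix on `a` rows and `b` columns with margins at most `k` and total `k p`
extends to a fractional matrix with all margins `k` by `b - p` dummy rows and `a - p` dummy columns
that do not meet. -/
theorem exists_extension {a b p k N : ℤ} (hpa : p ≤ a) (hpb : p ≤ b) (ha : 0 ≤ a) (hb : 0 ≤ b)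
    (hN : N = a + b - p) {c : ℤ → ℤ → ℚ}
    (hrow : ∀ x ∈ Ico 0 a, ∑ y ∈ Ico N (N + b), c x y ≤ k)
    (hcol : ∀ y ∈ Ico N (N + b), ∑ x ∈ Ico 0 a, c x y ≤ k)
    (htot : ∑ x ∈ Ico 0 a, ∑ y ∈ Ico N (N + b), c x y = k * p) :
    ∃ c' : ℤ → ℤ → ℚ, (∀ x ∈ Ico 0 N, ∑ y ∈ Ico N (2 * N), c' x y = k) ∧
      (∀ y ∈ Ico N (2 * N), ∑ x ∈ Ico 0 N, c' x y = k) ∧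
      (∀ x ∈ Ico 0 a, ∀ y ∈ Ico N (N + b), c' x y = c x y) ∧
      (∀ x ∈ Ico a N, ∀ y ∈ Ico (N + b) (2 * N), c' x y = 0) ∧
      (∀ x ∈ Ico 0 N, ∀ y ∈ Ico N (2 * N), (x < a ↔ N + b ≤ y) → 0 ≤ c' x y) := by
  -- The sum over a shifted interval, for the deficits of the columns.
  have hshift : ∀ f : ℤ → ℚ, ∑ y ∈ Ico N (N + b), f y = ∑ j ∈ Ico 0 b, f (N + j) := fun f => by
    refine sum_nbij' (· - N) (N + ·) ?_ ?_ ?_ ?_ ?_ <;> intro j hj <;> simp at hj ⊢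
    · omega
    · exact hj
  obtain ⟨u1, u2⟩ := spread_deficit hpa hrow htot ha
  obtain ⟨v1, v2⟩ := spread_deficit (a := b) (p := p) (k := k)
    (u := fun j => ∑ x ∈ Ico 0 a, c x (N + j)) hpb
    (fun j hj => hcol _ (by simp at hj ⊢; exact hj)) (by
      rw [← htot, sum_comm (s := Ico 0 a), hshift]) hb
  have hsplit : ∀ f : ℤ → ℚ, ∑ y ∈ Ico N (2 * N), f y =
      ∑ y ∈ Ico N (N + b), f y + ∑ y ∈ Ico (N + b) (2 * N), f y := fun f => by
    rw [← Ico_union_Ico_eq_Ico (by omega : N ≤ N + b) (by omega : N + b ≤ 2 * N),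
      sum_union (Ico_disjoint_Ico_consecutive _ _ _)]
  have hsplit' : ∀ f : ℤ → ℚ, ∑ y ∈ Ico 0 N, f y =
      ∑ y ∈ Ico 0 a, f y + ∑ y ∈ Ico a N, f y := fun f => by
    rw [← Ico_union_Ico_eq_Ico ha (by omega : a ≤ N),
      sum_union (Ico_disjoint_Ico_consecutive _ _ _)]
  have hpaQ : (0 : ℚ) ≤ a - p := by have : (p : ℚ) ≤ a := by exact_mod_cast hpa
                                    linarith
  have hpbQ : (0 : ℚ) ≤ b - p := by have : (p : ℚ) ≤ b := by exact_mod_cast hpb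
                                    linarith
  have hcard : ((#(Ico (N + b) (2 * N)) : ℕ) : ℚ) = a - p := by
    rw [Int.card_Ico]
    have : (((2 * N - (N + b)).toNat : ℤ)) = a - p := by omega
    exact_mod_cast congrArg (Int.cast : ℤ → ℚ) this
  have hcard' : ((#(Ico a N) : ℕ) : ℚ) = b - p := by
    rw [Int.card_Ico]
    have : (((N - a).toNat : ℤ)) = b - p := by omega
    exact_mod_cast congrArg (Int.cast : ℤ → ℚ) this
  refine ⟨fun x y => if x < a then if y < N + b then c x y
      else (k - ∑ y ∈ Ico N (N + b), c x y) / (a - p)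
    else if y < N + b then (k - ∑ x ∈ Ico 0 a, c x y) / (b - p) else 0, ?_, ?_, ?_, ?_, ?_⟩
  · intro x hx
    rw [hsplit]
    by_cases h : x < a
    · have hxa : x ∈ Ico 0 a := by simp at hx ⊢; omega
      rw [sum_congr rfl (g := fun y => c x y) (by intro y hy; simp at hy; simp [h, hy]),
        sum_congr (s₁ := Ico (N + b) (2 * N)) rfl
          (g := fun y => (k - ∑ y ∈ Ico N (N + b), c x y) / ((a : ℚ) - p))
          (by intro y hy; simp at hy; simp [h, hy]), sum_const, nsmul_eq_mul, hcard, u1 x hxa]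
      ring
    · have hab : p < b := by simp at hx; omega
      rw [sum_congr rfl (g := fun y => (k - ∑ x ∈ Ico 0 a, c x y) / ((b : ℚ) - p))
          (by intro y hy; simp at hy; simp [h, hy]),
        sum_congr (s₁ := Ico (N + b) (2 * N)) rfl (g := fun y => 0)
          (by intro y hy; simp at hy; simp [h, hy]), sum_const, smul_zero, add_zero, hshift, v2 hab]
  · intro y hy
    rw [hsplit']
    by_cases h : y < N + b
    · rw [sum_congr rfl (g := fun x => c x y) (by intro x hx; simp at hx; simp [h, hx]),
        sum_congr (s₁ := Ico a N) rfl
          (g := fun x => (k - ∑ x ∈ Ico 0 a, c x y) / ((b : ℚ) - p))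
          (by intro x hx; simp at hx; simp [h, hx]), sum_const, nsmul_eq_mul, hcard']
      have := v1 (y - N) (by simp at hy ⊢; omega)
      simp only [add_sub_cancel] at this
      rw [this]
      ring
    · have hab : p < a := by simp at hy; omega
      rw [sum_congr rfl (g := fun x => (k - ∑ y ∈ Ico N (N + b), c x y) / ((a : ℚ) - p))
          (by intro x hx; simp at hx; simp [h, hx]),
        sum_congr (s₁ := Ico a N) rfl (g := fun x => 0)
          (by intro x hx; simp at hx; simp [h, hx]), sum_const, smul_zero, add_zero, u2 hab]
  · intro x hx y hy
    simp at hx hy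
    simp [hx, hy]
  · intro x hx y hy
    simp at hx hy
    simp [not_lt.2 hx.1, not_lt.2 hy.1]
  · intro x hx y hy hxy
    rw [mem_Ico] at hx hy
    by_cases h : x < a
    · have h' := hxy.1 h
      simp only [h, if_true, not_lt.2 h', if_false]
      exact div_nonneg (sub_nonneg.2 (hrow x (by simp; omega))) hpaQ
    · have h' : y < N + b := by
        by_contra h'
        exact h (hxy.2 (not_lt.1 h'))
      simp only [h, if_false, h', if_true]
      exact div_nonneg (sub_nonneg.2 (hcol y (by simp; omega))) hpbQ

end DiverseMatching

namespace DiverseMatching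

/-! ### Diversity as a separable concave function -/

theorem sum_sum_eq_two_mul_sum_Ioi {k : ℕ} {f : Fin k → Fin k → ℤ} (hs : ∀ i j, f i j = f j i)
    (hd : ∀ i, f i i = 0) : ∑ i, ∑ j, f i j = 2 * ∑ i, ∑ j ∈ Ioi i, f i j := by
  have h1 : ∀ i, ∑ j, f i j = ∑ j ∈ Ioi i, f i j + ∑ j ∈ Iio i, f i j := by
    intro i
    have : (univ : Finset (Fin k)) = insert i (Ioi i ∪ Iio i) := by
      ext j
      simp only [mem_univ, mem_insert, mem_union, mem_Ioi, mem_Iio, true_iff]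
      rcases lt_trichotomy i j with h | rfl | h
      exacts [.inr (.inl h), .inl rfl, .inr (.inr h)]
    rw [this, sum_insert (by simp), hd, zero_add, sum_union]
    rw [disjoint_left]; intro j hj hj'; simp at hj hj'; exact lt_asymm hj hj'
  have h2 : ∑ i, ∑ j ∈ Iio i, f i j = ∑ i, ∑ j ∈ Ioi i, f i j := by
    rw [sum_comm' (t' := univ) (s' := fun j => Ioi j) (by simp)]
    exact sum_congr rfl fun i _ => sum_congr rfl fun j _ => hs _ _
  simp only [h1, sum_add_distrib, h2]
  ring

/-- An element that lies in `c` of `k` sets is counted `c (k - c)` times in their diversity. -/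
theorem diversity_eq {U : Type*} [DecidableEq U] [Fintype U] (w : U → ℤ) {k : ℕ}
    (S : Fin k → Finset U) :
    diversity w S = ∑ e, w e * (#{t | e ∈ S t} * (k - #{t | e ∈ S t})) := by
  have h := sum_sum_eq_two_mul_sum_Ioi (f := fun i j => ∑ e ∈ symmDiff (S i) (S j), w e)
    (fun i j => by rw [symmDiff_comm]) (fun i => by simp)
  have hd : diversity w S = ∑ i, ∑ j ∈ Ioi i, ∑ e ∈ symmDiff (S i) (S j), w e := rfl
  rw [← hd] at h
  have h2 : ∀ i j, ∑ e ∈ symmDiff (S i) (S j), w e = ∑ e, w e *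
      ((if e ∈ S i then 1 else 0) + (if e ∈ S j then 1 else 0)
        - 2 * ((if e ∈ S i then 1 else 0) * (if e ∈ S j then 1 else 0))) := by
    intro i j
    rw [← univ_inter (symmDiff (S i) (S j)), ← sum_ite_mem]
    refine sum_congr rfl fun e _ => ?_
    by_cases h1 : e ∈ S i <;> by_cases h2 : e ∈ S j <;> simp [mem_symmDiff, h1, h2]
  have h3 : ∀ e, ∑ i, ∑ j, w e * (((if e ∈ S i then 1 else 0) + (if e ∈ S j then 1 else 0)
        - 2 * ((if e ∈ S i then 1 else 0) * (if e ∈ S j then 1 else 0))) : ℤ) =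
      2 * (w e * (#{t | e ∈ S t} * (k - #{t | e ∈ S t}))) := by
    intro e
    simp only [← mul_sum, sum_sub_distrib, sum_add_distrib, sum_const, ← sum_mul, card_univ,
      Fintype.card_fin, nsmul_eq_mul, sum_boole]
    ring
  simp only [h2] at h
  have h4 : ∑ i, ∑ j, ∑ e, w e *
      ((if e ∈ S i then 1 else 0) + (if e ∈ S j then 1 else 0)
        - 2 * ((if e ∈ S i then 1 else 0) * (if e ∈ S j then 1 else 0)) : ℤ) =
      2 * ∑ e, w e * (#{t | e ∈ S t} * (k - #{t | e ∈ S t})) := by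
    rw [mul_sum, ← sum_congr rfl fun e _ => h3 e, sum_comm (s := univ (α := U))]
    exact sum_congr rfl fun i _ => sum_comm
  rw [h4] at h
  omega

variable {I : DiverseMatchingInstance} {N big : ℤ}

/-- The row of an edge. -/
def rowOf (I : DiverseMatchingInstance) (e : Fin I.numE) : ℤ := (I.endA e : ℕ)

/-- The column of an edge. -/
def colOf (I : DiverseMatchingInstance) (N : ℤ) (e : Fin I.numE) : ℤ := N + (I.endB e : ℕ)

theorem pos_injective {e f : Fin I.numE} (h1 : rowOf I e = rowOf I f)
    (h2 : colOf I N e = colOf I N f) : e = f := by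
  apply I.simple
  simp only [rowOf, colOf] at h1 h2
  ext <;> simp <;> omega

/-- The costs of the transportation problem of an instance, whose rows are the vertices of `A` and
then dummies for `B`, and whose columns are the vertices of `B` and then dummies for `A`. The
matrix `F` marks the forbidden pairs: nonadjacent vertices, and two dummies. -/
structure Costs (I : DiverseMatchingInstance) (N big : ℤ) (F G D : ℤ → ℤ → ℤ) : Prop where
  edge_F : ∀ e, F (rowOf I e) (colOf I N e) = 0
  edge_G : ∀ e, G (rowOf I e) (colOf I N e) = I.weight e - I.k * I.weight e
  edge_D : ∀ e, D (rowOf I e) (colOf I N e) = 2 * I.weight e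
  other_F : ∀ x ∈ Ico 0 N, ∀ y ∈ Ico N (2 * N), (∀ e, ¬ (rowOf I e = x ∧ colOf I N e = y)) →
    F x y = if (x < I.numA ↔ y < N + I.numB) then 1 else 0
  other_G : ∀ x ∈ Ico 0 N, ∀ y ∈ Ico N (2 * N), (∀ e, ¬ (rowOf I e = x ∧ colOf I N e = y)) →
    G x y = if (x < I.numA ↔ y < N + I.numB) then big else 0
  other_D : ∀ x ∈ Ico 0 N, ∀ y ∈ Ico N (2 * N), (∀ e, ¬ (rowOf I e = x ∧ colOf I N e = y)) →
    D x y = 0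

theorem card_le_numA {M : Finset (Fin I.numE)} (hM : I.IsMatching M) : #M ≤ I.numA := by
  have := card_le_card_of_injOn (t := univ) I.endA (by simp) (s := M) (fun e he f hf h => by
    by_contra hne; exact (hM e he f hf hne).1 h)
  simpa using this

theorem card_le_numB {M : Finset (Fin I.numE)} (hM : I.IsMatching M) : #M ≤ I.numB := by
  have := card_le_card_of_injOn (t := univ) I.endB (by simp) (s := M) (fun e he f hf h => by
    by_contra hne; exact (hM e he f hf hne).2 h)
  simpa using this

/-- The convex function `- w c (k - c)` lies above its linearization at `c` with any slope `δ`
between its two one-sided differences there; the lower one matters only if `c` can decrease. -/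
theorem linearization_edge {w k c c' δ : ℤ} (hw : 0 ≤ w) (hc' : 0 ≤ c')
    (hup : δ ≤ w - k * w + 2 * w * c) (hlo : 0 < c → w - k * w + 2 * w * (c - 1) ≤ δ) :
    δ * (c' - c) ≤ w * (c * (k - c)) - w * (c' * (k - c')) := by
  rcases lt_trichotomy c' c with h | h | h
  · nlinarith [mul_le_mul_of_nonneg_right (hlo (by omega)) (by omega : 0 ≤ c - c'),
      mul_nonneg hw (mul_nonneg (by omega : 0 ≤ c - c') (by omega : 0 ≤ c - c' - 1))]
  · subst h; simp
  · nlinarith [mul_le_mul_of_nonneg_right hup (by omega : 0 ≤ c' - c),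
      mul_nonneg hw (mul_nonneg (by omega : 0 ≤ c' - c) (by omega : 0 ≤ c' - c - 1))]

/-- Summing over all positions the values of the edges there gives the sum over all edges. -/
theorem sum_sum_edges {α : Type*} [AddCommMonoid α] {R Q : Finset ℤ}
    (hR : ∀ e, rowOf I e ∈ R) (hQ : ∀ e, colOf I N e ∈ Q)
    (q : Fin I.numE → α) :
    ∑ x ∈ R, ∑ y ∈ Q, ∑ e, (if rowOf I e = x ∧ colOf I N e = y then q e else 0) = ∑ e, q e := by
  have h1 : ∀ x ∈ R, ∑ y ∈ Q, ∑ e, (if rowOf I e = x ∧ colOf I N e = y then q e else 0) =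
      ∑ e, if rowOf I e = x then q e else 0 := by
    intro x _
    rw [sum_comm]
    refine sum_congr rfl fun e _ => ?_
    by_cases h : rowOf I e = x
    · simp [h, hQ e]
    · simp [h]
  rw [sum_congr rfl h1, sum_comm]
  refine sum_congr rfl fun e _ => ?_
  simp [hR e]

theorem sum_edges_at {α : Type*} [AddCommMonoid α] (q : Fin I.numE → α) (e : Fin I.numE) :
    ∑ f, (if rowOf I f = rowOf I e ∧ colOf I N f = colOf I N e then q f else 0) = q e := by
  rw [sum_eq_single e]
  · simp
  · intro f _ hf
    rw [if_neg]
    exact fun h => hf (pos_injective h.1 h.2)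
  · simp

/-- An optimal solution `c` of the transportation problem compared with a feasible family, extended
fractionally to the dummies. -/
theorem objective_le (hw : ∀ e, 0 ≤ I.weight e) (hpA : I.p ≤ I.numA) (hpB : I.p ≤ I.numB)
    (hN : N = I.numA + I.numB - I.p) (hbig : 0 ≤ big) {F G D c : ℤ → ℤ → ℤ} {π : ℤ → ℤ}
    (hC : Costs I N big F G D) (hopt : TransportOpt N I.k G D c π)
    {M : Fin I.k → Finset (Fin I.numE)} (hM : I.IsFeasible M) {b : ℤ}
    (hb : b = 0 ∨ b = big ∧ ∃ x ∈ Ico 0 N, ∃ y ∈ Ico N (2 * N), F x y = 1 ∧ 0 < c x y) :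
    diversity I.weight M + b ≤ ∑ e, I.weight e *
      (c (rowOf I e) (colOf I N e) * (I.k - c (rowOf I e) (colOf I N e))) := by
  obtain ⟨hk, hp⟩ : (0 : ℤ) ≤ I.k ∧ (0 : ℤ) ≤ I.p := ⟨by omega, by omega⟩
  have hR : ∀ e, rowOf I e ∈ Ico 0 (I.numA : ℤ) := fun e => by
    have := (I.endA e).2; simp [rowOf]
  have hQ : ∀ e, colOf I N e ∈ Ico N (N + I.numB) := fun e => by
    have := (I.endB e).2; simp [colOf]
  have hRs : Ico 0 (I.numA : ℤ) ⊆ Ico 0 N := Ico_subset_Ico_right (by omega)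
  have hQs : Ico N (N + I.numB) ⊆ Ico N (2 * N) := Ico_subset_Ico_right (by omega)
  set cnt : Fin I.numE → ℕ := fun e => #{t | e ∈ M t} with hcnt
  have hcnt' : ∀ P : Fin I.numE → Prop, ∀ [DecidablePred P],
      ∑ e, (if P e then (cnt e : ℚ) else 0) = ∑ t, (#{e ∈ M t | P e} : ℚ) := by
    intro P _
    have : ∀ e, (if P e then (cnt e : ℚ) else 0) = ∑ t, if e ∈ M t ∧ P e then 1 else 0 := by
      intro e
      by_cases h : P e <;> simp [h, hcnt]
    simp only [this]
    rw [sum_comm]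
    refine sum_congr rfl fun t _ => ?_
    rw [sum_boole, ← filter_filter, filter_univ_mem]
  have hle : ∀ P : Fin I.numE → Prop, ∀ [DecidablePred P],
      (∀ t, ∀ e ∈ M t, P e → ∀ f ∈ M t, P f → e = f) →
      ∑ e, (if P e then (cnt e : ℚ) else 0) ≤ I.k := by
    intro P _ hP
    rw [hcnt']
    have : ∀ t ∈ (univ : Finset (Fin I.k)), (#{e ∈ M t | P e} : ℚ) ≤ 1 := by
      intro t _
      have : #{e ∈ M t | P e} ≤ 1 := card_le_one.2 fun e he f hf => by
        rw [mem_filter] at he hf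
        exact hP t e he.1 he.2 f hf.1 hf.2
      exact_mod_cast this
    simpa using sum_le_sum this
  obtain ⟨c', r1, r2, r3, r4, r5⟩ := exists_extension (a := I.numA) (b := I.numB) (p := I.p)
    (k := I.k) (N := N) (by omega) (by omega) (by omega) (by omega) hN
    (c := fun x y => ∑ e, if rowOf I e = x ∧ colOf I N e = y then (cnt e : ℚ) else 0)
    (by
      intro x _
      have : ∑ y ∈ Ico N (N + I.numB), ∑ e, (if rowOf I e = x ∧ colOf I N e = y then
          (cnt e : ℚ) else 0) = ∑ e, if rowOf I e = x then (cnt e : ℚ) else 0 := by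
        rw [sum_comm]
        refine sum_congr rfl fun e _ => ?_
        by_cases h : rowOf I e = x
        · simp only [h, true_and, if_true]; rw [sum_ite_eq, if_pos (hQ e)]
        · simp [h]
      rw [this]
      refine hle _ fun t e he hx f hf hx' => ?_
      by_contra hne
      refine ((hM t).1 e he f hf hne).1 ?_
      simp only [rowOf] at hx hx'
      ext; omega)
    (by
      intro y _
      have : ∑ x ∈ Ico 0 (I.numA : ℤ), ∑ e, (if rowOf I e = x ∧ colOf I N e = y then
          (cnt e : ℚ) else 0) = ∑ e, if colOf I N e = y then (cnt e : ℚ) else 0 := by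
        rw [sum_comm]
        refine sum_congr rfl fun e _ => ?_
        by_cases h : colOf I N e = y
        · simp only [h, and_true, if_true]; rw [sum_ite_eq, if_pos (hR e)]
        · simp [h]
      rw [this]
      refine hle _ fun t e he hx f hf hx' => ?_
      by_contra hne
      refine ((hM t).1 e he f hf hne).2 ?_
      simp only [colOf] at hx hx'
      ext; omega)
    (by
      rw [sum_sum_edges hR hQ]
      have := hcnt' fun _ => True
      simp only [if_true, filter_true] at this
      rw [this, sum_congr rfl fun t _ => by rw [(hM t).2]]
      simp)
  -- The loss of `c'` on forbidden pairs, which `c'` does not use.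
  let β : ℤ → ℤ → ℤ := fun x y => if F x y = 1 then big * c x y else 0
  have hβ0 : ∀ x ∈ Ico 0 N, ∀ y ∈ Ico N (2 * N), 0 ≤ β x y := by
    intro x hx y hy
    simp only [β]
    split_ifs
    · exact mul_nonneg hbig (hopt.nonneg x hx y hy)
    · rfl
  have hβ : b ≤ ∑ x ∈ Ico 0 N, ∑ y ∈ Ico N (2 * N), β x y := by
    rcases hb with rfl | ⟨rfl, x, hx, y, hy, h1, h2⟩
    · exact sum_nonneg fun x hx => sum_nonneg (hβ0 x hx)
    · refine le_trans ?_ (single_le_sum (f := fun x => ∑ y ∈ Ico N (2 * N), β x y)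
        (fun x hx => sum_nonneg (hβ0 x hx)) hx)
      refine le_trans ?_ (single_le_sum (hβ0 x hx) hy)
      simp only [β, h1, if_true]
      nlinarith
  let q : Fin I.numE → ℤ := fun e => I.weight e *
    (c (rowOf I e) (colOf I N e) * (I.k - c (rowOf I e) (colOf I N e)))
    - I.weight e * (cnt e * (I.k - cnt e))
  have hpt : ∀ x ∈ Ico 0 N, ∀ y ∈ Ico N (2 * N), ((π y : ℚ) - π x) * (c' x y - c x y) ≤
      ∑ e, (if rowOf I e = x ∧ colOf I N e = y then (q e : ℚ) else 0) - β x y := by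
    intro x hx y hy
    have a1 := hopt.nonneg x hx y hy
    have a2 := hopt.upper x hx y hy
    have a3 := hopt.lower x hx y hy
    by_cases he : ∃ e, rowOf I e = x ∧ colOf I N e = y
    · obtain ⟨e, rfl, rfl⟩ := he
      rw [sum_edges_at, r3 _ (hR e) _ (hQ e), sum_edges_at]
      simp only [β, hC.edge_F]
      rw [hC.edge_G, hC.edge_D] at a2 a3
      have := linearization_edge (hw e) (Int.natCast_nonneg (cnt e)) a2 a3
      simp only [q]
      norm_num
      exact_mod_cast this
    · push Not at he
      have he' : ∀ e, ¬ (rowOf I e = x ∧ colOf I N e = y) := fun e h => he e h.1 h.2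
      rw [hC.other_G x hx y hy he', hC.other_D x hx y hy he'] at a2 a3
      simp only [β, hC.other_F x hx y hy he', he', if_false, sum_const_zero]
      by_cases hf : x < I.numA ↔ y < N + I.numB
      · have hc0 : c' x y = 0 := by
          rw [mem_Ico] at hx hy
          by_cases hxa : x < I.numA
          · rw [r3 x (by simp; omega) y (by simp; have := hf.1 hxa; omega)]
            simp [he']
          · exact r4 x (by simp; omega) y (by simp; have := mt hf.2 hxa; omega)
        simp only [hf, if_true, hc0] at a2 a3 ⊢
        have : (π y - π x) * (0 - c x y) ≤ 0 - big * c x y := by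
          rcases a1.eq_or_lt with h | h
          · rw [← h]; simp
          · have := a3 h; nlinarith
        exact_mod_cast this
      · have hc0 : 0 ≤ c' x y := r5 x hx y hy (by
          rw [← not_lt]; tauto)
        simp only [hf, if_false] at a2 a3 ⊢
        norm_num at a2 a3 ⊢
        have a2' : (π y : ℚ) - π x ≤ 0 := by exact_mod_cast (by omega : π y - π x ≤ 0)
        rcases a1.eq_or_lt with h | h
        · rw [← h]; norm_num; exact mul_nonpos_of_nonpos_of_nonneg a2' hc0
        · have := a3 h
          rw [show π x = π y by omega]; simp
  have hsum := sum_le_sum fun x hx => sum_le_sum (hpt x hx)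
  rw [sum_potential_mul_eq_zero (fun x => (π x : ℚ))] at hsum
  · simp only [sum_sub_distrib] at hsum
    rw [sum_sum_edges (fun e => hRs (hR e)) (fun e => hQs (hQ e))] at hsum
    have h1 : 0 ≤ ∑ e, q e - ∑ x ∈ Ico 0 N, ∑ y ∈ Ico N (2 * N), β x y := by exact_mod_cast hsum
    simp only [q, sum_sub_distrib] at h1
    rw [diversity_eq]
    linarith
  · intro x hx
    rw [sum_sub_distrib, r1 x hx, ← Int.cast_sum, hopt.row_sum x hx, sub_self]
  · intro y hy
    rw [sum_sub_distrib, r2 y hy, ← Int.cast_sum, hopt.col_sum y hy, sub_self]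

end DiverseMatching

namespace DiverseMatching

variable {I : DiverseMatchingInstance} {N big : ℤ}

theorem diversity_nonneg {U : Type*} [DecidableEq U] {w : U → ℤ} (hw : ∀ e, 0 ≤ w e) {k : ℕ}
    (S : Fin k → Finset U) : 0 ≤ diversity w S :=
  sum_nonneg fun _ _ => sum_nonneg fun _ _ => sum_nonneg fun e _ => hw e

/-- If an optimal solution uses a forbidden pair, then no feasible family exists, since a forbidden
pair costs more than the largest possible diversity. -/
theorem not_isFeasible_of_forbidden (hw : ∀ e, 0 ≤ I.weight e) (hpA : I.p ≤ I.numA)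
    (hpB : I.p ≤ I.numB) (hN : N = I.numA + I.numB - I.p)
    (hbig : big = 1 + I.k * I.k * ∑ e, I.weight e) {F G D c : ℤ → ℤ → ℤ} {π : ℤ → ℤ}
    (hC : Costs I N big F G D) (hopt : TransportOpt N I.k G D c π) {x y : ℤ} (hx : x ∈ Ico 0 N)
    (hy : y ∈ Ico N (2 * N)) (hF : F x y = 1) (hc : 0 < c x y)
    (M : Fin I.k → Finset (Fin I.numE)) : ¬ I.IsFeasible M := by
  intro hM
  have hW : 0 ≤ ∑ e, I.weight e := sum_nonneg fun e _ => hw e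
  have h := objective_le hw hpA hpB hN (by rw [hbig]; positivity) hC hopt hM
    (.inr ⟨rfl, x, hx, y, hy, hF, hc⟩)
  have h1 : ∑ e, I.weight e *
      (c (rowOf I e) (colOf I N e) * (I.k - c (rowOf I e) (colOf I N e))) ≤
      ∑ e, I.weight e * (I.k * I.k) := by
    refine sum_le_sum fun e _ => mul_le_mul_of_nonneg_left ?_ (hw e)
    have hR : rowOf I e ∈ Ico 0 N := by
      have := (I.endA e).2; simp [rowOf]; omega
    have hQ : colOf I N e ∈ Ico N (2 * N) := by
      have := (I.endB e).2; simp [colOf]; omega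
    have h0 := hopt.nonneg _ hR _ hQ
    have hk := single_le_sum (hopt.nonneg _ hR) hQ
    rw [hopt.row_sum _ hR] at hk
    nlinarith
  rw [← sum_mul] at h1
  have := diversity_nonneg hw M
  rw [hbig] at h
  nlinarith

/-- A permutation matrix: a nonnegative integral matrix with all margins equal to `1`. -/
structure IsPerm (N : ℤ) (m : ℤ → ℤ → ℤ) : Prop where
  nonneg : ∀ x ∈ Ico 0 N, ∀ y ∈ Ico N (2 * N), 0 ≤ m x y
  row_sum : ∀ x ∈ Ico 0 N, ∑ y ∈ Ico N (2 * N), m x y = 1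
  col_sum : ∀ y ∈ Ico N (2 * N), ∑ x ∈ Ico 0 N, m x y = 1

theorem IsPerm.zero_or_one {m : ℤ → ℤ → ℤ} (hm : IsPerm N m) {x y : ℤ} (hx : x ∈ Ico 0 N)
    (hy : y ∈ Ico N (2 * N)) : m x y = 0 ∨ m x y = 1 := by
  have h0 := hm.nonneg x hx y hy
  have h1 := single_le_sum (hm.nonneg x hx) hy
  rw [hm.row_sum x hx] at h1
  omega

/-- A permutation matrix without forbidden entries restricts to a matching of cardinality `p`:
of the `numA` rows of `A`, exactly `numA - p` are matched to dummies. -/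
theorem IsPerm.isMatching (hpA : I.p ≤ I.numA) (hpB : I.p ≤ I.numB)
    (hN : N = I.numA + I.numB - I.p) {F G D m : ℤ → ℤ → ℤ}
    (hC : Costs I N big F G D) (hm : IsPerm N m)
    (hF : ∀ x ∈ Ico 0 N, ∀ y ∈ Ico N (2 * N), F x y = 1 → m x y = 0)
    {M : Finset (Fin I.numE)} (hM : ∀ e, e ∈ M ↔ m (rowOf I e) (colOf I N e) = 1) :
    I.IsMatching M ∧ #M = I.p := by
  have hR : ∀ e, rowOf I e ∈ Ico 0 (I.numA : ℤ) := fun e => by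
    have := (I.endA e).2; simp [rowOf]
  have hQ : ∀ e, colOf I N e ∈ Ico N (N + I.numB) := fun e => by
    have := (I.endB e).2; simp [colOf]
  have hRs : Ico 0 (I.numA : ℤ) ⊆ Ico 0 N := Ico_subset_Ico_right (by omega)
  have hQs : Ico N (N + I.numB) ⊆ Ico N (2 * N) := Ico_subset_Ico_right (by omega)
  constructor
  · intro e he f hf hef
    rw [hM] at he hf
    constructor
    · intro h
      have hrow : rowOf I e = rowOf I f := by simp only [rowOf, h]
      have hcol : colOf I N e ≠ colOf I N f := fun h' => hef (pos_injective hrow h')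
      have h1 := hm.row_sum _ (hRs (hR e))
      have h2 := sum_le_sum_of_subset_of_nonneg (f := m (rowOf I e))
        (s := {colOf I N e, colOf I N f}) (t := Ico N (2 * N))
        (by simp only [insert_subset_iff, singleton_subset_iff]; exact ⟨hQs (hQ e), hQs (hQ f)⟩)
        (fun y hy _ => hm.nonneg _ (hRs (hR e)) y hy)
      rw [sum_pair hcol, h1, he, hrow, hf] at h2
      omega
    · intro h
      have hcol : colOf I N e = colOf I N f := by simp only [colOf, h]
      have hrow : rowOf I e ≠ rowOf I f := fun h' => hef (pos_injective h' hcol)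
      have h1 := hm.col_sum _ (hQs (hQ e))
      have h2 := sum_le_sum_of_subset_of_nonneg (f := fun x => m x (colOf I N e))
        (s := {rowOf I e, rowOf I f}) (t := Ico 0 N)
        (by simp only [insert_subset_iff, singleton_subset_iff]; exact ⟨hRs (hR e), hRs (hR f)⟩)
        (fun x hx _ => hm.nonneg x hx _ (hQs (hQ e)))
      rw [sum_pair hrow, h1, he, hcol, hf] at h2
      omega
  · have h1 : ∀ x ∈ Ico 0 (I.numA : ℤ), ∀ y ∈ Ico N (N + I.numB), m x y =
        ∑ e, if rowOf I e = x ∧ colOf I N e = y then m (rowOf I e) (colOf I N e) else 0 := by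
      intro x hx y hy
      by_cases he : ∃ e, rowOf I e = x ∧ colOf I N e = y
      · obtain ⟨e, rfl, rfl⟩ := he
        rw [sum_edges_at]
      · push Not at he
        have he' : ∀ e, ¬ (rowOf I e = x ∧ colOf I N e = y) := fun e h => he e h.1 h.2
        simp only [he', if_false, sum_const_zero]
        refine hF x (hRs hx) y (hQs hy) ?_
        rw [hC.other_F x (hRs hx) y (hQs hy) he', if_pos]
        rw [mem_Ico] at hx hy
        tauto
    have h2 : ∑ x ∈ Ico 0 (I.numA : ℤ), ∑ y ∈ Ico N (N + I.numB), m x y = #M := by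
      rw [sum_congr rfl fun x hx => sum_congr rfl (h1 x hx), sum_sum_edges hR hQ]
      have : ∀ e, m (rowOf I e) (colOf I N e) = if e ∈ M then 1 else 0 := by
        intro e
        rcases hm.zero_or_one (hRs (hR e)) (hQs (hQ e)) with h | h <;> simp [hM, h]
      rw [sum_congr rfl fun e _ => this e, sum_boole, filter_univ_mem]
    have h3 : ∑ x ∈ Ico 0 (I.numA : ℤ), ∑ y ∈ Ico (N + I.numB) (2 * N), m x y =
        I.numA - I.p := by
      have h4 : ∀ y ∈ Ico (N + I.numB) (2 * N), ∑ x ∈ Ico 0 (I.numA : ℤ), m x y = 1 := by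
        intro y hy
        rw [mem_Ico] at hy
        have hyQ : y ∈ Ico N (2 * N) := by simp; omega
        rw [← hm.col_sum y hyQ]
        refine sum_subset hRs fun x hx hx' => hF x hx y hyQ ?_
        rw [mem_Ico] at hx hx'
        rw [hC.other_F x (mem_Ico.2 hx) y hyQ, if_pos (by omega)]
        rintro e ⟨rfl, -⟩
        exact hx' (mem_Ico.1 (hR e))
      rw [sum_comm, sum_congr rfl h4, sum_const, Int.card_Ico]
      simp
      omega
    have h5 : ∑ x ∈ Ico 0 (I.numA : ℤ), ∑ y ∈ Ico N (2 * N), m x y = I.numA := by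
      rw [sum_congr rfl fun x hx => hm.row_sum x (hRs hx)]
      simp
    rw [← Ico_union_Ico_eq_Ico (by omega : N ≤ N + I.numB) (by omega : N + I.numB ≤ 2 * N)] at h5
    simp only [sum_union (Ico_disjoint_Ico_consecutive _ _ _), sum_add_distrib, h2, h3] at h5
    omega

/-- A decomposition of an optimal solution without forbidden entries into permutation matrices is an
optimal family of matchings. -/
theorem isOptimal_of_decomposition (hw : ∀ e, 0 ≤ I.weight e) (hpA : I.p ≤ I.numA)
    (hpB : I.p ≤ I.numB) (hN : N = I.numA + I.numB - I.p) (hbig : 0 ≤ big)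
    {F G D c : ℤ → ℤ → ℤ} {π : ℤ → ℤ} (hC : Costs I N big F G D)
    (hopt : TransportOpt N I.k G D c π)
    (hF : ∀ x ∈ Ico 0 N, ∀ y ∈ Ico N (2 * N), F x y = 1 → c x y = 0)
    {m : ℕ → ℤ → ℤ → ℤ} (hm : ∀ t < I.k, IsPerm N (m t))
    (hsum : ∀ x ∈ Ico 0 N, ∀ y ∈ Ico N (2 * N), c x y = ∑ t ∈ range I.k, m t x y)
    {M : Fin I.k → Finset (Fin I.numE)}
    (hM : ∀ t e, e ∈ M t ↔ m t (rowOf I e) (colOf I N e) = 1) : I.IsOptimal M := by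
  refine ⟨fun t => ?_, fun M' hM' => ?_⟩
  · refine (hm t t.2).isMatching hpA hpB hN hC (fun x hx y hy h => ?_) (hM t)
    have h1 := hF x hx y hy h
    rw [hsum x hx y hy] at h1
    exact (sum_eq_zero_iff_of_nonneg fun s hs => (hm s (mem_range.1 hs)).nonneg x hx y hy).1 h1 t
      (mem_range.2 t.2)
  · have h := objective_le hw hpA hpB hN hbig hC hopt hM' (.inl rfl)
    rw [add_zero] at h
    refine h.trans (le_of_eq ?_)
    rw [diversity_eq]
    refine sum_congr rfl fun e _ => ?_
    have hR : rowOf I e ∈ Ico 0 N := by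
      have := (I.endA e).2; simp [rowOf]; omega
    have hQ : colOf I N e ∈ Ico N (2 * N) := by
      have := (I.endB e).2; simp [colOf]; omega
    have : c (rowOf I e) (colOf I N e) = #{t | e ∈ M t} := by
      rw [hsum _ hR _ hQ, ← Fin.sum_univ_eq_sum_range (fun t => m t (rowOf I e) (colOf I N e)),
        ← sum_boole]
      refine sum_congr rfl fun t _ => ?_
      rcases (hm t t.2).zero_or_one hR hQ with h | h <;> simp [hM, h]
    rw [this]

end DiverseMatching

namespace DiverseMatching

/-! ### Setting up the transportation problem of an instance -/

variable {I : DiverseMatchingInstance} {N big : ℤ}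

/-- The instance is stored in the state. -/
structure Loaded (I : DiverseMatchingInstance) (N : ℤ) (s : State) : Prop where
  numA : s.reg rA = I.numA
  numB : s.reg rB = I.numB
  numE : s.reg rE = I.numE
  k : s.reg rk = I.k
  rows : s.reg rN = N
  nodes : s.reg rV = 2 * N
  endA : ∀ e : Fin I.numE, s.mem aA (e : ℕ) = (I.endA e : ℕ)
  endB : ∀ e : Fin I.numE, s.mem aB (e : ℕ) = (I.endB e : ℕ)
  weight : ∀ e : Fin I.numE, s.mem aW (e : ℕ) = I.weight e

theorem Loaded.of_agree {R Y : List ℕ} {s s' : State} (h : Loaded I N s) (hag : Agree R Y s s')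
    (hR : ∀ x ∈ [rA, rB, rE, rk, rN, rV], x ∉ R := by decide)
    (hY : ∀ a ∈ [aA, aB, aW], a ∉ Y := by decide) : Loaded I N s' where
  numA := by rw [hag.reg _ (hR _ (by simp)), h.numA]
  numB := by rw [hag.reg _ (hR _ (by simp)), h.numB]
  numE := by rw [hag.reg _ (hR _ (by simp)), h.numE]
  k := by rw [hag.reg _ (hR _ (by simp)), h.k]
  rows := by rw [hag.reg _ (hR _ (by simp)), h.rows]
  nodes := by rw [hag.reg _ (hR _ (by simp)), h.nodes]
  endA := by rw [hag.mem _ (hY _ (by simp))]; exact h.endA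
  endB := by rw [hag.mem _ (hY _ (by simp))]; exact h.endB
  weight := by rw [hag.mem _ (hY _ (by simp))]; exact h.weight

/-- A loop whose iterations add `v 0, v 1, …` to a register. -/
theorem reg_forTo_add {x n r : ℕ} {P : FProg} {s : State} (v : ℕ → ℤ) (hrx : r ≠ x)
    (hb : ∀ (i : ℕ) (s' : State), (i : ℤ) < s.reg n → Agree (x :: P.writes) P.arrs s s' →
      s'.reg x = i → (P.den s').reg r = s'.reg r + v i) :
    ((forTo x n P).den s).reg r = s.reg r + ∑ i ∈ range (s.reg n).toNat, v i :=
  forTo_rule (fun i s' => s'.reg r = s.reg r + ∑ j ∈ range i, v j) (by simp [hrx])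
    (by
      intro i s' hi hag hx h
      simp only [State.setReg_reg, hrx, if_false, hb i s' hi hag hx, h, sum_range_succ]
      ring)

/-- Compute the offsets of the rows of square matrices. -/
def offsets : FProg :=
  .assign rAcc (.const 0) ;;
  .forTo rX rV (.store aOff (.reg rX) (.reg rAcc) ;; .assign rAcc (.add (.reg rAcc) (.reg rV)))

theorem offsets_spec (s : State) : Offsets (offsets.den s) := by
  have hV : (offsets.den s).reg rV = s.reg rV := (agree_den offsets s).reg _ (by decide)
  have key := forTo_rule (x := rX) (n := rV) (s := s.setReg rAcc 0)
    (P := .store aOff (.reg rX) (.reg rAcc) ;; .assign rAcc (.add (.reg rAcc) (.reg rV)))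
    (fun i s' => s'.reg rAcc = i * s.reg rV ∧ ∀ j : ℤ, 0 ≤ j → j < i → s'.mem aOff j = j * s.reg rV)
    ⟨by simp, by intro j h h'; push_cast at h'; omega⟩
    (by
      rintro i s' - hag hx ⟨h1, h2⟩
      have h3 := hag.reg rV (by decide)
      simp only [State.setReg_reg] at h3
      norm_num at h3
      refine ⟨?_, ?_⟩
      · simp [h1, h3]; ring
      · intro j hj hji
        push_cast at hji
        by_cases h : j = i
        · simp [h, h1, hx]
        · simp [hx, h]
          exact h2 j hj (by omega))
  intro x hx
  rw [hV] at hx ⊢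
  rw [mem_Ico] at hx
  refine key.2 x hx.1 ?_
  simp
  omega

/-- Add `k² ∑ w` to the register `rBig`. -/
def addWeights : FProg :=
  .forTo rJ rE (.forTo rS rk (.forTo rM rk (.assign rBig (.add (.reg rBig) (at1 aW rJ)))))

theorem sum_range_toNat_fin {n : ℕ} (f : ℕ → ℤ) :
    ∑ i ∈ range ((n : ℤ)).toNat, f i = ∑ i : Fin n, f i := by
  rw [Int.toNat_natCast, Fin.sum_univ_eq_sum_range]

theorem addWeights_spec {s : State} (h : Loaded I N s) :
    (addWeights.den s).reg rBig = s.reg rBig + I.k * I.k * ∑ e, I.weight e := by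
  unfold addWeights
  rw [reg_forTo_add (fun j => I.k * (I.k * s.mem aW j)) (by decide), h.numE, sum_range_toNat_fin]
  · simp only [← mul_sum, h.weight]; ring
  · intro j s1 _ hag1 hj
    have hk1 : s1.reg rk = I.k := by rw [hag1.reg _ (by decide), h.k]
    rw [reg_forTo_add (fun _ => I.k * s.mem aW j) (by decide), hk1]
    · simp
    · intro _ s2 _ hag2 _
      have hk2 : s2.reg rk = I.k := by rw [hag2.reg _ (by decide), hk1]
      rw [reg_forTo_add (fun _ => s.mem aW j) (by decide), hk2]
      · simp
      · intro _ s3 _ hag3 _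
        have h3 : s3.mem aW = s.mem aW := by
          rw [hag3.mem _ (by decide), hag2.mem _ (by decide), hag1.mem _ (by decide)]
        have h4 : s3.reg rJ = j := by rw [hag3.reg _ (by decide), hag2.reg _ (by decide), hj]
        simp [h3, h4]

/-- The address of the matrix entry of the edge `rJ`. -/
def edgeIdx : Expr := .add (.read aOff (at1 aA rJ)) (.add (.reg rN) (at1 aB rJ))

/-- Write the costs of the edges. -/
def edgeCosts : FProg :=
  .forTo rJ rE
    (.assign rAcc (.const 0) ;;
    .forTo rS rk (.assign rAcc (.add (.reg rAcc) (at1 aW rJ))) ;;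
    .store aF edgeIdx (.const 0) ;;
    .store aG edgeIdx (.sub (at1 aW rJ) (.reg rAcc)) ;;
    .store aD edgeIdx (.add (at1 aW rJ) (at1 aW rJ)))

/-- Mark the forbidden pairs and write all costs. A pair that is not an edge is forbidden if it
consists of two vertices or of two dummies. -/
def costs : FProg :=
  forPairs (.ite (.and (.lt (.reg rX) (.reg rA)) (.lt (.reg rY) (.add (.reg rN) (.reg rB))))
    (.store aF (idx rX rY) (.const 1))
    (.ite (.and (.not (.lt (.reg rX) (.reg rA)))
        (.not (.lt (.reg rY) (.add (.reg rN) (.reg rB)))))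
      (.store aF (idx rX rY) (.const 1)) (.store aF (idx rX rY) (.const 0)))) ;;
  forPairs (.ite (.eq (cell aF rX rY) (.const 1)) (.store aG (idx rX rY) (.reg rBig))
    (.store aG (idx rX rY) (.const 0))) ;;
  forPairs (.store aD (idx rX rY) (.const 0)) ;;
  edgeCosts

/-- The matrix `m` has the entries `v e` at the first `i` edges `e`, and agrees with `f`
elsewhere. -/
def Overlay (I : DiverseMatchingInstance) (N : ℤ) (i : ℕ) (v : Fin I.numE → ℤ)
    (f : ℤ → ℤ → ℤ) (m : ℤ → ℤ) : Prop :=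
  (∀ e : Fin I.numE, (e : ℕ) < i → mat (2 * N) m (rowOf I e) (colOf I N e) = v e) ∧
  ∀ x ∈ Ico 0 N, ∀ y ∈ Ico N (2 * N),
    (∀ e : Fin I.numE, (e : ℕ) < i → ¬ (rowOf I e = x ∧ colOf I N e = y)) →
    mat (2 * N) m x y = f x y

theorem Overlay.step {v : Fin I.numE → ℤ} {f : ℤ → ℤ → ℤ} {m : ℤ → ℤ}
    (hB : I.numB ≤ N) {e : Fin I.numE} (h : Overlay I N e v f m) :
    Overlay I N ((e : ℕ) + 1) v f
      (Function.update m (rowOf I e * (2 * N) + colOf I N e) (v e)) := by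
  have hQ : ∀ e, colOf I N e ∈ Ico N (2 * N) := fun e => by
    have := (I.endB e).2; simp [colOf]; omega
  have hQ0 : ∀ e, 0 ≤ colOf I N e := fun e => by have := (mem_Ico.1 (hQ e)).1; omega
  refine ⟨fun e' he' => ?_, fun x hx y hy hxy => ?_⟩
  · rw [mat_update _ _ (hQ0 e) (mem_Ico.1 (hQ e)).2 (hQ0 e') (mem_Ico.1 (hQ e')).2]
    by_cases hee : e' = e
    · subst hee; simp
    · rw [if_neg fun h' => hee (pos_injective h'.1 h'.2)]
      exact h.1 e' (by omega)
  · rw [mem_Ico] at hy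
    rw [mat_update _ _ (hQ0 e) (mem_Ico.1 (hQ e)).2 (by omega) hy.2, if_neg]
    · exact h.2 x hx y (mem_Ico.2 hy) fun e' he' => hxy e' (by omega)
    · rintro ⟨rfl, rfl⟩
      exact hxy e (by omega) ⟨rfl, rfl⟩

theorem Overlay.zero {v : Fin I.numE → ℤ} {f : ℤ → ℤ → ℤ} {m : ℤ → ℤ}
    (h : ∀ x ∈ Ico 0 (2 * N), ∀ y ∈ Ico 0 (2 * N), mat (2 * N) m x y = f x y) :
    Overlay I N 0 v f m := by
  refine ⟨fun e he => by omega, fun x hx y hy _ => h x ?_ y ?_⟩ <;> simp at * <;> omega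

theorem edgeIdx_eval {s : State} (h : Loaded I N s) (ho : Offsets s) (hA : I.numA ≤ 2 * N)
    (e : Fin I.numE) (hj : s.reg rJ = (e : ℕ)) :
    edgeIdx.eval s = rowOf I e * (2 * N) + colOf I N e := by
  have h1 := ho (I.endA e : ℕ) (by have := (I.endA e).2; rw [h.nodes]; simp; omega)
  rw [h.nodes] at h1
  simp [edgeIdx, hj, h.endA, h.endB, h1, h.rows, rowOf, colOf]

theorem costs_spec {s : State} (h : Loaded I N s) (ho : Offsets s) (hA : I.numA ≤ N)
    (hB : I.numB ≤ N) :
    let s' := costs.den s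
    Costs I N (s.reg rBig) (mat (2 * N) (s'.mem aF)) (mat (2 * N) (s'.mem aG))
      (mat (2 * N) (s'.mem aD)) := by
  obtain ⟨a1, b1⟩ := forPairs_spec (a := aF) (s := s) (n := 2 * N)
    (P := .ite (.and (.lt (.reg rX) (.reg rA)) (.lt (.reg rY) (.add (.reg rN) (.reg rB))))
      (.store aF (idx rX rY) (.const 1))
      (.ite (.and (.not (.lt (.reg rX) (.reg rA)))
          (.not (.lt (.reg rY) (.add (.reg rN) (.reg rB)))))
        (.store aF (idx rX rY) (.const 1)) (.store aF (idx rX rY) (.const 0)))) h.nodes ho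
    (by decide) (fun x y => if (x < I.numA ↔ y < N + I.numB) then 1 else 0) (by
      intro i j s' _ _ oi _ hag hx hy _
      have h' := h.of_agree hag
      by_cases h1 : i < I.numA <;> by_cases h2 : j < N + I.numB <;>
        simp [hx, hy, oi, h'.numA, h'.numB, h'.rows, h1, h2, -not_lt])
  set s1 := (forPairs (.ite (.and (.lt (.reg rX) (.reg rA))
      (.lt (.reg rY) (.add (.reg rN) (.reg rB))))
    (.store aF (idx rX rY) (.const 1))
    (.ite (.and (.not (.lt (.reg rX) (.reg rA)))
        (.not (.lt (.reg rY) (.add (.reg rN) (.reg rB)))))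
      (.store aF (idx rX rY) (.const 1)) (.store aF (idx rX rY) (.const 0))))).den s with hs1
  have h1 := h.of_agree a1
  have ho1 : Offsets s1 := ho.of_agree a1
  obtain ⟨a2, b2⟩ := forPairs_spec (a := aG) (s := s1) (n := 2 * N)
    (P := .ite (.eq (cell aF rX rY) (.const 1)) (.store aG (idx rX rY) (.reg rBig))
      (.store aG (idx rX rY) (.const 0))) h1.nodes ho1 (by decide)
    (fun x y => if (x < I.numA ↔ y < N + I.numB) then s.reg rBig else 0) (by
      intro i j s' hi hj oi _ hag hx hy _
      have e1 := b1 i hi j hj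
      have e2 := hag.mem aF (by decide)
      have e3 := (hag.reg rBig (by decide)).trans (a1.reg rBig (by decide))
      simp only [mat, ← e2] at e1
      by_cases h1 : i < I.numA ↔ j < N + I.numB <;> simp [hx, hy, oi, e1, e3, h1])
  set s2 := (forPairs (.ite (.eq (cell aF rX rY) (.const 1)) (.store aG (idx rX rY) (.reg rBig))
    (.store aG (idx rX rY) (.const 0)))).den s1 with hs2
  have h2 := h1.of_agree a2
  have ho2 : Offsets s2 := ho1.of_agree a2
  obtain ⟨a3, b3⟩ := forPairs_spec (a := aD) (s := s2) (n := 2 * N)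
    (P := .store aD (idx rX rY) (.const 0)) h2.nodes ho2 (by decide)
    (fun _ _ => 0) (by
      intro i j s' hi hj oi _ hag hx hy _
      simp [hx, hy, oi])
  set s3 := (forPairs (.store aD (idx rX rY) (.const 0))).den s2 with hs3
  have h3 := h2.of_agree a3
  have ho3 : Offsets s3 := ho2.of_agree a3
  have key := forTo_rule (x := rJ) (n := rE) (s := s3)
    (P := .assign rAcc (.const 0) ;;
      .forTo rS rk (.assign rAcc (.add (.reg rAcc) (at1 aW rJ))) ;;
      .store aF edgeIdx (.const 0) ;;
      .store aG edgeIdx (.sub (at1 aW rJ) (.reg rAcc)) ;;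
      .store aD edgeIdx (.add (at1 aW rJ) (at1 aW rJ)))
    (fun i s' =>
      Overlay I N i (fun _ => 0) (fun x y => if (x < I.numA ↔ y < N + I.numB) then 1 else 0)
        (s'.mem aF) ∧
      Overlay I N i (fun e => I.weight e - I.k * I.weight e)
        (fun x y => if (x < I.numA ↔ y < N + I.numB) then s.reg rBig else 0) (s'.mem aG) ∧
      Overlay I N i (fun e => 2 * I.weight e) (fun _ _ => 0) (s'.mem aD))
    (by
      refine ⟨.zero ?_, .zero ?_, .zero ?_⟩
      · simpa only [State.setReg_mem, a3.mem aF (by decide), a2.mem aF (by decide)] using b1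
      · simpa only [State.setReg_mem, a3.mem aG (by decide)] using b2
      · simpa only [State.setReg_mem] using b3)
    (by
      rintro i s' hi hag hj ⟨o1, o2, o3⟩
      rw [h3.numE] at hi
      obtain ⟨e, rfl⟩ : ∃ e : Fin I.numE, (e : ℕ) = i := ⟨⟨i, by omega⟩, rfl⟩
      have h' := h3.of_agree hag
      have ho' : Offsets s' := ho3.of_agree hag
      set s4 := (FProg.forTo rS rk (.assign rAcc (.add (.reg rAcc) (at1 aW rJ)))).den
        (s'.setReg rAcc 0) with hs4
      have a4 : Agree [rAcc, rS] [] s' s4 :=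
        ((Agree.refl _ _ s').setReg 0 (by simp)).trans
          ((agree_den _ _).mono (by decide) (by decide))
      have h4 := h'.of_agree a4
      have hj4 : s4.reg rJ = (e : ℕ) := by rw [a4.reg _ (by decide), hj]
      have ei : ∀ s6, Agree [] [aF, aG, aD] s4 s6 →
          edgeIdx.eval s6 = rowOf I e * (2 * N) + colOf I N e := fun s6 a6 =>
        edgeIdx_eval (h4.of_agree a6) ((ho'.of_agree a4).of_agree a6) (by omega) e
          (by rw [a6.reg _ (by decide), hj4])
      have hacc : s4.reg rAcc = I.k * I.weight e := by
        rw [hs4, reg_forTo_add (fun _ => I.weight e) (by decide)]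
        · simp [h'.k]
        · intro _ s5 _ hag5 _
          have e1 : s5.reg rJ = (e : ℕ) := by rw [hag5.reg _ (by decide)]; simp [hj]
          have e2 : s5.mem aW = s'.mem aW := by rw [hag5.mem _ (by decide)]; simp
          simp [e1, e2, h'.weight]
      have hW : s4.mem aW (e : ℕ) = I.weight e := h4.weight e
      simp only [den_seq, den_assign, Expr.eval]
      rw [← hs4]
      have e1 := ei s4 (.refl _ _ _)
      set q := rowOf I e * (2 * N) + colOf I N e with hq
      have e2 := ei (s4.setMem aF q 0) ((Agree.refl _ _ _).setMem _ _ (by simp))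
      have e3 := ei ((s4.setMem aF q 0).setMem aG q (I.weight e - I.k * I.weight e))
        (((Agree.refl _ _ _).setMem _ _ (by simp)).setMem _ _ (by simp))
      have hF4 : s4.mem aF = s'.mem aF := a4.mem _ (by simp)
      have hG4 : s4.mem aG = s'.mem aG := a4.mem _ (by simp)
      have hD4 : s4.mem aD = s'.mem aD := a4.mem _ (by simp)
      refine ⟨?_, ?_, ?_⟩
      · simpa [e1, e2, e3, hF4] using o1.step hB
      · simpa [e1, e2, e3, hG4, hj4, hW, hacc] using o2.step hB
      · simpa [e1, e2, e3, hD4, hj4, hW, hacc, ← two_mul] using o3.step hB)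
  rw [h3.numE, Int.toNat_natCast] at key
  obtain ⟨o1, o2, o3⟩ := key
  exact ⟨fun e => o1.1 e e.2, fun e => o2.1 e e.2, fun e => o3.1 e e.2,
    fun x hx y hy he => o1.2 x hx y hy fun e _ => he e,
    fun x hx y hy he => o2.2 x hx y hy fun e _ => he e,
    fun x hx y hy he => o3.2 x hx y hy fun e _ => he e⟩

end DiverseMatching

namespace DiverseMatching

variable {I : DiverseMatchingInstance} {N big : ℤ}

/-! ### Decomposition into perfect matchings -/

/-- Record the forbidden pairs that the solution uses in the register `rBad`. -/
def checkForbidden : FProg :=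
  forPairs (.ite (.and rowCol (.and (.eq (cell aF rX rY) (.const 1))
      (.lt (.const 0) (cell aRes rY rX))))
    (.assign rBad (.const 1)) .skip)

theorem checkForbidden_spec {s : State} {n : ℤ} (hN : s.reg rN = N) (hn : s.reg rV = n)
    (ho : Offsets s) :
    (s.reg rBad = 1 → (checkForbidden.den s).reg rBad = 1) ∧
    (s.reg rBad = 0 →
      ((checkForbidden.den s).reg rBad = 0 ∧ ∀ x ∈ Ico 0 N, ∀ y ∈ Ico N n,
        mat n (s.mem aF) x y = 1 → mat n (s.mem aRes) y x ≤ 0) ∨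
      ((checkForbidden.den s).reg rBad = 1 ∧ ∃ x ∈ Ico 0 N, ∃ y ∈ Ico N n,
        mat n (s.mem aF) x y = 1 ∧ 0 < mat n (s.mem aRes) y x)) := by
  have key := forTo_forTo_rule (x := rX) (y := rY) (n := rV) (s := s)
    (P := .ite (.and rowCol (.and (.eq (cell aF rX rY) (.const 1))
      (.lt (.const 0) (cell aRes rY rX)))) (.assign rBad (.const 1)) .skip)
    (fun i j s' => (s.reg rBad = 1 → s'.reg rBad = 1) ∧
      (s.reg rBad = 0 →
      (s'.reg rBad = 0 ∧ ∀ x ∈ Ico 0 N, ∀ y ∈ Ico N n, (x < i ∨ x = i ∧ y < j) →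
        mat n (s.mem aF) x y = 1 → mat n (s.mem aRes) y x ≤ 0) ∨
      (s'.reg rBad = 1 ∧ ∃ x ∈ Ico 0 N, ∃ y ∈ Ico N n,
        mat n (s.mem aF) x y = 1 ∧ 0 < mat n (s.mem aRes) y x)))
    (by decide) (by decide) (by decide)
    ⟨by simp, fun h => .inl ⟨by simpa using h, by
      intro x hx y hy h; simp at hx hy h; omega⟩⟩
    (by intro i s' h; simpa using h)
    (by
      rintro i j s' hi hj hag hx hy ⟨h1, h2⟩
      rw [hn] at hi hj
      have hmem : s'.mem = s.mem := by funext a; exact hag.mem a (by simp)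
      have hN' : s'.reg rN = N := by rw [hag.reg _ (by decide), hN]
      have hoi : s.mem aOff i = i * n := by rw [← hn]; exact ho i (by simp [hn, hi])
      have hoj : s.mem aOff j = j * n := by rw [← hn]; exact ho j (by simp [hn, hj])
      by_cases hc : ((i : ℤ) < N ∧ N ≤ j) ∧ mat n (s.mem aF) i j = 1 ∧ 0 < mat n (s.mem aRes) j i
      · have hden : (FProg.ite (.and rowCol (.and (.eq (cell aF rX rY) (.const 1))
            (.lt (.const 0) (cell aRes rY rX)))) (.assign rBad (.const 1)) .skip).den s' =
            s'.setReg rBad 1 := by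
          simp only [mat] at hc
          simp [rowCol, hx, hy, hN', hmem, hoi, hoj, hc]
        rw [hden]
        refine ⟨by simp, fun _ => .inr ⟨by simp, i, by simp; omega, j, by simp; omega, hc.2⟩⟩
      · have hden : (FProg.ite (.and rowCol (.and (.eq (cell aF rX rY) (.const 1))
            (.lt (.const 0) (cell aRes rY rX)))) (.assign rBad (.const 1)) .skip).den s' = s' := by
          simp only [mat] at hc
          rw [den_ite, if_neg]
          · rfl
          · simpa [rowCol, hx, hy, hN', hmem, hoi, hoj] using hc
        rw [hden]
        refine ⟨by simpa using h1, fun h => (h2 h).imp (fun h => ⟨by simpa using h.1, ?_⟩)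
          (by simp)⟩
        intro x hx' y hy' hxy hF
        by_cases hxi : x = i ∧ y = j
        · obtain ⟨rfl, rfl⟩ := hxi
          by_contra hlt
          rw [mem_Ico] at hx' hy'
          exact hc ⟨⟨hx'.2, hy'.1⟩, hF, not_le.1 hlt⟩
        · refine h.2 x hx' y hy' ?_ hF
          push_cast at hxy
          omega)
    (by
      intro i s' h
      simp only [State.setReg_reg]
      norm_num at h ⊢
      refine ⟨h.1, fun h0 => (h.2 h0).imp (fun h' => ⟨h'.1, ?_⟩) id⟩
      intro x hx0 hxN y hyN hyn hxy
      refine h'.2 x hx0 hxN y hyN hyn ?_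
      omega)
  have hden : checkForbidden.den s = (FProg.forTo rX rV (.forTo rY rV (.ite (.and rowCol
    (.and (.eq (cell aF rX rY) (.const 1)) (.lt (.const 0) (cell aRes rY rX))))
    (.assign rBad (.const 1)) .skip))).den s := rfl
  rw [← hden] at key
  refine ⟨key.1, fun h => (key.2 h).imp (fun h' => ⟨h'.1, fun x hx y hy => h'.2 x hx y hy ?_⟩) id⟩
  rw [mem_Ico] at hx hy
  omega

/-- The address of the matrix entry of the reverse of the edge `rJ`. -/
def revEdgeIdx : Expr := .add (.read aOff (.add (.reg rN) (at1 aB rJ))) (at1 aA rJ)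

/-- Write the edges of the perfect matching in `aRes` to the output. -/
def writeMatching : FProg :=
  .forTo rJ rE (.store aOut (.add (.reg rOut) (.reg rJ)) (.read aRes revEdgeIdx))

theorem writeMatching_spec {s : State} (h : Loaded I N s) (ho : Offsets s) (hN : 0 ≤ N)
    (hB : I.numB ≤ N) :
    (∀ e : Fin I.numE, (writeMatching.den s).mem aOut (s.reg rOut + (e : ℕ)) =
      mat (2 * N) (s.mem aRes) (colOf I N e) (rowOf I e)) ∧
    ∀ j < s.reg rOut, (writeMatching.den s).mem aOut j = s.mem aOut j := by
  have key := forTo_rule (x := rJ) (n := rE) (s := s)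
    (P := .store aOut (.add (.reg rOut) (.reg rJ)) (.read aRes revEdgeIdx))
    (fun i s' => (∀ e : Fin I.numE, (e : ℕ) < i → s'.mem aOut (s.reg rOut + (e : ℕ)) =
      mat (2 * N) (s.mem aRes) (colOf I N e) (rowOf I e)) ∧
      ∀ j < s.reg rOut, s'.mem aOut j = s.mem aOut j)
    ⟨fun e he => by omega, by simp⟩
    (by
      rintro i s' hi hag hj ⟨h1, h2⟩
      rw [h.numE] at hi
      obtain ⟨e, rfl⟩ : ∃ e : Fin I.numE, (e : ℕ) = i := ⟨⟨i, by omega⟩, rfl⟩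
      have h' := h.of_agree hag
      have hO : s'.reg rOut = s.reg rOut := hag.reg _ (by decide)
      have hRes : s'.mem aRes = s.mem aRes := hag.mem _ (by decide)
      have hoff : s'.mem aOff (N + (I.endB e : ℕ)) = (N + (I.endB e : ℕ)) * (2 * N) := by
        have := (ho.of_agree hag) (N + (I.endB e : ℕ)) (by
          have := (I.endB e).2
          rw [h'.nodes]; simp; omega)
        rwa [h'.nodes] at this
      have hval : (Expr.read aRes revEdgeIdx).eval s' =
          mat (2 * N) (s.mem aRes) (colOf I N e) (rowOf I e) := by
        simp [revEdgeIdx, h'.rows, hj, h'.endA, h'.endB, hoff, hRes, mat, colOf, rowOf]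
      rw [den_store, hval]
      simp only [Expr.eval, hO, hj]
      refine ⟨fun e' he' => ?_, fun j hj' => ?_⟩
      · by_cases hee : e' = e
        · subst hee; simp
        · have : (e' : ℕ) ≠ e := fun h => hee (Fin.ext h)
          have hne : s.reg rOut + ((e' : ℕ) : ℤ) ≠ s.reg rOut + ((e : ℕ) : ℤ) := by omega
          simp only [State.setReg_mem, State.setMem_mem, if_true, Function.update_of_ne hne]
          exact h1 e' (by omega)
      · have hne : j ≠ s.reg rOut + ((e : ℕ) : ℤ) := by omega
        simp only [State.setReg_mem, State.setMem_mem, if_true, Function.update_of_ne hne]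
        exact h2 j hj')
  rw [h.numE, Int.toNat_natCast] at key
  exact ⟨fun e => key.1 e e.2, key.2⟩

/-- Find a perfect matching in the support of the matrix in `aC`, write it to the output, and
subtract it. -/
def splitStep : FProg :=
  forPairs (.ite (.lt (.const 0) (cell aC rX rY)) (.store aG (idx rX rY) (.const (-1)))
    (.store aG (idx rX rY) (.const 0))) ;;
  forPairs (.store aD (idx rX rY) (.const 0)) ;;
  transport ;;
  writeMatching ;;
  forPairs (.store aC (idx rX rY) (.sub (cell aC rX rY) (cell aRes rY rX))) ;;
  .assign rOut (.add (.reg rOut) (.reg rE))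

theorem splitStep_spec {s : State} (h : Loaded I N s) (ho : Offsets s) (hN : 0 ≤ N)
    (hB : I.numB ≤ N) (hK : s.reg rK = 1) (hbig : s.reg rBig = 1) {r : ℤ} (hr : 0 < r)
    (hC : ∀ x ∈ Ico 0 N, ∀ y ∈ Ico N (2 * N), 0 ≤ mat (2 * N) (s.mem aC) x y)
    (hCr : ∀ x ∈ Ico 0 N, ∑ y ∈ Ico N (2 * N), mat (2 * N) (s.mem aC) x y = r)
    (hCc : ∀ y ∈ Ico N (2 * N), ∑ x ∈ Ico 0 N, mat (2 * N) (s.mem aC) x y = r) :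
    let s' := splitStep.den s
    ∃ m, IsPerm N m ∧
      (∀ x ∈ Ico 0 N, ∀ y ∈ Ico N (2 * N), m x y ≤ mat (2 * N) (s.mem aC) x y) ∧
      (∀ x ∈ Ico 0 N, ∀ y ∈ Ico N (2 * N),
        mat (2 * N) (s'.mem aC) x y = mat (2 * N) (s.mem aC) x y - m x y) ∧
      (∀ e : Fin I.numE, s'.mem aOut (s.reg rOut + (e : ℕ)) = m (rowOf I e) (colOf I N e)) ∧
      (∀ j < s.reg rOut, s'.mem aOut j = s.mem aOut j) ∧
      s'.reg rOut = s.reg rOut + I.numE := by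
  have hsub : Ico 0 N ⊆ Ico 0 (2 * N) := Ico_subset_Ico_right (by omega)
  have hsub' : Ico N (2 * N) ⊆ Ico 0 (2 * N) := Ico_subset_Ico_left hN
  obtain ⟨a1, b1⟩ := forPairs_spec (a := aG) (s := s) (n := 2 * N)
    (P := .ite (.lt (.const 0) (cell aC rX rY)) (.store aG (idx rX rY) (.const (-1)))
      (.store aG (idx rX rY) (.const 0))) h.nodes ho (by decide)
    (fun x y => if 0 < mat (2 * N) (s.mem aC) x y then -1 else 0) (by
      intro i j s' _ _ oi _ hag hx hy _
      have e1 := hag.mem aC (by decide)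
      by_cases h1 : 0 < mat (2 * N) (s.mem aC) i j
      · have h1' := h1
        simp only [mat] at h1'
        simp [hx, hy, oi, e1, h1, h1']
      · have h1' := h1
        simp only [mat] at h1'
        simp only [den_ite, Test.Holds, Expr.eval, cell, idx, hx, hy, oi, e1, h1', h1, if_false,
          den_store])
  set s1 := (forPairs (.ite (.lt (.const 0) (cell aC rX rY)) (.store aG (idx rX rY) (.const (-1)))
      (.store aG (idx rX rY) (.const 0)))).den s with hs1
  have h1 := h.of_agree a1
  have ho1 : Offsets s1 := ho.of_agree a1
  obtain ⟨a2, b2⟩ := forPairs_spec (a := aD) (s := s1) (n := 2 * N)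
    (P := .store aD (idx rX rY) (.const 0)) h1.nodes ho1 (by decide)
    (fun _ _ => 0) (by
      intro i j s' hi hj oi _ hag hx hy _
      simp [hx, hy, oi])
  set s2 := (forPairs (.store aD (idx rX rY) (.const 0))).den s1 with hs2
  have h2 := h1.of_agree a2
  have ho2 : Offsets s2 := ho1.of_agree a2
  have hG2 : ∀ x ∈ Ico 0 N, ∀ y ∈ Ico N (2 * N), mat (2 * N) (s2.mem aG) x y =
      if 0 < mat (2 * N) (s.mem aC) x y then -1 else 0 := by
    intro x hx y hy
    rw [a2.mem aG (by decide)]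
    exact b1 x (hsub hx) y (hsub' hy)
  have hD2 : ∀ x ∈ Ico 0 N, ∀ y ∈ Ico N (2 * N), mat (2 * N) (s2.mem aD) x y = 0 :=
    fun x hx y hy => b2 x (hsub hx) y (hsub' hy)
  obtain ⟨π, hπ⟩ := transport_spec (s := s2) (K := 1) hN (by decide) h2.rows h2.nodes
    (by rw [a2.reg _ (by decide), a1.reg _ (by decide), hK]) ho2
    (G := mat (2 * N) (s2.mem aG)) (D := mat (2 * N) (s2.mem aD)) (fun _ _ _ _ => rfl)
    (fun _ _ _ _ => rfl) (by
      intro x hx y hy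
      rw [hG2 x hx y hy, a2.reg _ (by decide), a1.reg _ (by decide), hbig]
      split_ifs <;> simp) (fun x hx y hy => (hD2 x hx y hy).ge)
  have a3 := agree_transport s2
  set s3 := transport.den s2 with hs3
  have h3 := h2.of_agree a3
  have ho3 : Offsets s3 := ho2.of_agree a3
  obtain ⟨w1, w2⟩ := writeMatching_spec h3 ho3 hN hB
  have a4 := agree_den writeMatching s3
  set s4 := writeMatching.den s3 with hs4
  have h4 := h3.of_agree a4
  have ho4 : Offsets s4 := ho3.of_agree a4
  have hC4 : s4.mem aC = s.mem aC := by
    rw [a4.mem _ (by decide), a3.mem _ (by decide), a2.mem _ (by decide), a1.mem _ (by decide)]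
  have hR4 : s4.mem aRes = s3.mem aRes := a4.mem _ (by decide)
  have hO3 : s3.reg rOut = s.reg rOut := by
    rw [a3.reg _ (by decide), a2.reg _ (by decide), a1.reg _ (by decide)]
  obtain ⟨a5, b5⟩ := forPairs_spec (a := aC) (s := s4) (n := 2 * N)
    (P := .store aC (idx rX rY) (.sub (cell aC rX rY) (cell aRes rY rX))) h4.nodes ho4 (by decide)
    (fun x y => mat (2 * N) (s.mem aC) x y - mat (2 * N) (s3.mem aRes) y x) (by
      intro i j s' _ _ oi oj hag hx hy he
      have e1 := hag.mem aRes (by decide)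
      rw [hC4] at he
      rw [hR4] at e1
      rw [← he]
      simp [hx, hy, oi, oj, e1, mat])
  set s5 := (forPairs (.store aC (idx rX rY) (.sub (cell aC rX rY) (cell aRes rY rX)))).den s4
    with hs5
  have hden : splitStep.den s = s5.setReg rOut (s5.reg rOut + s5.reg rE) := rfl
  have hO5 : s5.reg rOut = s.reg rOut := by
    rw [a5.reg _ (by decide), a4.reg _ (by decide), hO3]
  have hA5 : s5.mem aOut = s4.mem aOut := a5.mem _ (by decide)
  have hE5 : s5.reg rE = I.numE := (h4.of_agree a5).numE
  refine ⟨fun x y => mat (2 * N) (s3.mem aRes) y x, ⟨hπ.nonneg, hπ.row_sum, hπ.col_sum⟩,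
    le_of_transportOpt_support hr hC hCr hCc hG2 hD2 hπ, ?_, ?_, ?_, ?_⟩
  · intro x hx y hy
    simp only [hden, State.setReg_mem]
    exact b5 x (hsub hx) y (hsub' hy)
  · intro e
    simp only [hden, State.setReg_mem, hA5, ← hO3]
    exact w1 e
  · intro j hj
    simp only [hden, State.setReg_mem, hA5]
    rw [← hO3] at hj
    rw [w2 j hj, a3.mem _ (by decide), a2.mem _ (by decide), a1.mem _ (by decide)]
  · simp [hden, hO5, hE5]

/-- Decompose the matrix in `aC` into perfect matchings and write them to the output. -/
def decompose : FProg := .assign rOut (.const 0) ;; .forTo rT rk splitStep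

theorem decompose_spec {s : State} (h : Loaded I N s) (ho : Offsets s) (hN : 0 ≤ N)
    (hB : I.numB ≤ N) (hK : s.reg rK = 1) (hbig : s.reg rBig = 1)
    (hC : ∀ x ∈ Ico 0 N, ∀ y ∈ Ico N (2 * N), 0 ≤ mat (2 * N) (s.mem aC) x y)
    (hCr : ∀ x ∈ Ico 0 N, ∑ y ∈ Ico N (2 * N), mat (2 * N) (s.mem aC) x y = I.k)
    (hCc : ∀ y ∈ Ico N (2 * N), ∑ x ∈ Ico 0 N, mat (2 * N) (s.mem aC) x y = I.k) :
    ∃ m : ℕ → ℤ → ℤ → ℤ, (∀ t < I.k, IsPerm N (m t)) ∧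
      (∀ x ∈ Ico 0 N, ∀ y ∈ Ico N (2 * N),
        mat (2 * N) (s.mem aC) x y = ∑ t ∈ range I.k, m t x y) ∧
      ∀ t < I.k, ∀ e : Fin I.numE,
        (decompose.den s).mem aOut (t * I.numE + (e : ℕ)) = m t (rowOf I e) (colOf I N e) := by
  have key := forTo_rule (x := rT) (n := rk) (P := splitStep) (s := s.setReg rOut 0)
    (fun t s' => s'.reg rOut = t * I.numE ∧ ∃ m : ℕ → ℤ → ℤ → ℤ, (∀ u < t, IsPerm N (m u)) ∧
      (∀ x ∈ Ico 0 N, ∀ y ∈ Ico N (2 * N), 0 ≤ mat (2 * N) (s'.mem aC) x y) ∧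
      (∀ x ∈ Ico 0 N, ∀ y ∈ Ico N (2 * N), mat (2 * N) (s.mem aC) x y =
        mat (2 * N) (s'.mem aC) x y + ∑ u ∈ range t, m u x y) ∧
      ∀ u < t, ∀ e : Fin I.numE,
        s'.mem aOut (u * I.numE + (e : ℕ)) = m u (rowOf I e) (colOf I N e))
    ⟨by simp, fun _ _ _ => 0, by simp, by simpa using hC, by simp, by simp⟩
    (by
      rintro t s' ht hag hT ⟨hO, m, g1, g2, g3, g4⟩
      have h' : Loaded I N s' :=
        (h.of_agree ((Agree.refl [rOut] [] s).setReg 0 (by simp))).of_agree hag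
      have ho' : Offsets s' :=
        (ho.of_agree ((Agree.refl [rOut] [] s).setReg 0 (by simp))).of_agree hag
      have htk : (t : ℤ) < I.k := by simpa [h.k] using ht
      obtain ⟨m', p1, p2, p3, p4, p5, p6⟩ := splitStep_spec h' ho' hN hB
        (by rw [hag.reg _ (by decide)]; simpa using hK)
        (by rw [hag.reg _ (by decide)]; simpa using hbig) (r := I.k - t) (by omega) g2
        (by
          intro x hx
          have := hCr x hx
          rw [sum_congr rfl (g3 x hx), sum_add_distrib, sum_comm (t := range t),
            sum_congr (s₁ := range t) rfl
              fun u hu => (g1 u (mem_range.1 hu)).row_sum x hx] at this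
          simp at this
          omega)
        (by
          intro y hy
          have := hCc y hy
          rw [sum_congr rfl (fun x hx => g3 x hx y hy), sum_add_distrib, sum_comm (t := range t),
            sum_congr (s₁ := range t) rfl
              fun u hu => (g1 u (mem_range.1 hu)).col_sum y hy] at this
          simp at this
          omega)
      refine ⟨by simp [p6, hO]; ring, Function.update m t m', ?_, ?_, ?_, ?_⟩
      · intro u hu
        by_cases hut : u = t
        · subst hut; simpa using p1
        · rw [Function.update_of_ne hut]; exact g1 u (by omega)
      · intro x hx y hy
        have := p2 x hx y hy
        simp only [State.setReg_mem, p3 x hx y hy]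
        omega
      · intro x hx y hy
        simp only [State.setReg_mem]
        have hsum : ∑ u ∈ range t, Function.update m t m' u x y = ∑ u ∈ range t, m u x y :=
          sum_congr rfl fun u hu => by
            rw [Function.update_of_ne (mem_range.1 hu).ne]
        rw [p3 x hx y hy, g3 x hx y hy, sum_range_succ, Function.update_self, hsum]
        ring
      · intro u hu e
        simp only [State.setReg_mem]
        by_cases hut : u = t
        · subst hut
          rw [Function.update_self, ← hO, p4]
        · rw [Function.update_of_ne hut, ← g4 u (by omega) e, p5]
          rw [hO]
          have h1 : ((e : ℕ) : ℤ) < I.numE := by exact_mod_cast e.2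
          have h2 : (u : ℤ) + 1 ≤ t := by omega
          nlinarith)
  have hden : decompose.den s = (FProg.forTo rT rk splitStep).den (s.setReg rOut 0) := rfl
  rw [← hden] at key
  have hk : ((s.setReg rOut 0).reg rk).toNat = I.k := by simp [h.k]
  rw [hk] at key
  obtain ⟨-, m, g1, g2, g3, g4⟩ := key
  refine ⟨m, g1, fun x hx y hy => ?_, g4⟩
  -- After `k` steps all row sums of the remaining matrix vanish.
  have hrow : ∑ y ∈ Ico N (2 * N), mat (2 * N) ((decompose.den s).mem aC) x y = 0 := by
    have := hCr x hx
    rw [sum_congr rfl (g3 x hx), sum_add_distrib, sum_comm (t := range I.k),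
      sum_congr (s₁ := range I.k) rfl
        fun u hu => (g1 u (mem_range.1 hu)).row_sum x hx] at this
    simpa using this
  rw [g3 x hx y hy, (sum_eq_zero_iff_of_nonneg (g2 x hx)).1 hrow y hy, zero_add]

end DiverseMatching

namespace DiverseMatching

variable {I : DiverseMatchingInstance} {N : ℤ}

/-! ### The algorithm -/

/-- Initialize the scalar registers. The register `rBad` becomes `1` if `p` exceeds the size of a
colour class. -/
def setup : FProg :=
  .assign rN (.sub (.add (.reg rA) (.reg rB)) (.reg rp)) ;;
  .assign rV (.add (.reg rN) (.reg rN)) ;;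
  .assign rK (.reg rk) ;;
  .assign rBig (.const 1) ;;
  .assign rBad (.const 0) ;;
  .ite (.lt (.reg rA) (.reg rp)) (.assign rBad (.const 1)) .skip ;;
  .ite (.lt (.reg rB) (.reg rp)) (.assign rBad (.const 1)) .skip

/-- Set up and solve the transportation problem, copy the solution to `aC`, and look for forbidden
pairs in it. -/
def solve : FProg :=
  offsets ;; addWeights ;; costs ;; transport ;;
  forPairs (.store aC (idx rX rY) (cell aRes rY rX)) ;;
  checkForbidden

/-- Prepare for transportation problems in which all supplies and demands are `1`. -/
def setUnit : FProg := .assign rK (.const 1) ;; .assign rBig (.const 1)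

/-- Write the family of matchings, and report in register `0` whether it is feasible. -/
def finish : FProg :=
  decompose ;; .ite (.eq (.reg rBad) (.const 0)) (.assign 0 (.const 1)) (.assign 0 (.const 0))

theorem TransportOpt.congr {K : ℤ} {G D c c' : ℤ → ℤ → ℤ} {π : ℤ → ℤ}
    (h : TransportOpt N K G D c π)
    (hc : ∀ x ∈ Ico 0 N, ∀ y ∈ Ico N (2 * N), c' x y = c x y) : TransportOpt N K G D c' π where
  nonneg x hx y hy := by rw [hc x hx y hy]; exact h.nonneg x hx y hy
  row_sum x hx := by rw [sum_congr rfl (hc x hx)]; exact h.row_sum x hx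
  col_sum y hy := by rw [sum_congr rfl fun x hx => hc x hx y hy]; exact h.col_sum y hy
  upper x hx y hy := by rw [hc x hx y hy]; exact h.upper x hx y hy
  lower x hx y hy := by rw [hc x hx y hy]; exact h.lower x hx y hy

theorem setup_loaded (I : DiverseMatchingInstance) :
    Loaded I (I.numA + I.numB - I.p) (setup.den I.input) := by
  have hag := agree_den setup I.input
  refine ⟨?_, ?_, ?_, ?_, ?_, ?_, fun e => ?_, fun e => ?_, fun e => ?_⟩
  · rw [hag.reg _ (by decide)]; rfl
  · rw [hag.reg _ (by decide)]; rfl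
  · rw [hag.reg _ (by decide)]; rfl
  · rw [hag.reg _ (by decide)]; rfl
  · by_cases h1 : (I.numA : ℤ) < I.p <;> by_cases h2 : (I.numB : ℤ) < I.p <;>
      simp [setup, DiverseMatchingInstance.input, h1, h2, -Nat.cast_lt]
  · by_cases h1 : (I.numA : ℤ) < I.p <;> by_cases h2 : (I.numB : ℤ) < I.p <;>
      simp [setup, DiverseMatchingInstance.input, h1, h2, -Nat.cast_lt, two_mul]
  all_goals
    rw [hag.mem _ (by decide)]
    simp [DiverseMatchingInstance.input]

theorem setup_spec (I : DiverseMatchingInstance) :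
    (setup.den I.input).reg rK = I.k ∧ (setup.den I.input).reg rBig = 1 ∧
    (setup.den I.input).reg rBad = if I.p ≤ I.numA ∧ I.p ≤ I.numB then 0 else 1 := by
  have e : I.p ≤ I.numA ∧ I.p ≤ I.numB ↔ ¬ (I.numA : ℤ) < I.p ∧ ¬ (I.numB : ℤ) < I.p := by
    omega
  rw [if_congr e rfl rfl]
  by_cases h1 : (I.numA : ℤ) < I.p <;> by_cases h2 : (I.numB : ℤ) < I.p <;>
    simp [setup, DiverseMatchingInstance.input, h1, h2, -Nat.cast_lt, -not_lt]

/-- The entry `(x, y)` of `aC` is the number of matchings that use the pair `x y`. -/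
theorem solve_spec (hw : ∀ e, 0 ≤ I.weight e) {s : State} (h : Loaded I N s)
    (hA : I.numA ≤ N) (hB : I.numB ≤ N) (hK : s.reg rK = I.k) (hbig : s.reg rBig = 1)
    (hbad : s.reg rBad = 0) :
    let s' := solve.den s
    ∃ F G D π, Costs I N (1 + I.k * I.k * ∑ e, I.weight e) F G D ∧
      TransportOpt N I.k G D (mat (2 * N) (s'.mem aC)) π ∧
      ((s'.reg rBad = 0 ∧ ∀ x ∈ Ico 0 N, ∀ y ∈ Ico N (2 * N), F x y = 1 →
        mat (2 * N) (s'.mem aC) x y = 0) ∨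
      (s'.reg rBad = 1 ∧ ∃ x ∈ Ico 0 N, ∃ y ∈ Ico N (2 * N), F x y = 1 ∧
        0 < mat (2 * N) (s'.mem aC) x y)) := by
  have hN : 0 ≤ N := by omega
  have hW : 0 ≤ ∑ e, I.weight e := sum_nonneg fun e _ => hw e
  have hsub : Ico 0 N ⊆ Ico 0 (2 * N) := Ico_subset_Ico_right (by omega)
  have hsub' : Ico N (2 * N) ⊆ Ico 0 (2 * N) := Ico_subset_Ico_left hN
  have a1 := agree_den offsets s
  have ho1 := offsets_spec s
  set s1 := offsets.den s with hs1
  have h1 := h.of_agree a1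
  have a2 := agree_den addWeights s1
  have w2 := addWeights_spec h1
  set s2 := addWeights.den s1 with hs2
  have h2 := h1.of_agree a2
  have ho2 : Offsets s2 := ho1.of_agree a2
  have a3 := agree_den costs s2
  have hC := costs_spec h2 ho2 hA hB
  rw [w2, a1.reg _ (by decide), hbig] at hC
  set s3 := costs.den s2 with hs3
  simp only at hC
  have h3 := h2.of_agree a3
  have ho3 : Offsets s3 := ho2.of_agree a3
  have hbig3 : s3.reg rBig = 1 + I.k * I.k * ∑ e, I.weight e := by
    rw [a3.reg _ (by decide), w2, a1.reg _ (by decide), hbig]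
  obtain ⟨π, hπ⟩ := transport_spec hN (by omega : (0 : ℤ) ≤ I.k) h3.rows h3.nodes
    (by rw [a3.reg _ (by decide), a2.reg _ (by decide), a1.reg _ (by decide), hK]) ho3
    (fun _ _ _ _ => rfl) (fun _ _ _ _ => rfl)
    (by
      intro x hx y hy
      rw [hbig3]
      by_cases he : ∃ e, rowOf I e = x ∧ colOf I N e = y
      · obtain ⟨e, rfl, rfl⟩ := he
        rw [hC.edge_G]
        have h1 : I.weight e ≤ ∑ e, I.weight e := single_le_sum (fun e _ => hw e) (mem_univ e)
        have h2 : (1 : ℤ) ≤ I.k := by exact_mod_cast I.k_pos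
        nlinarith [hw e, mul_le_mul_of_nonneg_left h1 (by positivity : (0 : ℤ) ≤ I.k * I.k),
          mul_nonneg (mul_nonneg (by omega : (0 : ℤ) ≤ I.k) (by omega : (0 : ℤ) ≤ I.k - 1)) (hw e)]
      · rw [hC.other_G x hx y hy (not_exists.1 he)]
        have : 0 ≤ (I.k : ℤ) * I.k * ∑ e, I.weight e := by positivity
        split_ifs <;> omega)
    (by
      intro x hx y hy
      by_cases he : ∃ e, rowOf I e = x ∧ colOf I N e = y
      · obtain ⟨e, rfl, rfl⟩ := he
        rw [hC.edge_D]
        have := hw e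
        omega
      · rw [hC.other_D x hx y hy (not_exists.1 he)])
  have a4 := agree_transport s3
  set s4 := transport.den s3 with hs4
  have h4 := h3.of_agree a4
  have ho4 : Offsets s4 := ho3.of_agree a4
  obtain ⟨a5, b5⟩ := forPairs_spec (a := aC) (s := s4) (n := 2 * N)
    (P := .store aC (idx rX rY) (cell aRes rY rX)) h4.nodes ho4 (by decide)
    (fun x y => mat (2 * N) (s4.mem aRes) y x) (by
      intro i j s' _ _ oi oj hag hx hy _
      have e1 := hag.mem aRes (by decide)
      simp [hx, hy, oi, oj, e1, mat])
  set s5 := (forPairs (.store aC (idx rX rY) (cell aRes rY rX))).den s4 with hs5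
  have h5 := h4.of_agree a5
  have ho5 : Offsets s5 := ho4.of_agree a5
  have a6 := agree_den checkForbidden s5
  have hbad5 : s5.reg rBad = 0 := by
    rw [a5.reg _ (by decide), a4.reg _ (by decide), a3.reg _ (by decide), a2.reg _ (by decide),
      a1.reg _ (by decide), hbad]
  have hF5 : s5.mem aF = s3.mem aF := by rw [a5.mem _ (by decide), a4.mem _ (by decide)]
  have hR5 : s5.mem aRes = s4.mem aRes := a5.mem _ (by decide)
  have hcheck := (checkForbidden_spec h5.rows h5.nodes ho5).2 hbad5
  have hden : solve.den s = checkForbidden.den s5 := rfl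
  have hC6 : (solve.den s).mem aC = s5.mem aC := by rw [hden, a6.mem _ (by decide)]
  rw [← hden, hF5, hR5] at hcheck
  have hval : ∀ x ∈ Ico 0 N, ∀ y ∈ Ico N (2 * N), mat (2 * N) ((solve.den s).mem aC) x y =
      mat (2 * N) (s4.mem aRes) y x := fun x hx y hy => by
    rw [hC6]; exact b5 x (hsub hx) y (hsub' hy)
  refine ⟨_, _, _, π, hC, hπ.congr hval, hcheck.imp ?_ ?_⟩
  · rintro ⟨g1, g2⟩
    refine ⟨g1, fun x hx y hy h => ?_⟩
    rw [hval x hx y hy]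
    exact le_antisymm (g2 x hx y hy h) (hπ.nonneg x hx y hy)
  · rintro ⟨g1, x, hx, y, hy, g2, g3⟩
    exact ⟨g1, x, hx, y, hy, g2, by rwa [hval x hx y hy]⟩

/-- Bad inputs stay bad. -/
theorem solve_bad {s : State} (h : Loaded I N s) (hbad : s.reg rBad = 1) :
    (solve.den s).reg rBad = 1 := by
  set s5 := (offsets ;; addWeights ;; costs ;; transport ;;
    forPairs (.store aC (idx rX rY) (cell aRes rY rX))).den s with hs5
  have a5 : Agree _ _ s s5 := agree_den _ s
  have h5 := h.of_agree a5
  have ho5 : Offsets s5 := by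
    have := offsets_spec s
    have a := agree_den (addWeights ;; costs ;; transport ;;
      forPairs (.store aC (idx rX rY) (cell aRes rY rX))) (offsets.den s)
    exact this.of_agree a
  exact (checkForbidden_spec h5.rows h5.nodes ho5).1 (by rw [a5.reg _ (by decide), hbad])

theorem finish_reg (s : State) :
    (finish.den s).reg 0 = if s.reg rBad = 0 then 1 else 0 := by
  have a := (agree_den decompose s).reg rBad (by decide)
  by_cases h : s.reg rBad = 0 <;> simp [finish, a, h]

/-- The algorithm solves every instance. -/
theorem correct_den (hw : ∀ e, 0 ≤ I.weight e) :
    I.Correct (finish.den (setUnit.den (solve.den (setup.den I.input)))) := by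
  have h0 := setup_loaded I
  obtain ⟨hK, hbig, hbad⟩ := setup_spec I
  set s0 := setup.den I.input with hs0
  set s1 := solve.den s0 with hs1
  have a1 : Agree _ _ s0 s1 := agree_den solve s0
  have a2 := agree_den setUnit s1
  set s2 := setUnit.den s1 with hs2
  have hbad2 : s2.reg rBad = s1.reg rBad := a2.reg _ (by decide)
  by_cases hp : I.p ≤ I.numA ∧ I.p ≤ I.numB
  · rw [if_pos hp] at hbad
    obtain ⟨hpA, hpB⟩ := hp
    obtain ⟨F, G, D, π, hC, hopt, hcase⟩ := solve_spec hw h0 (by omega) (by omega) hK hbig hbad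
    rw [← hs1] at hopt hcase
    rcases hcase with ⟨hb, hF⟩ | ⟨hb, x, hx, y, hy, hF, hc⟩
    · refine .inl ⟨by rw [finish_reg, hbad2, hb]; rfl, ?_⟩
      have h2 := (h0.of_agree a1).of_agree a2
      have ho2 : Offsets s2 := by
        have := offsets_spec s0
        have a := agree_den (addWeights ;; costs ;; transport ;;
          forPairs (.store aC (idx rX rY) (cell aRes rY rX)) ;; checkForbidden) (offsets.den s0)
        exact (this.of_agree a).of_agree a2
      have hC2 : s2.mem aC = s1.mem aC := a2.mem _ (by decide)
      obtain ⟨m, m1, m2, m3⟩ := decompose_spec h2 ho2 (by omega) (by omega) (by simp [hs2, setUnit])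
        (by simp [hs2, setUnit]) (by rw [hC2]; exact hopt.nonneg) (by rw [hC2]; exact hopt.row_sum)
        (by rw [hC2]; exact hopt.col_sum)
      rw [hC2] at m2
      refine isOptimal_of_decomposition hw hpA hpB rfl ?_ hC hopt hF m1 m2 fun t e => ?_
      · have : 0 ≤ ∑ e, I.weight e := sum_nonneg fun e _ => hw e
        positivity
      · have hOut : (finish.den s2).mem aOut = (decompose.den s2).mem aOut :=
          (agree_den (.ite (.eq (.reg rBad) (.const 0)) (.assign 0 (.const 1))
            (.assign 0 (.const 0))) (decompose.den s2)).mem _ (by decide)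
        rw [← m3 t t.2 e, ← hOut]
        simp [DiverseMatchingInstance.output]
    · refine .inr ⟨by rw [finish_reg, hbad2, hb]; rfl, fun M => ?_⟩
      exact not_isFeasible_of_forbidden hw hpA hpB rfl rfl hC hopt hx hy hF hc M
  · rw [if_neg hp] at hbad
    refine .inr ⟨by rw [finish_reg, hbad2, solve_bad h0 hbad]; rfl, fun M hM => hp ?_⟩
    have h := hM ⟨0, I.k_pos⟩
    rw [← h.2]
    exact ⟨card_le_numA h.1, card_le_numB h.1⟩

/-- The registers that bound loops. -/
def bounds : List ℕ := [rE, rk, rN, rV, rK]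

theorem setup_bounds (I : DiverseMatchingInstance) :
    ∀ r ∈ bounds, (setup.den I.input).reg r ≤ (2 * I.size + 1 : ℕ) := by
  have h := setup_loaded I
  have hs : I.numA + I.numB + I.numE + I.k ≤ I.size := by
    unfold DiverseMatchingInstance.size; omega
  simp only [bounds, List.forall_mem_cons, h.numE, h.k, h.rows, h.nodes, (setup_spec I).1]
  push_cast
  refine ⟨by omega, by omega, by omega, by omega, by omega, by simp⟩

theorem setUnit_bounds (s : State) {B : ℕ} (hB : 1 ≤ B) (h : ∀ r ∈ bounds, s.reg r ≤ B) :
    ∀ r ∈ bounds, (setUnit.den s).reg r ≤ B := by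
  intro r hr
  by_cases h1 : r = rK
  · subst h1; simp [setUnit]; exact_mod_cast hB
  · by_cases h2 : r = rBig
    · subst h2; simp [setUnit]; exact_mod_cast hB
    · simpa [setUnit, h1, h2] using h r hr

/-- The program that solves Diverse Bipartite Matchings. -/
def algorithm : Prog :=
  .seq setup.compile (.seq solve.compile (.seq setUnit.compile finish.compile))

/-- The bound for the number of steps, in terms of the size of the instance. -/
noncomputable def stepBound : Polynomial ℕ :=
  (setup.time + (solve.time + (setUnit.time + finish.time))).comp (2 * Polynomial.X + 1)

/-- The running time is polynomial because every loop bound is linear in the size of the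
instance. -/
theorem exists_exec (I : DiverseMatchingInstance) :
    ∃ t ≤ stepBound.eval I.size,
      Exec algorithm I.input t (finish.den (setUnit.den (solve.den (setup.den I.input)))) := by
  have hsolve : solve.WF bounds := by decide
  have hfinish : finish.WF bounds := by decide
  have b0 := setup_bounds I
  set B := 2 * I.size + 1 with hB
  have b1 : ∀ r ∈ bounds, (solve.den (setup.den I.input)).reg r ≤ B := fun r hr => by
    rw [(agree_den solve _).reg r (not_mem_writes_of_WF hsolve r hr)]
    exact b0 r hr
  obtain ⟨t0, l0, e0⟩ := exec_compile (L := []) (P := setup) (by decide) B I.input (by simp)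
  obtain ⟨t1, l1, e1⟩ := exec_compile hsolve B _ b0
  obtain ⟨t2, l2, e2⟩ := exec_compile (L := []) (P := setUnit) (by decide) B
    (solve.den (setup.den I.input)) (by simp)
  obtain ⟨t3, l3, e3⟩ := exec_compile hfinish B _ (setUnit_bounds _ (by omega) b1)
  refine ⟨t0 + (t1 + (t2 + t3)), ?_, .seq e0 (.seq e1 (.seq e2 e3))⟩
  simp only [stepBound, Polynomial.eval_comp, Polynomial.eval_add, Polynomial.eval_mul,
    Polynomial.eval_X, Polynomial.eval_ofNat, Polynomial.eval_one]
  rw [← hB]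
  omega

end DiverseMatching

theorem mainTheorem3 :
    ∃ (P : RAM.Prog) (q : Polynomial ℕ),
      ∀ I : DiverseMatchingInstance, (∀ e, 0 ≤ I.weight e) →
        ∃ (t : ℕ) (s : RAM.State),
          RAM.Exec P I.input t s ∧ t ≤ q.eval I.size ∧ I.Correct s := by
  refine ⟨DiverseMatching.algorithm, DiverseMatching.stepBound, fun I hw => ?_⟩
  obtain ⟨t, ht, hexec⟩ := DiverseMatching.exists_exec I
  exact ⟨t, _, hexec, ht, DiverseMatching.correct_den hw⟩
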